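/- Let $\mathbb S=\mathbb R+i(-\pi,0)$. The Hardy space $H^2(\mathbb S)$ consists of the analytic functions $\xi$ on $\mathbb S$ whose norms $\|\xi(\cdot+i\lambda)\|_{L^2(\mathbb R)}$ are bounded uniformly in $\lambda\in(-\pi,0)$. Such $\xi$ have $L^2$ boundary values $\xi(\theta)$ (as $\lambda\uparrow 0$) and $\xi(\theta-\pi i)$ (as $\lambda\downarrow-\pi$), and $H^2(\mathbb S)$ is regarded as a subspace of $L^2(\mathbb R)$ through $\xi\mapsto\xi(\theta)$. Let $\Delta^{1/2}$ be the operator on $L^2(\mathbb R)$ with domain $H^2(\mathbb S)$ and $(\Delta^{1/2}\xi)(\theta)=\xi(\theta-\pi i)$; let $M_g$ denote multiplication by $g\in L^\infty(\mathbb R)$. Bounded analytic functions on $\mathbb S$ have boundary values at almost every $\theta$ and $\theta-\pi i$ (vertical limits), and for these $M_g$ means multiplication by $g(\theta)$. Let $h$ be a bounded analytic function on $\mathbb S$ with $\overline{h(\theta)}=h(\theta-\pi i)$ for almost every $\theta$, and suppose that there is $\delta>0$ with $|h(\theta)|\ge\delta$ and $|h(\theta-\pi i)|\ge\delta$ for almost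 every $\theta$. Let $f=h^2$. Then the operator $A_f$ with domain $$\{\xi\in L^2(\mathbb R): h\xi\in H^2(\mathbb S)\}$$ (the product of the boundary value $h(\theta)$ with $\xi(\theta)$ is the boundary value on $\mathbb R$ of a function in $H^2(\mathbb S)$) and action $$(A_f\xi)(\theta)=f(\theta-\pi i)\,\xi(\theta-\pi i),\qquad \xi(\theta-\pi i):=\frac{(h\xi)(\theta-\pi i)}{h(\theta-\pi i)},$$ is well defined, self-adjoint, and extends $M_{\overline f}\Delta^{1/2}$. Moreover, $A_f$ coincides with the following canonical extension. The function $h$ has a Beurling factorization $h=c\,h_{\mathrm{Bl}}\,h_{\mathrm{in}}\,h_{\mathrm{out}}$ on $\mathbb S$, that is, $|c|=1$ and $$h_{\mathrm{Bl}}(\zeta)=\prod_j c_j\frac{e^\zeta-e^{\alpha_j}}{e^\zeta-e^{\overline{\alpha_j}}},\qquad h_{\mathrm{in}}(\zeta)=\exp\Big(i\int_{\mathbb R}\frac{1+e^\zeta s}{e^\zeta-s}\,d\nu(s)-i\,m\,e^\zeta\Big),\qquad h_{\mathrm{out}}(\zeta)=\exp\Big(-\frac i\pi\int_{\mathbb R}\frac{1+e^\zeta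 s}{e^\zeta-s}\,\frac{\log\phi(s)}{1+s^2}\,ds\Big),$$ with a finite or infinite family $\alpha_j\in\mathbb S$ satisfying $\sum_j(1-|\beta_j|)<\infty$ for $\beta_j=\frac{e^{\alpha_j}+i}{e^{\alpha_j}-i}$, with $c_j=-\frac{|\beta_j|}{\beta_j}\frac{\beta_j-1}{\overline{\beta_j}-1}$ ($c_j=1$ if $\alpha_j=-\frac{\pi i}2$), a finite measure $\nu$ on $\mathbb R$ singular with respect to Lebesgue measure, $m\ge0$ (the mass at $\infty$ of the singular measure), and $\phi>0$ with $\frac{\log\phi(s)}{1+s^2}\in L^1(\mathbb R)$. For every such factorization, put $$f_-(\zeta)=\exp\Big(-\frac i\pi\int_{-\infty}^0\frac{1+e^\zeta s}{e^\zeta-s}\,\frac{\log(\phi(s)^2)}{1+s^2}\,ds\Big).$$ Then $$A_f=(M_{h_{\mathrm{Bl}}}M_{h_{\mathrm{in}}}M_{f_-})^*\,\Delta^{1/2}\,M_{h_{\mathrm{Bl}}}M_{h_{\mathrm{in}}}M_{f_-}.$$ -/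

import Mathlib

open MeasureTheory Filter Topology

noncomputable section

namespace StripHardy

/-- The open strip `ℝ + i(-π, 0)`. -/
def strip : Set ℂ := {z | -Real.pi < z.im ∧ z.im < 0}

/-- The Hilbert space `L²(ℝ)`. -/
abbrev Hilb : Type := Lp ℂ 2 (volume : Measure ℝ)

/-- The restriction of `G` to the horizontal line at height `y`. -/
def slice (G : ℂ → ℂ) (y : ℝ) : ℝ → ℂ := fun x => G ((x : ℂ) + (y : ℂ) * Complex.I)

/-! ### Boundary values -/

/-- The pointwise boundary value `g(θ)` on `ℝ`, the limit of `g(θ + iy)` as `y ↑ 0`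
(for bounded analytic `g` it exists for almost every `θ`). -/
def upperValue (g : ℂ → ℂ) (θ : ℝ) : ℂ := limUnder (𝓝[<] (0 : ℝ)) fun y => slice g y θ

/-- The pointwise boundary value `g(θ - πi)` on `ℝ - πi`, the limit of `g(θ + iy)` as `y ↓ -π`
(for bounded analytic `g` it exists for almost every `θ`). -/
def lowerValue (g : ℂ → ℂ) (θ : ℝ) : ℂ := limUnder (𝓝[>] (-Real.pi)) fun y => slice g y θ

/-- `b` is the boundary value of `G` on `ℝ` in the sense of `L²(ℝ)`. -/
def HasUpperL2Value (G : ℂ → ℂ) (b : ℝ → ℂ) : Prop :=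
  Tendsto (fun y : ℝ => eLpNorm (slice G y - b) 2 volume) (𝓝[<] (0 : ℝ)) (𝓝 0)

/-- `b` is the boundary value of `G` on `ℝ - πi` in the sense of `L²(ℝ)`. -/
def HasLowerL2Value (G : ℂ → ℂ) (b : ℝ → ℂ) : Prop :=
  Tendsto (fun y : ℝ => eLpNorm (slice G y - b) 2 volume) (𝓝[>] (-Real.pi)) (𝓝 0)

/-! ### The Hardy space of the strip and the operator of analytic continuation -/

/-- `G` belongs to the Hardy space `H²` of the strip: it is analytic there and its horizontal
`L²` norms are uniformly bounded. -/
structure IsHardy (G : ℂ → ℂ) : Prop where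
  analytic : DifferentiableOn ℂ G strip
  bounded : ∃ C : NNReal, ∀ y ∈ Set.Ioo (-Real.pi) 0, eLpNorm (slice G y) 2 volume ≤ C

lemma continuous_slice {G : ℂ → ℂ} (hG : DifferentiableOn ℂ G strip) {y : ℝ}
    (hy : y ∈ Set.Ioo (-Real.pi) 0) : Continuous (slice G y) := by
  refine hG.continuousOn.comp_continuous (by fun_prop) fun x => ?_
  simpa [strip] using hy

lemma IsHardy.zero : IsHardy 0 :=
  ⟨differentiableOn_const 0, 0, fun y _ => by
    have : slice 0 y = 0 := rfl
    simp [this]⟩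

lemma IsHardy.add {G K : ℂ → ℂ} (hG : IsHardy G) (hK : IsHardy K) : IsHardy (G + K) := by
  obtain ⟨C, hC⟩ := hG.bounded
  obtain ⟨D, hD⟩ := hK.bounded
  refine ⟨hG.analytic.add hK.analytic, C + D, fun y hy => ?_⟩
  calc eLpNorm (slice (G + K) y) 2 volume
      ≤ eLpNorm (slice G y) 2 volume + eLpNorm (slice K y) 2 volume :=
        eLpNorm_add_le (continuous_slice hG.analytic hy).aestronglyMeasurable
          (continuous_slice hK.analytic hy).aestronglyMeasurable (by norm_num)
    _ ≤ C + D := add_le_add (hC y hy) (hD y hy)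
    _ = ((C + D : NNReal) : ENNReal) := by push_cast; rfl

lemma IsHardy.smul {G : ℂ → ℂ} (hG : IsHardy G) (c : ℂ) : IsHardy (c • G) := by
  obtain ⟨C, hC⟩ := hG.bounded
  refine ⟨hG.analytic.const_smul c, ‖c‖₊ * C, fun y hy => ?_⟩
  have : slice (c • G) y = c • slice G y := rfl
  rw [this, eLpNorm_const_smul, ENNReal.coe_mul]
  exact mul_le_mul_right (hC y hy) _

lemma upper_mem : ∀ᶠ y : ℝ in 𝓝[<] (0 : ℝ), y ∈ Set.Ioo (-Real.pi) 0 :=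
  Ioo_mem_nhdsLT (by linarith [Real.pi_pos])

lemma lower_mem : ∀ᶠ y : ℝ in 𝓝[>] (-Real.pi), y ∈ Set.Ioo (-Real.pi) 0 :=
  Ioo_mem_nhdsGT (by linarith [Real.pi_pos])

lemma l2Value_add {l : Filter ℝ} (hl : ∀ᶠ y in l, y ∈ Set.Ioo (-Real.pi) 0)
    {G K : ℂ → ℂ} (hG : IsHardy G) (hK : IsHardy K) {a b : Hilb}
    (ha : Tendsto (fun y : ℝ => eLpNorm (slice G y - ⇑a) 2 volume) l (𝓝 0))
    (hb : Tendsto (fun y : ℝ => eLpNorm (slice K y - ⇑b) 2 volume) l (𝓝 0)) :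
    Tendsto (fun y : ℝ => eLpNorm (slice (G + K) y - ⇑(a + b)) 2 volume) l (𝓝 0) := by
  have hsum := ha.add hb
  rw [add_zero] at hsum
  refine tendsto_of_tendsto_of_tendsto_of_le_of_le' tendsto_const_nhds hsum
    (Eventually.of_forall fun _ => zero_le) ?_
  filter_upwards [hl] with y hy
  have e : slice (G + K) y - ⇑(a + b) =ᵐ[volume] (slice G y - ⇑a) + (slice K y - ⇑b) := by
    filter_upwards [Lp.coeFn_add a b] with x hx
    simp only [Pi.sub_apply, Pi.add_apply, hx]
    simp only [slice, Pi.add_apply]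
    ring
  rw [eLpNorm_congr_ae e]
  exact eLpNorm_add_le
    ((continuous_slice hG.analytic hy).aestronglyMeasurable.sub (Lp.aestronglyMeasurable a))
    ((continuous_slice hK.analytic hy).aestronglyMeasurable.sub (Lp.aestronglyMeasurable b))
    (by norm_num)

lemma l2Value_smul {l : Filter ℝ} {G : ℂ → ℂ} (c : ℂ) {a : Hilb}
    (ha : Tendsto (fun y : ℝ => eLpNorm (slice G y - ⇑a) 2 volume) l (𝓝 0)) :
    Tendsto (fun y : ℝ => eLpNorm (slice (c • G) y - ⇑(c • a)) 2 volume) l (𝓝 0) := by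
  have e : ∀ y, eLpNorm (slice (c • G) y - ⇑(c • a)) 2 volume
      = ‖c‖ₑ * eLpNorm (slice G y - ⇑a) 2 volume := fun y => by
    rw [← eLpNorm_const_smul]
    refine eLpNorm_congr_ae ?_
    filter_upwards [Lp.coeFn_smul c a] with x hx
    simp only [Pi.sub_apply, Pi.smul_apply, hx, slice, smul_eq_mul]
    ring
  simp only [e]
  simpa using ENNReal.Tendsto.const_mul ha (Or.inr (by simp))

lemma l2Value_zero {l : Filter ℝ} :
    Tendsto (fun y : ℝ => eLpNorm (slice 0 y - ⇑(0 : Hilb)) 2 volume) l (𝓝 0) := by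
  have e : ∀ y, eLpNorm (slice 0 y - ⇑(0 : Hilb)) 2 volume = 0 := fun y => by
    rw [← eLpNorm_zero (ε := ℂ) (p := 2) (μ := (volume : Measure ℝ))]
    refine eLpNorm_congr_ae ?_
    filter_upwards [Lp.coeFn_zero ℂ 2 (volume : Measure ℝ)] with x hx
    simp only [Pi.sub_apply, hx, slice, Pi.zero_apply, sub_zero]
  simp only [e]
  exact tendsto_const_nhds

/-- The pairs `(ξ(·), ξ(· - πi))` of boundary values of functions `ξ` of the Hardy space. -/
def continuationGraph : Submodule ℂ (Hilb × Hilb) where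
  carrier := {p | ∃ G : ℂ → ℂ, IsHardy G ∧ HasUpperL2Value G p.1 ∧ HasLowerL2Value G p.2}
  zero_mem' := ⟨0, IsHardy.zero, l2Value_zero, l2Value_zero⟩
  add_mem' := by
    rintro p q ⟨G, hG, hG1, hG2⟩ ⟨K, hK, hK1, hK2⟩
    exact ⟨G + K, hG.add hK, l2Value_add upper_mem hG hK hG1 hK1,
      l2Value_add lower_mem hG hK hG2 hK2⟩
  smul_mem' := by
    rintro c p ⟨G, hG, hG1, hG2⟩
    exact ⟨c • G, hG.smul c, l2Value_smul c hG1, l2Value_smul c hG2⟩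

/-- The operator `Δ^{1/2}`: its domain is the Hardy space, seen in `L²(ℝ)` through the boundary
values on `ℝ`, and `(Δ^{1/2} ξ)(θ) = ξ(θ - πi)`. -/
def DeltaHalf : Hilb →ₗ.[ℂ] Hilb := continuationGraph.toLinearPMap

/-! ### Multiplication operators and products -/

open Classical in
/-- The operator `M_g` on `L²(ℝ)` of multiplication by an essentially bounded function `g`
(`0` if `g` is not in `L^∞`). -/
def mulOp (g : ℝ → ℂ) : Hilb →L[ℂ] Hilb :=
  if hg : MemLp g ⊤ (volume : Measure ℝ) then
    (ContinuousLinearMap.mul ℂ ℂ).holderL volume ⊤ 2 2 (hg.toLp g)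
  else 0

lemma mulOp_apply {g : ℝ → ℂ} (hg : MemLp g ⊤ (volume : Measure ℝ)) (ξ : Hilb) :
    mulOp g ξ =ᵐ[volume] fun θ => g θ * ξ θ := by
  rw [mulOp, dif_pos hg]
  refine ((ContinuousLinearMap.mul ℂ ℂ).coeFn_holder (r := 2) (hg.toLp g) ξ).trans ?_
  filter_upwards [hg.coeFn_toLp] with θ hθ
  simp [hθ]

/-- The product `T U` of an unbounded operator `T` and a bounded operator `U`, with its natural
domain `{ξ | U ξ ∈ dom T}`. -/
def compBounded (T : Hilb →ₗ.[ℂ] Hilb) (U : Hilb →L[ℂ] Hilb) : Hilb →ₗ.[ℂ] Hilb where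
  domain := T.domain.comap U.toLinearMap
  toFun :=
    { toFun := fun ξ => T ⟨U ξ, ξ.2⟩
      map_add' := fun ξ η => by
        rw [← T.map_add]; congr 1; ext1; simp
      map_smul' := fun c ξ => by
        rw [RingHom.id_apply, ← T.map_smul]; congr 1; ext1; simp }

/-- The operator `M_{f̄} Δ^{1/2}`, where `f̄` is the conjugate of the boundary value of `f` on
`ℝ`. -/
def boundStateOp (f : ℂ → ℂ) : Hilb →ₗ.[ℂ] Hilb :=
  (mulOp fun θ => starRingEnd ℂ (upperValue f θ)).toLinearMap.compPMap DeltaHalf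

/-! ### The Beurling factorization -/

/-- The point of the unit disk that corresponds to `α` in the strip. -/
def diskPoint (α : ℂ) : ℂ := (Complex.exp α + Complex.I) / (Complex.exp α - Complex.I)

open Classical in
/-- The normalizing constant of a Blaschke factor (`1` for `α = -πi/2`). -/
def blaschkeConst (α : ℂ) : ℂ :=
  if diskPoint α = 0 then 1
  else -((‖diskPoint α‖ : ℂ) / diskPoint α) *
    ((diskPoint α - 1) / (starRingEnd ℂ (diskPoint α) - 1))

/-- The Blaschke product with zeros `α j` (repeated according to multiplicity). -/
def blaschkeProduct {ι : Type} (α : ι → ℂ) (ζ : ℂ) : ℂ :=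
  ∏' j, blaschkeConst (α j) * ((Complex.exp ζ - Complex.exp (α j)) /
    (Complex.exp ζ - Complex.exp (starRingEnd ℂ (α j))))

/-- The kernel `(1 + e^ζ s) / (e^ζ - s)`. -/
def kernel (ζ : ℂ) (s : ℝ) : ℂ := (1 + Complex.exp ζ * s) / (Complex.exp ζ - s)

/-- The singular inner function of the measure on `ℝ ∪ {∞}` whose part on `ℝ` is `ν` and whose
mass at `∞` is `m`; the value of the kernel at `s = ∞` is its limit `-e^ζ`. -/
def singularInner (ν : Measure ℝ) (m : ℝ) (ζ : ℂ) : ℂ :=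
  Complex.exp (Complex.I * ((∫ s, kernel ζ s ∂ν) + (m : ℂ) * -Complex.exp ζ))

/-- The exponential of the Poisson type integral of `log φ` over a set `S ⊆ ℝ`. -/
def outerOn (S : Set ℝ) (φ : ℝ → ℝ) (ζ : ℂ) : ℂ :=
  Complex.exp (-(Complex.I / Real.pi) *
    ∫ s in S, kernel ζ s * ((Real.log (φ s) / (1 + s ^ 2) : ℝ) : ℂ))

/-- The outer function with boundary modulus `φ`: `φ (e^θ)` at `θ` and `φ (-e^θ)` at `θ - πi`. -/
def outerFun (φ : ℝ → ℝ) : ℂ → ℂ := outerOn Set.univ φ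

/-- The part over `s < 0` of the outer function with boundary modulus `φ`. -/
def outerMinus (φ : ℝ → ℝ) : ℂ → ℂ := outerOn (Set.Iio 0) φ

/-- The data of a Beurling factorization `h = c h_Bl h_in h_out` on the strip. -/
structure BeurlingFactorization (h : ℂ → ℂ) where
  /-- the unimodular constant -/
  c : ℂ
  norm_c : ‖c‖ = 1
  /-- the index set of the zeros -/
  ι : Type
  /-- the zeros -/
  α : ι → ℂ
  α_mem : ∀ j, α j ∈ strip
  blaschke_condition : Summable fun j => 1 - ‖diskPoint (α j)‖
  /-- the finite part of the singular measure -/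
  ν : Measure ℝ
  finite_ν : IsFiniteMeasure ν
  singular_ν : ν.MutuallySingular volume
  /-- the mass of the singular measure at infinity -/
  m : ℝ
  m_nonneg : 0 ≤ m
  /-- the boundary modulus -/
  φ : ℝ → ℝ
  φ_pos : ∀ s, 0 < φ s
  φ_integrable : Integrable (fun s => Real.log (φ s) / (1 + s ^ 2)) volume
  factorization : ∀ ζ ∈ strip,
    h ζ = c * blaschkeProduct α ζ * singularInner ν m ζ * outerFun φ ζ

namespace BeurlingFactorization

variable {h : ℂ → ℂ} (B : BeurlingFactorization h)

/-- The operator `U = M_{h_Bl} M_{h_in} M_{f_-}` for `f = h²`; the outer part of `f` has the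
boundary modulus `φ²`, and `f_-` is its part over `s < 0`. -/
def intertwiner : Hilb →L[ℂ] Hilb :=
  mulOp (upperValue (blaschkeProduct B.α)) ∘L mulOp (upperValue (singularInner B.ν B.m)) ∘L
    mulOp (upperValue (outerMinus fun s => B.φ s ^ 2))

/-- The canonical extension `U* Δ^{1/2} U` of `M_{f̄} Δ^{1/2}` for `f = h²`. -/
def canonicalExtension : Hilb →ₗ.[ℂ] Hilb :=
  (ContinuousLinearMap.adjoint B.intertwiner).toLinearMap.compPMap
    (compBounded DeltaHalf B.intertwiner)

end BeurlingFactorization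

end StripHardy

end

noncomputable section

namespace StripHardy

open scoped FourierTransform SchwartzMap InnerProductSpace ENNReal NNReal BoundedContinuousFunction

/-! ### The Fourier transform on `L²(ℝ)` -/

/-! The operator is `A = M_h* Δ^{1/2} M_h`, called `extension h`. Its domain is the required one
because a Hardy function automatically has a lower boundary value. Since the conjugate of `h(θ)` is
`h(θ - πi)`, applying `M_h*` to the lower value `b` of `hξ` gives `h(θ - πi) b = f(θ - πi) · b / h(θ
- πi)`. For `ξ` itself in `H²` this is `f̄(θ) ξ(θ - πi)`, so `A` extends `M_{f̄} Δ^{1/2}`.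

Self-adjointness comes from the Fourier transform, which turns `Δ^{1/2}` into multiplication by the
positive function `exp (2π²k)` on its maximal domain (`mem_continuationGraph_iff`,
`deltaHalf_isSelfAdjoint`). The lower bound on `|h|` makes `M_h` boundedly invertible, and `V* T V`
is self-adjoint when `T` is and `V` is invertible (`sandwich_isSelfAdjoint`).

For the canonical extension, `U = M_k` with `k = h_Bl h_in f_- = q h` and `q = c⁻¹ f_- / h_out`. If
`q` and `1/q` are bounded analytic and `conj (q(θ)) · q(θ - πi) = 1`, then `q` can be pulled through
`Δ^{1/2}` and cancels, so `h` and `k` define the same operator (`extension_eq`). The variable `w =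
e^ζ` maps the strip onto the lower half-plane, with `θ` going to `e^θ` and `θ - πi` to `-e^θ`.
Blaschke products and singular inner functions have boundary modulus `1`, so `φ` is the boundary
modulus of `h`. The symmetry of `h` makes `φ` even and the bounds on `h` make `log φ` bounded. Hence
`f_- / h_out` is the exponential of a Poisson type integral of an odd density, and the reflection `w
↦ -w̄` yields the identity for `q`.

Boundary values of bounded analytic functions rest on the Herglotz representation and the
differentiation of measures (`herglotz_strip`, `ae_tendsto_re`). The factorization exists because
the zeros can be divided out without increasing the bound (Schwarz lemma), the nonvanishing quotient
has a logarithm, and the Herglotz measure of that logarithm splits into a singular part (inner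
factor) and a density (outer factor): `nonempty_beurlingFactorization`. -/

/-- The Fourier transform on `L²(ℝ)`. -/
abbrev FT : Hilb ≃ₗᵢ[ℂ] Hilb := Lp.fourierTransformₗᵢ ℝ ℂ

/-- The abstract `L²` transform carries no pointwise formula. Both sides are tested against smooth
compactly supported functions: the distributional transform and Fubini each move the transform onto
the test function. -/
lemma FT_symm_ae {g : Hilb} (hg : Integrable g) :
    ⇑(FT.symm g) =ᵐ[volume]
      fun x : ℝ => ∫ k : ℝ, Complex.exp (2 * Real.pi * Complex.I * k * x) * g k := by
  have e0 : ∀ x : ℝ, 𝓕⁻ (g : ℝ → ℂ) x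
      = ∫ k : ℝ, Complex.exp (2 * Real.pi * Complex.I * k * x) * g k := fun x => by
    rw [Real.fourierInv_eq']
    refine integral_congr_ae (Eventually.of_forall fun k => ?_)
    simp only [smul_eq_mul]
    congr 2
    simp
    ring
  have hcont : Continuous (𝓕⁻ (g : ℝ → ℂ)) :=
    VectorFourier.fourierIntegral_continuous Real.continuous_fourierChar
      (show Continuous fun p : ℝ × ℝ => -(inner ℝ p.1 p.2) from continuous_inner.neg) hg
  have key : ∀ᵐ x : ℝ, FT.symm g x = 𝓕⁻ (g : ℝ → ℂ) x := by
    refine ae_eq_of_integral_contDiff_smul_eq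
      ((Lp.memLp (FT.symm g)).locallyIntegrable (by norm_num)) hcont.locallyIntegrable
      fun φ hφ hsupp => ?_
    have hsupp' : HasCompactSupport (fun x => (φ x : ℂ)) :=
      hsupp.comp_left (g := fun t : ℝ => (t : ℂ)) (by simp)
    set Φ : 𝓢(ℝ, ℂ) := hsupp'.toSchwartzMap (Complex.ofRealCLM.contDiff.comp hφ)
    have hΦ : ∀ x, Φ x = (φ x : ℂ) := fun x => rfl
    have h1 := congrArg (fun T => T Φ) (Lp.fourierInv_toTemperedDistribution_eq g)
    simp only [TemperedDistribution.fourierInv_apply, Lp.toTemperedDistribution_apply] at h1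
    have h2 := VectorFourier.integral_fourierIntegral_smul_eq_flip (μ := volume) (ν := volume)
      (L := -innerₗ ℝ) (f := (Φ : ℝ → ℂ)) (g := (g : ℝ → ℂ)) Real.continuous_fourierChar
      (show Continuous fun p : ℝ × ℝ => -(inner ℝ p.1 p.2) from continuous_inner.neg) Φ.integrable hg
    have h3 : (-innerₗ ℝ).flip = -innerₗ ℝ := by
      ext; simp
    rw [h3] at h2
    have h4 : ∫ x : ℝ, (𝓕⁻ Φ) x • g x = ∫ x : ℝ, Φ x • 𝓕⁻ (g : ℝ → ℂ) x := by
      rw [SchwartzMap.fourierInv_coe]; exact h2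
    rw [h4] at h1
    have e1 : ∀ u : ℝ → ℂ, ∫ x, φ x • u x = ∫ x, Φ x • u x := fun u => by
      simp only [hΦ, Complex.real_smul, smul_eq_mul]
    rw [e1, e1]
    exact h1.symm
  filter_upwards [key] with x hx
  rw [hx, e0]

lemma FT_inner (f g : Hilb) : ⟪FT f, FT g⟫_ℂ = ⟪f, g⟫_ℂ := FT.inner_map_map f g

lemma L2_inner (f g : Hilb) : ⟪f, g⟫_ℂ = ∫ x, starRingEnd ℂ (f x) * g x := by
  rw [MeasureTheory.L2.inner_def]
  exact integral_congr_ae (Eventually.of_forall fun x => by simp [mul_comm])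

lemma memLp_mul_of_bounded {m : ℝ → ℂ} (hm : AEStronglyMeasurable m volume) {C : ℝ}
    (hC : ∀ x, ‖m x‖ ≤ C) {g : ℝ → ℂ} (hg : MemLp g 2 (volume : Measure ℝ)) :
    MemLp (fun x => m x * g x) 2 (volume : Measure ℝ) :=
  hg.of_le_mul (c := C) (hm.mul hg.1) (Eventually.of_forall fun x => by
    rw [norm_mul]; gcongr; exact hC x)

lemma integrable_of_bounded_support {g : Hilb} {N : ℝ} (hN : ∀ᵐ k : ℝ, N < |k| → g k = 0) :
    Integrable (g : ℝ → ℂ) := by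
  have h1 : (g : ℝ → ℂ) =ᵐ[volume] (Set.Icc (-N) N).indicator g := by
    filter_upwards [hN] with k hk
    by_cases h : k ∈ Set.Icc (-N) N
    · rw [Set.indicator_of_mem h]
    · rw [Set.indicator_of_notMem h, hk]
      by_contra! h2
      exact h (abs_le.1 h2)
  refine Integrable.congr ?_ h1.symm
  rw [integrable_indicator_iff measurableSet_Icc]
  exact ((Lp.memLp g).restrict _).integrable (by norm_num)

/-- Pairing with a translate, for a vector of compactly supported Fourier transform. -/
lemma integral_conj_mul_translate {ψ : Hilb} {N : ℝ} (hN : ∀ᵐ k : ℝ, N < |k| → ψ k = 0)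
    (f : Hilb) (x : ℝ) :
    ∫ t, starRingEnd ℂ (FT.symm ψ t) * f (t + x)
      = ∫ k : ℝ, starRingEnd ℂ (ψ k) *
          (Complex.exp (2 * Real.pi * Complex.I * k * x) * FT f k) := by
  have hψ := integrable_of_bounded_support hN
  have hm : Continuous fun k : ℝ => Complex.exp (-(2 * Real.pi * Complex.I * k * x)) := by fun_prop
  have hb : ∀ k : ℝ, ‖Complex.exp (-(2 * Real.pi * Complex.I * k * x))‖ ≤ 1 := fun k => by
    rw [Complex.norm_exp]; simp
  -- Modulation by `exp (-2πikx)` translates the inverse transform by `x`, so the shift of `f` is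
  -- absorbed into `ψ`.
  set ψ' : Hilb := (memLp_mul_of_bounded hm.aestronglyMeasurable hb (Lp.memLp ψ)).toLp with hψ'
  have hψ'c : ⇑ψ' =ᵐ[volume] fun k : ℝ =>
      Complex.exp (-(2 * Real.pi * Complex.I * k * x)) * ψ k := MemLp.coeFn_toLp _
  have hψ'i : Integrable ψ' := by
    refine Integrable.congr ?_ hψ'c.symm
    exact hψ.bdd_mul hm.aestronglyMeasurable (Eventually.of_forall hb)
  have e1 : ∀ᵐ t : ℝ, FT.symm ψ' t = FT.symm ψ (t - x) := by
    have h2 := (measurePreserving_sub_right (volume : Measure ℝ) x).quasiMeasurePreserving.ae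
      (FT_symm_ae hψ)
    filter_upwards [FT_symm_ae hψ'i, h2] with t ht ht2
    rw [ht, ht2]
    refine integral_congr_ae ?_
    filter_upwards [hψ'c] with k hk
    rw [hk, ← mul_assoc, ← Complex.exp_add]
    congr 2
    push_cast
    ring
  calc ∫ t, starRingEnd ℂ (FT.symm ψ t) * f (t + x)
      = ∫ t, starRingEnd ℂ (FT.symm ψ (t - x)) * f t := by
        rw [← integral_add_right_eq_self
          (fun t => starRingEnd ℂ (FT.symm ψ (t - x)) * f t) x]
        simp only [add_sub_cancel_right]
    _ = ∫ t, starRingEnd ℂ (FT.symm ψ' t) * f t := by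
        refine integral_congr_ae ?_
        filter_upwards [e1] with t ht
        rw [ht]
    _ = ⟪ψ', FT f⟫_ℂ := by
        rw [← L2_inner, ← FT_inner, LinearIsometryEquiv.apply_symm_apply]
    _ = _ := by
        rw [L2_inner]
        refine integral_congr_ae ?_
        filter_upwards [hψ'c] with k hk
        rw [hk, map_mul, ← Complex.exp_conj]
        simp [map_ofNat]
        ring

/-! ### Analytic and measure-theoretic tools -/

lemma isOpen_strip : IsOpen strip :=
  (isOpen_lt continuous_const Complex.continuous_im).inter
    (isOpen_lt Complex.continuous_im continuous_const)

lemma convex_strip : Convex ℝ strip :=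
  (convex_halfSpace_im_gt _).inter (convex_halfSpace_im_lt _)

lemma mem_strip_iff {x y : ℝ} :
    (x : ℂ) + (y : ℂ) * Complex.I ∈ strip ↔ y ∈ Set.Ioo (-Real.pi) 0 := by
  simp [strip]

/-- Holomorphy under the integral with a local bound on `F` only: Cauchy's estimate on circles of
radius `ε / 3` supplies the bound on the derivative. -/
lemma differentiableOn_integral {α : Type*} [MeasurableSpace α] {μ : Measure α}
    {F : ℂ → α → ℂ} {U : Set ℂ} (hU : IsOpen U)
    (hmeas : ∀ z ∈ U, AEStronglyMeasurable (F z) μ)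
    (hdiff : ∀ᵐ t ∂μ, DifferentiableOn ℂ (fun z => F z t) U)
    (hbd : ∀ z₀ ∈ U, ∃ ε > 0, ∃ bound : α → ℝ, Integrable bound μ ∧
      ∀ᵐ t ∂μ, ∀ z ∈ Metric.ball z₀ ε, z ∈ U → ‖F z t‖ ≤ bound t) :
    DifferentiableOn ℂ (fun z => ∫ t, F z t ∂μ) U := by
  intro z₀ hz₀
  obtain ⟨ε', hε', bound, hint, hb⟩ := hbd z₀ hz₀
  obtain ⟨ε'', hε'', hsub⟩ := Metric.isOpen_iff.1 hU z₀ hz₀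
  set ε := min ε' ε'' with hεdef
  have hε : 0 < ε := lt_min hε' hε''
  have hsubU : Metric.ball z₀ ε ⊆ U := (Metric.ball_subset_ball (min_le_right _ _)).trans hsub
  have hsub' : Metric.ball z₀ ε ⊆ Metric.ball z₀ ε' := Metric.ball_subset_ball (min_le_left _ _)
  have hmem : ∀ n : ℕ, z₀ + ((ε / 2 / (n + 1) : ℝ) : ℂ) ∈ Metric.ball z₀ ε := fun n => by
    have h1 : (0 : ℝ) < n + 1 := by positivity
    rw [Metric.mem_ball, dist_eq_norm, add_sub_cancel_left, Complex.norm_real, Real.norm_eq_abs,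
      abs_of_pos (by positivity)]
    calc ε / 2 / (n + 1) ≤ ε / 2 / 1 := by
          gcongr
          have := n.cast_nonneg (α := ℝ)
          linarith
      _ < ε := by linarith
  have hlim : Tendsto (fun n : ℕ => z₀ + ((ε / 2 / (n + 1) : ℝ) : ℂ)) atTop (𝓝[≠] z₀) := by
    refine tendsto_nhdsWithin_iff.2 ⟨?_, Eventually.of_forall fun n => ?_⟩
    · have h1 : Tendsto (fun n : ℕ => ε / 2 / ((n : ℝ) + 1)) atTop (𝓝 0) :=
        tendsto_const_nhds.div_atTop (tendsto_natCast_atTop_atTop.atTop_add tendsto_const_nhds)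
      have h2 := (Complex.continuous_ofReal.tendsto 0).comp h1
      simpa using tendsto_const_nhds (x := z₀) |>.add h2
    · have h1 : (0 : ℝ) < ε / 2 / (n + 1) := by positivity
      simpa using ⟨hε.ne', (by positivity : (n : ℝ) + 1 ≠ 0) |> fun h => by exact_mod_cast h⟩
  have hd : ∀ᵐ t ∂μ, ∀ z ∈ Metric.ball z₀ ε, HasDerivAt (fun z => F z t)
      (deriv (fun z => F z t) z) z := by
    filter_upwards [hdiff] with t ht z hz
    exact (ht.differentiableAt (hU.mem_nhds (hsubU hz))).hasDerivAt
  refine (hasDerivAt_integral_of_dominated_loc_of_deriv_le (μ := μ) (F := F)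
    (F' := fun z t => deriv (fun z => F z t) z) (bound := fun t => bound t / (ε / 3))
    (Metric.ball_mem_nhds z₀ (half_pos hε)) ?_ ?_ ?_ ?_ (hint.div_const _)
    ?_).2.differentiableAt.differentiableWithinAt
  · filter_upwards [hU.mem_nhds hz₀] with z hz using hmeas z hz
  · refine hint.mono' (hmeas z₀ hz₀) ?_
    filter_upwards [hb] with t ht using ht z₀ (Metric.mem_ball_self hε') hz₀
  · refine aestronglyMeasurable_of_tendsto_ae atTop
      (f := fun (n : ℕ) t => slope (fun z => F z t) z₀ (z₀ + ((ε / 2 / (n + 1) : ℝ) : ℂ)))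
      (fun n => ?_) ?_
    · simp only [slope_def_field]
      exact ((hmeas _ (hsubU (hmem n))).sub (hmeas z₀ hz₀)).mul aestronglyMeasurable_const |>.congr
        (Eventually.of_forall fun t => (div_eq_mul_inv _ _).symm)
    · filter_upwards [hd] with t ht
      exact (ht z₀ (Metric.mem_ball_self hε)).tendsto_slope.comp hlim
  · filter_upwards [hb, hdiff] with t ht hdt z hz
    have hcb : Metric.closedBall z (ε / 3) ⊆ Metric.ball z₀ ε := fun u hu => by
      have h1 := Metric.mem_closedBall.1 hu
      have h2 := Metric.mem_ball.1 hz
      have := dist_triangle u z z₀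
      rw [Metric.mem_ball]; linarith
    refine Complex.norm_deriv_le_of_forall_mem_sphere_norm_le (by positivity) ?_ fun u hu => ?_
    · refine DifferentiableOn.diffContOnCl (hdt.mono ?_)
      exact Metric.closure_ball_subset_closedBall.trans (hcb.trans hsubU)
    · have := hcb (Metric.sphere_subset_closedBall hu)
      exact ht u (hsub' this) (hsubU this)
  · filter_upwards [hd] with t ht z hz
    exact ht z (Metric.ball_subset_ball (by linarith) hz)

/-- Dominated convergence for the squares, along sequences, which suffice because the filter is
countably generated. -/
lemma tendsto_eLpNorm_zero {l : Filter ℝ} [l.IsCountablyGenerated] {F : ℝ → ℝ → ℂ} {v : ℝ → ℝ}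
    (hF : ∀ᶠ y in l, AEStronglyMeasurable (F y) volume) (hv : MemLp v 2 (volume : Measure ℝ))
    (hb : ∀ᶠ y in l, ∀ᵐ x, ‖F y x‖ ≤ v x)
    (hlim : ∀ᵐ x, Tendsto (fun y => F y x) l (𝓝 0)) :
    Tendsto (fun y => eLpNorm (F y) 2 volume) l (𝓝 0) := by
  have e : ∀ u : ℝ → ℂ, eLpNorm u 2 volume = (∫⁻ x, ‖u x‖ₑ ^ (2 : ℝ)) ^ (1 / 2 : ℝ) := fun u => by
    rw [eLpNorm_eq_lintegral_rpow_enorm_toReal (by norm_num) (by norm_num)]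
    simp
  simp only [e]
  have h0 : Tendsto (fun y => ∫⁻ x, ‖F y x‖ₑ ^ (2 : ℝ)) l (𝓝 (∫⁻ x : ℝ, 0)) := by
    refine tendsto_of_seq_tendsto fun u hu => ?_
    obtain ⟨n₀, hn₀⟩ := eventually_atTop.1 (hu.eventually (hF.and hb))
    rw [← tendsto_add_atTop_iff_nat n₀]
    refine tendsto_lintegral_of_dominated_convergence' (fun x => ‖v x‖ₑ ^ (2 : ℝ))
      (fun n => ((hn₀ (n + n₀) (by omega)).1.enorm.pow_const _)) (fun n => ?_) ?_ ?_
    · filter_upwards [(hn₀ (n + n₀) (by omega)).2] with x hx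
      gcongr
      rw [← ofReal_norm, ← ofReal_norm]
      exact ENNReal.ofReal_le_ofReal (hx.trans (le_abs_self _))
    · have := lintegral_rpow_enorm_lt_top_of_eLpNorm_lt_top (p := 2) (by norm_num) (by norm_num)
        hv.2
      simpa using this.ne
    · filter_upwards [hlim] with x hx
      have h1 := hx.enorm
      rw [enorm_zero] at h1
      have := (ENNReal.continuous_rpow_const (y := (2 : ℝ))).tendsto 0 |>.comp
        (h1.comp (hu.comp (tendsto_add_atTop_nat n₀)))
      rw [ENNReal.zero_rpow_of_pos (by norm_num)] at this
      exact this
  have := (ENNReal.continuous_rpow_const (y := (1 / 2 : ℝ))).tendsto _ |>.comp h0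
  rw [lintegral_zero, ENNReal.zero_rpow_of_pos (by norm_num)] at this
  exact this

/-! ### The Fourier transform of the slices of a Hardy function -/

lemma IsHardy.memLp {G : ℂ → ℂ} (hG : IsHardy G) {y : ℝ} (hy : y ∈ Set.Ioo (-Real.pi) 0) :
    MemLp (slice G y) 2 (volume : Measure ℝ) := by
  obtain ⟨C, hC⟩ := hG.bounded
  exact ⟨(continuous_slice hG.analytic hy).aestronglyMeasurable,
    (hC y hy).trans_lt ENNReal.coe_lt_top⟩

lemma integrable_conj_mul {u v : ℝ → ℂ} (hu : MemLp u 2 (volume : Measure ℝ))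
    (hv : MemLp v 2 (volume : Measure ℝ)) :
    Integrable (fun t => starRingEnd ℂ (u t) * v t) :=
  MemLp.integrable_mul (p := 2) (q := 2) hu.star hv

lemma norm_integral_conj_mul_le {u v : ℝ → ℂ} (hu : MemLp u 2 (volume : Measure ℝ))
    (hv : MemLp v 2 (volume : Measure ℝ)) :
    ‖∫ t, starRingEnd ℂ (u t) * v t‖
      ≤ (eLpNorm u 2 volume).toReal * (eLpNorm v 2 volume).toReal := by
  have h1 : ∫ t, starRingEnd ℂ (u t) * v t = ⟪hu.toLp, hv.toLp⟫_ℂ := by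
    rw [L2_inner]
    refine integral_congr_ae ?_
    filter_upwards [hu.coeFn_toLp, hv.coeFn_toLp] with t h1 h2
    rw [h1, h2]
  rw [h1, ← Lp.norm_toLp u hu, ← Lp.norm_toLp v hv]
  exact norm_inner_le_norm _ _

lemma slice_add (G : ℂ → ℂ) (z : ℂ) (t : ℝ) : G (z + t) = slice G z.im (t + z.re) := by
  rw [slice]
  congr 1
  apply Complex.ext <;> simp [add_comm]

lemma mem_strip_im {z : ℂ} (hz : z ∈ strip) : z.im ∈ Set.Ioo (-Real.pi) 0 := hz

lemma add_real_mem_strip {z : ℂ} (hz : z ∈ strip) (t : ℝ) : z + t ∈ strip := by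
  simpa [strip] using hz

lemma IsHardy.memLp_translate {G : ℂ → ℂ} (hG : IsHardy G) {z : ℂ} (hz : z ∈ strip) :
    MemLp (fun t : ℝ => G (z + t)) 2 (volume : Measure ℝ) := by
  simp only [slice_add]
  exact (hG.memLp (mem_strip_im hz)).comp_measurePreserving
    (measurePreserving_add_right volume z.re)

lemma eLpNorm_translate {G : ℂ → ℂ} (hG : IsHardy G) {z : ℂ} (hz : z ∈ strip) :
    eLpNorm (fun t : ℝ => G (z + t)) 2 volume = eLpNorm (slice G z.im) 2 volume := by
  simp only [slice_add]
  exact eLpNorm_comp_measurePreserving (hG.memLp (mem_strip_im hz)).1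
    (measurePreserving_add_right volume z.re)

lemma differentiableOn_pairing_of_compact {G : ℂ → ℂ} (hG : DifferentiableOn ℂ G strip)
    {g : ℝ → ℂ} (hg : Continuous g) (hsupp : HasCompactSupport g) :
    DifferentiableOn ℂ (fun z => ∫ t : ℝ, starRingEnd ℂ (g t) * G (z + t)) strip := by
  have hc : ∀ z ∈ strip, Continuous fun t : ℝ => G (z + t) := fun z hz =>
    hG.continuousOn.comp_continuous (by fun_prop) fun t => add_real_mem_strip hz t
  refine differentiableOn_integral isOpen_strip (fun z hz => ?_) (Eventually.of_forall fun t => ?_)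
    fun z₀ hz₀ => ?_
  · have := hc z hz
    exact ((Complex.continuous_conj.comp hg).mul this).aestronglyMeasurable
  · refine (hG.comp (by fun_prop) fun z hz => add_real_mem_strip hz t).const_mul _
  · obtain ⟨ε, hε, hsub⟩ := Metric.nhds_basis_closedBall.mem_iff.1 (isOpen_strip.mem_nhds hz₀)
    have hcomp : IsCompact (Metric.closedBall z₀ ε ×ˢ tsupport g) :=
      (isCompact_closedBall _ _).prod hsupp
    have hcont : ContinuousOn (fun p : ℂ × ℝ => G (p.1 + p.2))
        (Metric.closedBall z₀ ε ×ˢ tsupport g) :=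
      hG.continuousOn.comp (by fun_prop) fun p hp => add_real_mem_strip (hsub hp.1) p.2
    obtain ⟨M, hM⟩ := hcomp.exists_bound_of_continuousOn hcont
    refine ⟨ε, hε, fun t => ‖g t‖ * M, (hg.integrable_of_hasCompactSupport hsupp).norm.mul_const M,
      Eventually.of_forall fun t z hz _ => ?_⟩
    rw [norm_mul, RCLike.norm_conj]
    by_cases ht : t ∈ tsupport g
    · exact mul_le_mul_of_nonneg_left (hM (z, t) ⟨Metric.ball_subset_closedBall hz, ht⟩)
        (norm_nonneg _)
    · simp [image_eq_zero_of_notMem_tsupport ht]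

/-- Continuous compactly supported functions approximate `χ` in `L²`. Since the slices of `G` are
uniformly bounded in `L²`, the pairings converge uniformly on the whole strip. -/
lemma differentiableOn_pairing {G : ℂ → ℂ} (hG : IsHardy G) (χ : Hilb) :
    DifferentiableOn ℂ (fun z => ∫ t : ℝ, starRingEnd ℂ (χ t) * G (z + t)) strip := by
  obtain ⟨C, hC⟩ := hG.bounded
  have hex : ∀ n : ℕ, ∃ g : ℝ → ℂ, HasCompactSupport g ∧
      eLpNorm ((χ : ℝ → ℂ) - g) 2 volume ≤ ENNReal.ofReal (1 / (n + 1)) ∧ Continuous g ∧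
        MemLp g 2 (volume : Measure ℝ) := fun n =>
    (Lp.memLp χ).exists_hasCompactSupport_eLpNorm_sub_le (by norm_num)
      (by simp; positivity)
  choose g hg1 hg2 hg3 hg4 using hex
  have hlim : TendstoUniformlyOn
      (fun (n : ℕ) z => ∫ t : ℝ, starRingEnd ℂ (g n t) * G (z + t))
      (fun z => ∫ t : ℝ, starRingEnd ℂ (χ t) * G (z + t)) atTop strip := by
    rw [Metric.tendstoUniformlyOn_iff]
    intro ε hε
    have h1 : Tendsto (fun n : ℕ => 1 / ((n : ℝ) + 1) * C) atTop (𝓝 0) := by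
      simpa using tendsto_one_div_add_atTop_nhds_zero_nat.mul_const (C : ℝ)
    filter_upwards [h1.eventually (gt_mem_nhds hε)] with n hn z hz
    have hv := hG.memLp_translate hz
    rw [dist_eq_norm, ← integral_sub (integrable_conj_mul (Lp.memLp χ) hv)
      (integrable_conj_mul (hg4 n) hv)]
    have e : ∀ t : ℝ, starRingEnd ℂ (χ t) * G (z + t) - starRingEnd ℂ (g n t) * G (z + t)
        = starRingEnd ℂ (((χ : ℝ → ℂ) - g n) t) * G (z + t) := fun t => by
      simp [sub_mul]
    simp only [e]
    refine (norm_integral_conj_mul_le ((Lp.memLp χ).sub (hg4 n)) hv).trans_lt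
      (lt_of_le_of_lt ?_ hn)
    gcongr
    · exact ENNReal.toReal_le_of_le_ofReal (by positivity) (hg2 n)
    · rw [eLpNorm_translate hG hz]
      exact ENNReal.toReal_le_coe_of_le_coe (hC _ (mem_strip_im hz))
  exact hlim.tendstoLocallyUniformlyOn.differentiableOn
    (Eventually.of_forall fun n => differentiableOn_pairing_of_compact hG.analytic (hg3 n) (hg1 n))
    isOpen_strip

/-- The slice of a Hardy function as a vector of `L²(ℝ)`. -/
def IsHardy.toHilb {G : ℂ → ℂ} (hG : IsHardy G) {y : ℝ} (hy : y ∈ Set.Ioo (-Real.pi) 0) : Hilb :=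
  (hG.memLp hy).toLp

lemma IsHardy.coe_toHilb {G : ℂ → ℂ} (hG : IsHardy G) {y : ℝ} (hy : y ∈ Set.Ioo (-Real.pi) 0) :
    ⇑(hG.toHilb hy) =ᵐ[volume] slice G y := MemLp.coeFn_toLp _

lemma pairing_eq {G : ℂ → ℂ} (hG : IsHardy G) {ψ : Hilb} {N : ℝ}
    (hN : ∀ᵐ k : ℝ, N < |k| → ψ k = 0) {y : ℝ} (hy : y ∈ Set.Ioo (-Real.pi) 0) (x : ℝ) :
    ∫ t : ℝ, starRingEnd ℂ (FT.symm ψ t) * G (x + y * Complex.I + t)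
      = ∫ k : ℝ, starRingEnd ℂ (ψ k) *
          (Complex.exp (2 * Real.pi * Complex.I * k * x) * FT (hG.toHilb hy) k) := by
  rw [← integral_conj_mul_translate hN]
  refine integral_congr_ae ?_
  filter_upwards [(measurePreserving_add_right (volume : Measure ℝ) x).quasiMeasurePreserving.ae
    (hG.coe_toHilb hy)] with t ht
  rw [ht, slice_add G]
  simp

/-- The spectral cutoff `|k| ≤ N` keeps the exponential locally bounded in `z`, uniformly in `k`. -/
lemma differentiableOn_spectral {ψ : Hilb} {N : ℝ} (hN : ∀ᵐ k : ℝ, N < |k| → ψ k = 0)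
    (g : Hilb) (y : ℝ) :
    DifferentiableOn ℂ (fun z => ∫ k : ℝ, starRingEnd ℂ (ψ k) *
      (Complex.exp (2 * Real.pi * Complex.I * k * (z - y * Complex.I)) * g k)) strip := by
  refine differentiableOn_integral isOpen_strip (fun z _ => ?_) (Eventually.of_forall fun k => ?_)
    fun z₀ _ => ⟨1, one_pos, fun k => Real.exp (2 * Real.pi * |N| * (‖z₀‖ + 1 + |y|)) *
      (‖starRingEnd ℂ (ψ k) * g k‖),
      ((integrable_conj_mul (Lp.memLp ψ) (Lp.memLp g)).norm.const_mul _), ?_⟩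
  · have : Continuous fun k : ℝ =>
      Complex.exp (2 * Real.pi * Complex.I * k * (z - y * Complex.I)) := by fun_prop
    exact (Complex.continuous_conj.comp_aestronglyMeasurable (Lp.aestronglyMeasurable ψ)).mul
      (this.aestronglyMeasurable.mul (Lp.aestronglyMeasurable g))
  · fun_prop
  · filter_upwards [hN] with k hk z hz _
    by_cases h : N < |k|
    · simp [hk h]
    · push Not at h
      rw [norm_mul, norm_mul, norm_mul, mul_left_comm]
      gcongr
      rw [Complex.norm_exp, Real.exp_le_exp]
      refine (Complex.re_le_norm _).trans ?_
      have h1 : ‖(2 * Real.pi * Complex.I * k * (z - y * Complex.I) : ℂ)‖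
          = 2 * Real.pi * |k| * ‖z - y * Complex.I‖ := by
        simp [abs_of_pos Real.pi_pos]
      have h2 : ‖z - y * Complex.I‖ ≤ ‖z₀‖ + 1 + |y| := by
        have h3 : ‖z - z₀‖ < 1 := by simpa [dist_eq_norm] using hz
        calc ‖z - y * Complex.I‖ = ‖z₀ + (z - z₀) - y * Complex.I‖ := by congr 1; ring
          _ ≤ ‖z₀‖ + ‖z - z₀‖ + ‖y * Complex.I‖ :=
            (norm_sub_le _ _).trans (by gcongr; exact norm_add_le _ _)
          _ ≤ _ := by
            have : ‖(y : ℂ) * Complex.I‖ = |y| := by simp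
            rw [this]; linarith
      rw [h1]
      have h4 : 2 * Real.pi * |k| ≤ 2 * Real.pi * |N| :=
        mul_le_mul_of_nonneg_left (h.trans (le_abs_self N)) (by positivity)
      exact mul_le_mul h4 h2 (norm_nonneg _) (by positivity)

/-- The pairing of `G(z + ·)` and the spectral integral built from the slice at `y'` are both
analytic in `z` and agree on the line at height `y'`, hence everywhere. The claim is their equality
at `z = iy`. -/
lemma integral_spectral_eq {G : ℂ → ℂ} (hG : IsHardy G) {ψ : Hilb} {N : ℝ}
    (hN : ∀ᵐ k : ℝ, N < |k| → ψ k = 0) {y y' : ℝ} (hy : y ∈ Set.Ioo (-Real.pi) 0)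
    (hy' : y' ∈ Set.Ioo (-Real.pi) 0) :
    ∫ k : ℝ, starRingEnd ℂ (ψ k) * FT (hG.toHilb hy) k
      = ∫ k : ℝ, starRingEnd ℂ (ψ k) *
        (Real.exp (-(2 * Real.pi * k * (y - y'))) * FT (hG.toHilb hy') k) := by
  have h1 := (differentiableOn_pairing hG (FT.symm ψ)).analyticOnNhd isOpen_strip
  have h2 := (differentiableOn_spectral hN (FT (hG.toHilb hy')) y').analyticOnNhd isOpen_strip
  have hz₀ : ((0 : ℝ) : ℂ) + y' * Complex.I ∈ strip := mem_strip_iff.2 hy'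
  -- The points `1 / (n + 1) + iy'` of the line accumulate at `iy'`, which is all the identity
  -- theorem needs.
  have hfr : ∃ᶠ z in 𝓝[≠] (((0 : ℝ) : ℂ) + y' * Complex.I),
      ∫ t : ℝ, starRingEnd ℂ (FT.symm ψ t) * G (z + t) = ∫ k : ℝ, starRingEnd ℂ (ψ k) *
      (Complex.exp (2 * Real.pi * Complex.I * k * (z - y' * Complex.I)) *
        FT (hG.toHilb hy') k) := by
    have hlim : Tendsto (fun n : ℕ => ((1 / ((n : ℝ) + 1) : ℝ) : ℂ) + y' * Complex.I) atTop
        (𝓝[≠] (((0 : ℝ) : ℂ) + y' * Complex.I)) := by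
      refine tendsto_nhdsWithin_iff.2 ⟨?_, Eventually.of_forall fun n => ?_⟩
      · exact ((Complex.continuous_ofReal.tendsto 0).comp
          tendsto_one_div_add_atTop_nhds_zero_nat).add_const _
      · have : (n : ℝ) + 1 ≠ 0 := by positivity
        simp only [Set.mem_compl_iff, Set.mem_singleton_iff, add_left_inj, Complex.ofReal_inj]
        positivity
    refine hlim.frequently (Eventually.frequently (Eventually.of_forall fun n => ?_))
    rw [pairing_eq hG hN hy']
    simp
  have key := h1.eqOn_of_preconnected_of_frequently_eq h2 convex_strip.isPreconnected hz₀ hfr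
    (mem_strip_iff.2 hy : ((0 : ℝ) : ℂ) + y * Complex.I ∈ strip)
  simp only at key
  rw [pairing_eq hG hN hy] at key
  simp only [Complex.ofReal_zero, mul_zero, Complex.exp_zero, one_mul, zero_add] at key
  rw [key]
  refine integral_congr_ae (Eventually.of_forall fun k => ?_)
  simp only [Complex.ofReal_exp]
  congr 3
  push_cast
  linear_combination (2 * Real.pi * k * (y - y') : ℂ) * Complex.I_sq

/-- The integrand is the square of the modulus of the truncation. Truncation is forced by the
exponential weights, which make `D` only locally square integrable in the applications. -/
lemma ae_eq_zero_of_integral_conj_mul {D : ℝ → ℂ}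
    (hD : ∀ N : ℕ, MemLp ((Set.Icc (-N : ℝ) N).indicator D) 2 (volume : Measure ℝ))
    (h : ∀ N : ℕ, ∫ k, starRingEnd ℂ ((Set.Icc (-N : ℝ) N).indicator D k) * D k = 0) :
    D =ᵐ[volume] 0 := by
  have h1 : ∀ N : ℕ, (Set.Icc (-N : ℝ) N).indicator D =ᵐ[volume] 0 := fun N => by
    have h2 : ⟪(hD N).toLp, (hD N).toLp⟫_ℂ = 0 := by
      rw [L2_inner, ← h N]
      refine integral_congr_ae ?_
      filter_upwards [(hD N).coeFn_toLp] with k hk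
      rw [hk]
      by_cases hkN : k ∈ Set.Icc (-N : ℝ) N <;> simp [hkN]
    rw [inner_self_eq_zero] at h2
    have h3 := (hD N).coeFn_toLp
    rw [h2] at h3
    exact h3.symm.trans (Lp.coeFn_zero ℂ 2 volume)
  filter_upwards [ae_all_iff.2 h1] with k hk
  obtain ⟨N, hN⟩ := exists_nat_ge |k|
  have := hk N
  rwa [Set.indicator_of_mem (show k ∈ Set.Icc (-N : ℝ) N from abs_le.1 hN)] at this

lemma memLp_indicator_exp (c : ℝ) (g : Hilb) (N : ℕ) :
    MemLp ((Set.Icc (-N : ℝ) N).indicator fun k => (Real.exp (c * k) : ℂ) * g k) 2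
      (volume : Measure ℝ) := by
  have hm : AEStronglyMeasurable ((Set.Icc (-N : ℝ) N).indicator fun k => (Real.exp (c * k) : ℂ))
      volume :=
    (Continuous.aestronglyMeasurable (by fun_prop)).indicator measurableSet_Icc
  refine MemLp.ae_eq (Eventually.of_forall fun k => ?_)
    (memLp_mul_of_bounded hm (C := Real.exp (|c| * N)) (fun k => ?_) (Lp.memLp g))
  · by_cases hk : k ∈ Set.Icc (-N : ℝ) N <;> simp [hk]
  · by_cases hk : k ∈ Set.Icc (-N : ℝ) N
    · rw [Set.indicator_of_mem hk, Complex.norm_real, Real.norm_eq_abs, Real.abs_exp]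
      refine Real.exp_le_exp.2 ?_
      calc c * k ≤ |c * k| := le_abs_self _
        _ = |c| * |k| := abs_mul _ _
        _ ≤ |c| * N := mul_le_mul_of_nonneg_left (abs_le.2 hk) (abs_nonneg _)
    · rw [Set.indicator_of_notMem hk]; simp; positivity

/-- The Fourier transforms of the slices differ by an exponential factor. -/
lemma FT_slice {G : ℂ → ℂ} (hG : IsHardy G) {y y' : ℝ} (hy : y ∈ Set.Ioo (-Real.pi) 0)
    (hy' : y' ∈ Set.Ioo (-Real.pi) 0) :
    ⇑(FT (hG.toHilb hy)) =ᵐ[volume] fun k =>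
      (Real.exp (-(2 * Real.pi * k * (y - y'))) : ℂ) * FT (hG.toHilb hy') k := by
  set f := FT (hG.toHilb hy)
  set g := FT (hG.toHilb hy')
  set D : ℝ → ℂ := fun k => f k - (Real.exp (-(2 * Real.pi * k * (y - y'))) : ℂ) * g k with hDdef
  have hE : ∀ N : ℕ, MemLp ((Set.Icc (-N : ℝ) N).indicator fun k =>
      (Real.exp (-(2 * Real.pi * k * (y - y'))) : ℂ) * g k) 2 (volume : Measure ℝ) := fun N => by
    convert memLp_indicator_exp (-(2 * Real.pi * (y - y'))) g N using 6
    ring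
  have hD : ∀ N : ℕ, MemLp ((Set.Icc (-N : ℝ) N).indicator D) 2 (volume : Measure ℝ) := fun N => by
    have := ((Lp.memLp f).indicator (s := Set.Icc (-N : ℝ) N) measurableSet_Icc).sub (hE N)
    rw [← Set.indicator_sub'] at this
    exact this
  have := ae_eq_zero_of_integral_conj_mul hD fun N => ?_
  · filter_upwards [this] with k hk
    exact sub_eq_zero.1 hk
  have hψ := (hD N).coeFn_toLp
  have hN : ∀ᵐ k : ℝ, (N : ℝ) < |k| → (hD N).toLp _ k = 0 := by
    filter_upwards [hψ] with k hk hkN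
    rw [hk, Set.indicator_of_notMem]
    exact fun h => absurd (abs_le.2 h) (not_le.2 hkN)
  have key := integral_spectral_eq hG hN hy hy'
  have e1 : ∫ k : ℝ, starRingEnd ℂ ((hD N).toLp _ k) *
        (Real.exp (-(2 * Real.pi * k * (y - y'))) * g k)
      = ∫ k : ℝ, starRingEnd ℂ ((hD N).toLp _ k) * (Set.Icc (-N : ℝ) N).indicator (fun k =>
        (Real.exp (-(2 * Real.pi * k * (y - y'))) : ℂ) * g k) k := by
    refine integral_congr_ae ?_
    filter_upwards [hN] with k hk
    by_cases h : k ∈ Set.Icc (-N : ℝ) N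
    · rw [Set.indicator_of_mem h]
    · rw [hk (not_le.1 fun h2 => h (abs_le.1 h2))]
      simp
  rw [e1, ← sub_eq_zero, ← integral_sub (integrable_conj_mul (Lp.memLp _) (Lp.memLp _))
    (integrable_conj_mul (Lp.memLp _) (hE N))] at key
  rw [← key]
  refine integral_congr_ae ?_
  filter_upwards [hψ] with k hk
  rw [hk]
  by_cases h : k ∈ Set.Icc (-N : ℝ) N
  · simp only [Set.indicator_of_mem h]
    rw [← mul_sub]
  · simp [h]

/-! ### Spectral description of the operator of analytic continuation -/

lemma enorm_eq_of_ae {f : Hilb} {u : ℝ → ℂ} (h : ⇑f =ᵐ[volume] u) :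
    ‖f‖ₑ = eLpNorm u 2 volume := by
  rw [Lp.enorm_def, eLpNorm_congr_ae h]

/-- Plancherel bounds the weighted transforms at the interior heights `u n` by the Hardy constant,
and Fatou's lemma carries the bound to a limit height on the boundary. -/
lemma IsHardy.memLp_limit {G : ℂ → ℂ} (hG : IsHardy G) {y₀ : ℝ}
    (hy₀ : y₀ ∈ Set.Ioo (-Real.pi) 0) {u : ℕ → ℝ} (hu : ∀ n, u n ∈ Set.Ioo (-Real.pi) 0)
    {y : ℝ} (hlim : Tendsto u atTop (𝓝 y)) :
    MemLp (fun k : ℝ => (Real.exp (-(2 * Real.pi * k * (y - y₀))) : ℂ) *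
      FT (hG.toHilb hy₀) k) 2 (volume : Measure ℝ) := by
  obtain ⟨C, hC⟩ := hG.bounded
  have hm : ∀ y : ℝ, AEStronglyMeasurable (fun k : ℝ =>
      (Real.exp (-(2 * Real.pi * k * (y - y₀))) : ℂ) * FT (hG.toHilb hy₀) k) volume := fun y =>
    (Continuous.aestronglyMeasurable (by fun_prop)).mul (Lp.aestronglyMeasurable _)
  refine ⟨hm y, ?_⟩
  have h1 := Lp.eLpNorm_lim_le_liminf_eLpNorm (p := 2) (fun n => hm (u n))
    (fun k : ℝ => (Real.exp (-(2 * Real.pi * k * (y - y₀))) : ℂ) * FT (hG.toHilb hy₀) k)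
    (Eventually.of_forall fun k => by
      have hc : Continuous fun y : ℝ => (Real.exp (-(2 * Real.pi * k * (y - y₀))) : ℂ) *
        FT (hG.toHilb hy₀) k := by fun_prop
      exact (hc.tendsto y).comp hlim)
  have h2 : ∀ n, eLpNorm (fun k : ℝ => (Real.exp (-(2 * Real.pi * k * (u n - y₀))) : ℂ) *
      FT (hG.toHilb hy₀) k) 2 volume ≤ C := fun n => by
    rw [← enorm_eq_of_ae (FT_slice hG (hu n) hy₀), LinearIsometryEquiv.enorm_map,
      enorm_eq_of_ae (hG.coe_toHilb (hu n))]
    exact hC _ (hu n)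
  refine (h1.trans ?_).trans_lt (ENNReal.coe_lt_top (r := C))
  exact liminf_le_of_le (by isBoundedDefault) fun b hb => by
    obtain ⟨n, hn⟩ := hb.exists
    exact hn.trans (h2 n)

/-- The boundary values in the Fourier picture. -/
lemma IsHardy.exists_FT {G : ℂ → ℂ} (hG : IsHardy G) :
    ∃ α β : Hilb, (⇑β =ᵐ[volume] fun k => (Real.exp (2 * Real.pi * Real.pi * k) : ℂ) * α k) ∧
      ∀ y (hy : y ∈ Set.Ioo (-Real.pi) 0), ⇑(FT (hG.toHilb hy)) =ᵐ[volume]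
        fun k => (Real.exp (-(2 * Real.pi * k * y)) : ℂ) * α k := by
  have hpi := Real.pi_pos
  have hy₀ : -(Real.pi / 2) ∈ Set.Ioo (-Real.pi) 0 := ⟨by linarith, by linarith⟩
  -- The sequences start at the middle height `-π/2` and run inside the strip to the edges `0` and
  -- `-π`.
  have hmem : ∀ (n : ℕ) (t : ℝ), t = 0 ∨ t = -Real.pi →
      t + (-(Real.pi / 2) - t) / (n + 1) ∈ Set.Ioo (-Real.pi) 0 := fun n t ht => by
    have h1 : (0 : ℝ) < n + 1 := by positivity
    have h2 : Real.pi / 2 / (n + 1) ≤ Real.pi / 2 :=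
      div_le_self (by positivity) (by linarith [n.cast_nonneg (α := ℝ)])
    have h3 : 0 < Real.pi / 2 / (n + 1) := by positivity
    rcases ht with rfl | rfl
    · rw [sub_zero, neg_div]
      constructor <;> linarith
    · rw [show -(Real.pi / 2) - -Real.pi = Real.pi / 2 by ring]
      constructor <;> linarith
  have hlim : ∀ t : ℝ, Tendsto (fun n : ℕ => t + (-(Real.pi / 2) - t) / ((n : ℝ) + 1)) atTop
      (𝓝 t) := fun t => by
    have h1 : Tendsto (fun n : ℕ => (-(Real.pi / 2) - t) / ((n : ℝ) + 1)) atTop (𝓝 0) :=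
      tendsto_const_nhds.div_atTop (tendsto_natCast_atTop_atTop.atTop_add tendsto_const_nhds)
    simpa using h1.const_add t
  have hα := hG.memLp_limit hy₀ (fun n => hmem n 0 (Or.inl rfl)) (hlim 0)
  have hβ := hG.memLp_limit hy₀ (fun n => hmem n (-Real.pi) (Or.inr rfl)) (hlim (-Real.pi))
  refine ⟨hα.toLp _, hβ.toLp _, ?_, fun y hy => ?_⟩
  · filter_upwards [hα.coeFn_toLp, hβ.coeFn_toLp] with k h1 h2
    rw [h1, h2, ← mul_assoc, ← Complex.ofReal_mul, ← Real.exp_add]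
    congr 3
    ring
  · filter_upwards [hα.coeFn_toLp, FT_slice hG hy hy₀] with k h1 h2
    rw [h1, h2, ← mul_assoc, ← Complex.ofReal_mul, ← Real.exp_add]
    congr 3
    ring

/-- On `[-π, 0]` a real exponential in `y` is at most the larger of its end values, hence at most
their sum. This dominates every slice by the two boundary values. -/
lemma exp_interpolation {y : ℝ} (hy : y ∈ Set.Icc (-Real.pi) 0) (k : ℝ) :
    Real.exp (-(2 * Real.pi * k * y)) ≤ 1 + Real.exp (2 * Real.pi * Real.pi * k) := by
  have hpi := Real.pi_pos
  rcases le_total 0 k with hk | hk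
  · refine (Real.exp_le_exp.2 ?_).trans (le_add_of_nonneg_left zero_le_one)
    have : 0 ≤ 2 * Real.pi * k * (y + Real.pi) :=
      mul_nonneg (by positivity) (by linarith [hy.1])
    nlinarith
  · refine (Real.exp_le_one_iff.2 ?_).trans (le_add_of_nonneg_right (Real.exp_pos _).le)
    have : 0 ≤ 2 * Real.pi * (-k) * (-y) :=
      mul_nonneg (mul_nonneg (by positivity) (by linarith)) (by linarith [hy.2])
    nlinarith

lemma norm_exp_mul_le {α β : Hilb}
    (hβ : ⇑β =ᵐ[volume] fun k => (Real.exp (2 * Real.pi * Real.pi * k) : ℂ) * α k) :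
    ∀ᵐ k, ∀ y ∈ Set.Icc (-Real.pi) 0,
      ‖(Real.exp (-(2 * Real.pi * k * y)) : ℂ) * α k‖ ≤ ‖α k‖ + ‖β k‖ := by
  filter_upwards [hβ] with k hk y hy
  rw [hk, norm_mul, norm_mul, Complex.norm_real, Complex.norm_real, Real.norm_eq_abs,
    Real.norm_eq_abs, Real.abs_exp, Real.abs_exp, ← one_add_mul]
  exact mul_le_mul_of_nonneg_right (exp_interpolation hy k) (norm_nonneg _)

/-- By Plancherel only the multipliers `exp (-2πky)` have to converge, dominated by `|α| + |β|`. -/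
lemma tendsto_slice_of_FT {G : ℂ → ℂ} (hG : IsHardy G) {α β γ : Hilb}
    (hβ : ⇑β =ᵐ[volume] fun k => (Real.exp (2 * Real.pi * Real.pi * k) : ℂ) * α k)
    (hFT : ∀ y (hy : y ∈ Set.Ioo (-Real.pi) 0), ⇑(FT (hG.toHilb hy)) =ᵐ[volume]
        fun k => (Real.exp (-(2 * Real.pi * k * y)) : ℂ) * α k)
    {l : Filter ℝ} [l.IsCountablyGenerated] (hl : ∀ᶠ y in l, y ∈ Set.Ioo (-Real.pi) 0) {y₀ : ℝ}
    (hy₀ : y₀ ∈ Set.Icc (-Real.pi) 0) (hly : Tendsto id l (𝓝 y₀))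
    (hγ : ⇑γ =ᵐ[volume] fun k => (Real.exp (-(2 * Real.pi * k * y₀)) : ℂ) * α k) :
    Tendsto (fun y : ℝ => eLpNorm (slice G y - ⇑(FT.symm γ)) 2 volume) l (𝓝 0) := by
  have h1 : Tendsto (fun y : ℝ => eLpNorm (fun k => (Real.exp (-(2 * Real.pi * k * y)) : ℂ) * α k
      - (Real.exp (-(2 * Real.pi * k * y₀)) : ℂ) * α k) 2 volume) l (𝓝 0) := by
    refine tendsto_eLpNorm_zero (v := fun k => 2 * (‖α k‖ + ‖β k‖))
      (Eventually.of_forall fun y => ?_)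
      (((Lp.memLp α).norm.add (Lp.memLp β).norm).const_mul 2) ?_ ?_
    · have : ∀ y : ℝ, AEStronglyMeasurable (fun k : ℝ =>
          (Real.exp (-(2 * Real.pi * k * y)) : ℂ) * α k) volume := fun y =>
        (Continuous.aestronglyMeasurable (by fun_prop)).mul (Lp.aestronglyMeasurable _)
      exact (this y).sub (this y₀)
    · filter_upwards [hl] with y hy
      filter_upwards [norm_exp_mul_le hβ] with k hk
      refine (norm_sub_le _ _).trans ?_
      linarith [hk y (Set.Ioo_subset_Icc_self hy), hk y₀ hy₀]
    · refine Eventually.of_forall fun k => ?_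
      have hc : Continuous fun y : ℝ => (Real.exp (-(2 * Real.pi * k * y)) : ℂ) * α k
        - (Real.exp (-(2 * Real.pi * k * y₀)) : ℂ) * α k := by fun_prop
      have := (hc.tendsto y₀).comp hly
      rw [sub_self] at this
      exact this
  refine h1.congr' ?_
  filter_upwards [hl] with y hy
  have e1 : ⇑(hG.toHilb hy - FT.symm γ) =ᵐ[volume] slice G y - ⇑(FT.symm γ) :=
    (Lp.coeFn_sub _ _).trans ((hG.coe_toHilb hy).sub EventuallyEq.rfl)
  have e2 : ⇑(FT (hG.toHilb hy) - γ) =ᵐ[volume] fun k =>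
      (Real.exp (-(2 * Real.pi * k * y)) : ℂ) * α k
        - (Real.exp (-(2 * Real.pi * k * y₀)) : ℂ) * α k :=
    (Lp.coeFn_sub _ _).trans ((hFT y hy).sub hγ)
  rw [← enorm_eq_of_ae e1, ← enorm_eq_of_ae e2,
    ← LinearIsometryEquiv.enorm_map FT (hG.toHilb hy - FT.symm γ), map_sub,
    LinearIsometryEquiv.apply_symm_apply]

lemma upper_value_of_FT {G : ℂ → ℂ} (hG : IsHardy G) {α β : Hilb}
    (hβ : ⇑β =ᵐ[volume] fun k => (Real.exp (2 * Real.pi * Real.pi * k) : ℂ) * α k)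
    (hFT : ∀ y (hy : y ∈ Set.Ioo (-Real.pi) 0), ⇑(FT (hG.toHilb hy)) =ᵐ[volume]
        fun k => (Real.exp (-(2 * Real.pi * k * y)) : ℂ) * α k) :
    HasUpperL2Value G (FT.symm α) :=
  tendsto_slice_of_FT hG hβ hFT upper_mem ⟨by linarith [Real.pi_pos], le_rfl⟩
    nhdsWithin_le_nhds (Eventually.of_forall fun k => by simp)

lemma lower_value_of_FT {G : ℂ → ℂ} (hG : IsHardy G) {α β : Hilb}
    (hβ : ⇑β =ᵐ[volume] fun k => (Real.exp (2 * Real.pi * Real.pi * k) : ℂ) * α k)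
    (hFT : ∀ y (hy : y ∈ Set.Ioo (-Real.pi) 0), ⇑(FT (hG.toHilb hy)) =ᵐ[volume]
        fun k => (Real.exp (-(2 * Real.pi * k * y)) : ℂ) * α k) :
    HasLowerL2Value G (FT.symm β) :=
  tendsto_slice_of_FT hG hβ hFT lower_mem ⟨le_rfl, by linarith [Real.pi_pos]⟩
    nhdsWithin_le_nhds (hβ.trans (Eventually.of_forall fun k => by
      simp only
      congr 3
      ring))

/-- A Hardy function has `L²` boundary values. -/
lemma IsHardy.exists_boundary {G : ℂ → ℂ} (hG : IsHardy G) :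
    ∃ a b : Hilb, HasUpperL2Value G a ∧ HasLowerL2Value G b := by
  obtain ⟨α, β, hβ, hFT⟩ := hG.exists_FT
  exact ⟨_, _, upper_value_of_FT hG hβ hFT, lower_value_of_FT hG hβ hFT⟩

lemma l2Value_unique {l : Filter ℝ} [l.NeBot] (hl : ∀ᶠ y in l, y ∈ Set.Ioo (-Real.pi) 0)
    {G : ℂ → ℂ} (hG : DifferentiableOn ℂ G strip) {a b : ℝ → ℂ}
    (ha : AEStronglyMeasurable a volume) (hb : AEStronglyMeasurable b volume)
    (h1 : Tendsto (fun y : ℝ => eLpNorm (slice G y - a) 2 volume) l (𝓝 0))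
    (h2 : Tendsto (fun y : ℝ => eLpNorm (slice G y - b) 2 volume) l (𝓝 0)) :
    a =ᵐ[volume] b := by
  have h3 : eLpNorm (a - b) 2 volume ≤ 0 := by
    refine ge_of_tendsto (by simpa using h1.add h2) ?_
    filter_upwards [hl] with y hy
    have hm := (continuous_slice hG hy).aestronglyMeasurable (μ := volume)
    have e : a - b = (slice G y - b) - (slice G y - a) := by abel
    rw [e, add_comm]
    exact eLpNorm_sub_le (hm.sub hb) (hm.sub ha) (by norm_num)
  have h4 := (eLpNorm_eq_zero_iff (ha.sub hb) (by norm_num)).1 (le_antisymm h3 zero_le)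
  filter_upwards [h4] with x hx
  exact sub_eq_zero.1 hx

/-- Distance `η` from both edges gains a factor `exp (-2πη|k|)`. It is square integrable and
therefore makes the inverse transform of an `L²` function absolutely convergent. -/
lemma hardy_integrable_bound {α β : Hilb}
    (hβ : ⇑β =ᵐ[volume] fun k => (Real.exp (2 * Real.pi * Real.pi * k) : ℂ) * α k) {η : ℝ}
    (hη : 0 < η) :
    Integrable (fun k : ℝ => Real.exp (-(2 * Real.pi * η * |k|)) * (‖α k‖ + ‖β k‖)) ∧
    ∀ᵐ k : ℝ, ∀ z : ℂ, z.im ∈ Set.Icc (-Real.pi + η) (-η) →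
      ‖Complex.exp (2 * Real.pi * Complex.I * k * z) * α k‖
        ≤ Real.exp (-(2 * Real.pi * η * |k|)) * (‖α k‖ + ‖β k‖) := by
  have hpi := Real.pi_pos
  constructor
  · have h1 : MemLp (fun k : ℝ => Real.exp (-(2 * Real.pi * η * |k|))) 2 volume := by
      refine (memLp_two_iff_integrable_sq (Continuous.aestronglyMeasurable (by fun_prop))).2 ?_
      have h2 : Integrable fun k : ℝ => Real.exp (-(4 * Real.pi * η) * |k|) := by
        have h3 : (0 : ℝ) < 4 * Real.pi * η := by positivity
        rw [← integrableOn_univ, ← Set.Iic_union_Ioi (a := (0 : ℝ))]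
        refine IntegrableOn.union ?_ ?_
        · refine (integrableOn_exp_mul_Iic h3 0).congr_fun (fun k hk => ?_) measurableSet_Iic
          simp only [abs_of_nonpos (Set.mem_Iic.1 hk), neg_mul_neg]
        · refine (integrableOn_exp_mul_Ioi (neg_lt_zero.2 h3) 0).congr_fun (fun k hk => ?_)
            measurableSet_Ioi
          simp only [abs_of_pos (Set.mem_Ioi.1 hk)]
      refine h2.congr (Eventually.of_forall fun k => ?_)
      simp only
      rw [← Real.exp_nat_mul]
      congr 1
      push_cast
      ring
    exact MemLp.integrable_mul (p := 2) (q := 2) h1 ((Lp.memLp α).norm.add (Lp.memLp β).norm)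
  · filter_upwards [hβ] with k hk z hz
    have e1 : ‖Complex.exp (2 * Real.pi * Complex.I * k * z)‖
        = Real.exp (-(2 * Real.pi * k * z.im)) := by
      rw [Complex.norm_exp]
      congr 1
      simp
    rw [norm_mul, e1, hk, norm_mul, Complex.norm_real, Real.norm_eq_abs, Real.abs_exp,
      ← one_add_mul, ← mul_assoc]
    refine mul_le_mul_of_nonneg_right ?_ (norm_nonneg _)
    rcases le_total 0 k with h0 | h0
    · rw [abs_of_nonneg h0, mul_add, ← Real.exp_add]
      refine le_trans (Real.exp_le_exp.2 ?_) (le_add_of_nonneg_left (by positivity))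
      have : 0 ≤ 2 * Real.pi * k * (z.im - (-Real.pi + η)) :=
        mul_nonneg (by positivity) (by linarith [hz.1])
      nlinarith
    · rw [abs_of_nonpos h0, mul_add]
      refine le_trans ?_ (le_add_of_nonneg_right (by positivity))
      rw [mul_one]
      refine Real.exp_le_exp.2 ?_
      have : 0 ≤ 2 * Real.pi * (-k) * (-η - z.im) :=
        mul_nonneg (mul_nonneg (by positivity) (by linarith)) (by linarith [hz.2])
      nlinarith

/-- Vectors whose Fourier transforms differ by the factor `exp (2π²k)` are the boundary values of
a Hardy function. -/
lemma mem_continuationGraph_of_FT {a b : Hilb}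
    (hab : ⇑(FT b) =ᵐ[volume] fun k => (Real.exp (2 * Real.pi * Real.pi * k) : ℂ) * FT a k) :
    (a, b) ∈ continuationGraph := by
  set α := FT a with hα
  set β := FT b with hβ
  have hpi := Real.pi_pos
  -- The inverse Fourier integral at a complex argument; height `y` inserts the factor `exp
  -- (-2πky)`.
  set G : ℂ → ℂ := fun z => ∫ k : ℝ, Complex.exp (2 * Real.pi * Complex.I * k * z) * α k with hGdef
  have hmeas : ∀ z : ℂ, AEStronglyMeasurable
      (fun k : ℝ => Complex.exp (2 * Real.pi * Complex.I * k * z) * α k) volume := fun z =>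
    (Continuous.aestronglyMeasurable (by fun_prop)).mul (Lp.aestronglyMeasurable _)
  have hdiff : DifferentiableOn ℂ G strip := by
    refine differentiableOn_integral isOpen_strip (fun z _ => hmeas z)
      (Eventually.of_forall fun k => by fun_prop) fun z₀ hz₀ => ?_
    -- With half the distance from `z₀` to the edges, the ball of radius `η` still stays at distance
    -- `η` from them.
    set η := min (z₀.im + Real.pi) (-z₀.im) / 2 with hη
    have h1 : 0 < z₀.im + Real.pi := by linarith [hz₀.1]
    have h2 : 0 < -z₀.im := by linarith [hz₀.2]
    have hη0 : 0 < η := half_pos (lt_min h1 h2)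
    obtain ⟨hi, hb⟩ := hardy_integrable_bound hab hη0
    refine ⟨η, hη0, _, hi, ?_⟩
    filter_upwards [hb] with k hk z hz _
    refine hk z ?_
    have h3 : |z.im - z₀.im| < η := by
      have := (Complex.abs_im_le_norm (z - z₀)).trans_lt (by simpa [dist_eq_norm] using hz)
      simpa using this
    have h4 := abs_lt.1 h3
    have h5 : 2 * η ≤ z₀.im + Real.pi := by rw [hη]; linarith [min_le_left (z₀.im + Real.pi) (-z₀.im)]
    have h6 : 2 * η ≤ -z₀.im := by rw [hη]; linarith [min_le_right (z₀.im + Real.pi) (-z₀.im)]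
    constructor <;> linarith
  have hu : ∀ y ∈ Set.Ioo (-Real.pi) 0, MemLp (fun k : ℝ =>
      (Real.exp (-(2 * Real.pi * k * y)) : ℂ) * α k) 2 volume := fun y hy => by
    refine MemLp.of_le ((Lp.memLp α).norm.add (Lp.memLp β).norm)
      ((Continuous.aestronglyMeasurable (by fun_prop)).mul (Lp.aestronglyMeasurable _)) ?_
    filter_upwards [norm_exp_mul_le hab] with k hk
    exact (hk y (Set.Ioo_subset_Icc_self hy)).trans (le_abs_self _)
  have hslice : ∀ y (hy : y ∈ Set.Ioo (-Real.pi) 0),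
      slice G y =ᵐ[volume] FT.symm ((hu y hy).toLp _) := fun y hy => by
    have hc := (hu y hy).coeFn_toLp
    have e1 : ∀ k : ℝ, Complex.exp (2 * Real.pi * Complex.I * k * ((0 : ℝ) + y * Complex.I)) * α k
        = (Real.exp (-(2 * Real.pi * k * y)) : ℂ) * α k := fun k => by
      rw [Complex.ofReal_exp]
      congr 2
      push_cast
      linear_combination (2 * Real.pi * k * y : ℂ) * Complex.I_sq
    have hint : Integrable ((hu y hy).toLp _) := by
      set η := min (y + Real.pi) (-y) with hη
      obtain ⟨hi, hb⟩ := hardy_integrable_bound hab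
        (lt_min (by linarith [hy.1]) (by linarith [hy.2]) : 0 < η)
      refine hi.mono' (Lp.aestronglyMeasurable _) ?_
      filter_upwards [hb, hc] with k hk h2
      rw [h2, ← e1]
      refine hk _ ?_
      simp only [Complex.add_im, Complex.ofReal_im, Complex.mul_im, Complex.ofReal_re,
        Complex.I_im, Complex.I_re]
      constructor <;> linarith [min_le_left (y + Real.pi) (-y), min_le_right (y + Real.pi) (-y)]
    filter_upwards [FT_symm_ae hint] with x hx
    rw [hx]
    refine integral_congr_ae ?_
    filter_upwards [hc] with k hk
    rw [hk, ← e1, ← mul_assoc, ← Complex.exp_add]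
    congr 2
    push_cast
    ring
  have hG : IsHardy G := by
    have hfin : eLpNorm (fun k => ‖α k‖ + ‖β k‖) 2 volume ≠ ⊤ :=
      ((Lp.memLp α).norm.add (Lp.memLp β).norm).2.ne
    refine ⟨hdiff, (eLpNorm (fun k => ‖α k‖ + ‖β k‖) 2 volume).toNNReal, fun y hy => ?_⟩
    rw [eLpNorm_congr_ae (hslice y hy), ← Lp.enorm_def, LinearIsometryEquiv.enorm_map,
      enorm_eq_of_ae (hu y hy).coeFn_toLp,
      ENNReal.coe_toNNReal hfin]
    refine eLpNorm_mono_ae ?_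
    filter_upwards [norm_exp_mul_le hab] with k hk
    exact (hk y (Set.Ioo_subset_Icc_self hy)).trans (le_abs_self _)
  have hFT : ∀ y (hy : y ∈ Set.Ioo (-Real.pi) 0), ⇑(FT (hG.toHilb hy)) =ᵐ[volume]
        fun k => (Real.exp (-(2 * Real.pi * k * y)) : ℂ) * α k := fun y hy => by
    have e : hG.toHilb hy = FT.symm ((hu y hy).toLp _) :=
      Lp.ext ((hG.coe_toHilb hy).trans (hslice y hy))
    rw [e, LinearIsometryEquiv.apply_symm_apply]
    exact (hu y hy).coeFn_toLp
  have h1 := upper_value_of_FT hG hab hFT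
  have h2 := lower_value_of_FT hG hab hFT
  rw [hα, LinearIsometryEquiv.symm_apply_apply] at h1
  rw [hβ, LinearIsometryEquiv.symm_apply_apply] at h2
  exact ⟨G, hG, h1, h2⟩

/-- In the Fourier picture `Δ^{1/2}` is the maximal operator of multiplication by `exp (2π²k)`.
Every operator-theoretic property of `Δ^{1/2}` below is read off from this. -/
lemma mem_continuationGraph_iff {a b : Hilb} :
    (a, b) ∈ continuationGraph ↔
      ⇑(FT b) =ᵐ[volume] fun k => (Real.exp (2 * Real.pi * Real.pi * k) : ℂ) * FT a k := by
  refine ⟨?_, mem_continuationGraph_of_FT⟩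
  rintro ⟨G, hG, h1, h2⟩
  obtain ⟨α, β, hβ, hFT⟩ := hG.exists_FT
  have e1 : a = FT.symm α := Lp.ext (l2Value_unique upper_mem hG.analytic
    (Lp.aestronglyMeasurable _) (Lp.aestronglyMeasurable _) h1 (upper_value_of_FT hG hβ hFT))
  have e2 : b = FT.symm β := Lp.ext (l2Value_unique lower_mem hG.analytic
    (Lp.aestronglyMeasurable _) (Lp.aestronglyMeasurable _) h2 (lower_value_of_FT hG hβ hFT))
  rw [e1, e2, LinearIsometryEquiv.apply_symm_apply, LinearIsometryEquiv.apply_symm_apply]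
  exact hβ

/-! ### Self-adjointness -/

/-- `toLinearPMap` is faithful only for a single-valued relation. That holds here because the
multiplier sends `0` to `0`. -/
lemma deltaHalf_graph : DeltaHalf.graph = continuationGraph := by
  refine Submodule.toLinearPMap_graph_eq _ ?_
  rintro ⟨a, b⟩ h h0
  rw [mem_continuationGraph_iff] at h
  simp only at h0 ⊢
  subst h0
  have h1 : ⇑(FT b) =ᵐ[volume] 0 := by
    rw [map_zero] at h
    filter_upwards [h, Lp.coeFn_zero ℂ 2 (volume : Measure ℝ)] with k hk h0
    rw [hk, h0]
    simp
  exact (LinearIsometryEquiv.map_eq_zero_iff FT).1 ((Lp.eq_zero_iff_ae_eq_zero).2 h1)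

lemma isSelfAdjoint_of_graph_adjoint {T : Hilb →ₗ.[ℂ] Hilb} (hT : Dense (T.domain : Set Hilb))
    (h : T.graph.adjoint = T.graph) : IsSelfAdjoint T :=
  LinearPMap.eq_of_eq_graph ((LinearPMap.adjoint_graph_eq_graph_adjoint hT).trans h)

lemma IsSelfAdjoint.graph_adjoint {T : Hilb →ₗ.[ℂ] Hilb} (hT : IsSelfAdjoint T) :
    T.graph.adjoint = T.graph := by
  rw [← LinearPMap.adjoint_graph_eq_graph_adjoint hT.dense_domain,
    LinearPMap.isSelfAdjoint_def.1 hT]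

/-- The vector with Fourier transform truncated to `[-N, N]`, together with its image. -/
lemma exists_truncated_mem_graph (D : Hilb) (N : ℕ) :
    ∃ a b : Hilb, (a, b) ∈ continuationGraph ∧
      (⇑(FT a) =ᵐ[volume] (Set.Icc (-N : ℝ) N).indicator D) ∧
      (⇑(FT b) =ᵐ[volume] fun k => (Real.exp (2 * Real.pi * Real.pi * k) : ℂ) *
        (Set.Icc (-N : ℝ) N).indicator D k) := by
  have h1 := (Lp.memLp D).indicator (s := Set.Icc (-N : ℝ) N) measurableSet_Icc
  have h2 := memLp_indicator_exp (2 * Real.pi * Real.pi) D N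
  have e : ∀ k, (Set.Icc (-N : ℝ) N).indicator
      (fun k => (Real.exp (2 * Real.pi * Real.pi * k) : ℂ) * D k) k
      = (Real.exp (2 * Real.pi * Real.pi * k) : ℂ) * (Set.Icc (-N : ℝ) N).indicator D k := fun k => by
    by_cases hk : k ∈ Set.Icc (-N : ℝ) N
    · simp only [Set.indicator_of_mem hk]
    · simp only [Set.indicator_of_notMem hk, mul_zero]
  have h3 : ⇑(FT (FT.symm (h1.toLp _))) =ᵐ[volume] (Set.Icc (-N : ℝ) N).indicator D := by
    rw [LinearIsometryEquiv.apply_symm_apply]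
    exact h1.coeFn_toLp
  have h4 : ⇑(FT (FT.symm (h2.toLp _))) =ᵐ[volume]
      fun k => (Real.exp (2 * Real.pi * Real.pi * k) : ℂ) *
        (Set.Icc (-N : ℝ) N).indicator D k := by
    rw [LinearIsometryEquiv.apply_symm_apply]
    exact h2.coeFn_toLp.trans (Eventually.of_forall e)
  refine ⟨FT.symm (h1.toLp _), FT.symm (h2.toLp _), ?_, h3, h4⟩
  rw [mem_continuationGraph_iff]
  filter_upwards [h3, h4] with k e1 e2
  rw [e1, e2]

/-- A vector orthogonal to the domain is orthogonal to its own spectral truncations, which lie in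
the domain because the multiplier is bounded on `[-N, N]`. -/
lemma deltaHalf_dense : Dense (DeltaHalf.domain : Set Hilb) := by
  rw [Submodule.dense_iff_topologicalClosure_eq_top, Submodule.topologicalClosure_eq_top_iff,
    Submodule.eq_bot_iff]
  intro η hη
  have h0 : ⇑(FT η) =ᵐ[volume] 0 := by
    refine ae_eq_zero_of_integral_conj_mul
      (fun N => (Lp.memLp (FT η)).indicator measurableSet_Icc) fun N => ?_
    obtain ⟨a, b, hab, ha, -⟩ := exists_truncated_mem_graph (FT η) N
    have hmem : a ∈ DeltaHalf.domain := ⟨(a, b), hab, rfl⟩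
    have h1 := (Submodule.mem_orthogonal _ _).1 hη a hmem
    rw [← FT_inner, L2_inner] at h1
    rw [← h1]
    refine integral_congr_ae ?_
    filter_upwards [ha] with k hk
    rw [hk]
  exact (LinearIsometryEquiv.map_eq_zero_iff FT).1 ((Lp.eq_zero_iff_ae_eq_zero).2 h0)

/-- The multiplier is real, so the graph lies in its adjoint. Conversely, testing a pair of the
adjoint graph on spectrally truncated vectors shows that its components differ by the multiplier. -/
theorem deltaHalf_isSelfAdjoint : IsSelfAdjoint DeltaHalf := by
  refine isSelfAdjoint_of_graph_adjoint deltaHalf_dense ?_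
  rw [deltaHalf_graph]
  ext ⟨η, η'⟩
  rw [Submodule.mem_adjoint_iff, mem_continuationGraph_iff]
  constructor
  · intro h
    set g : ℝ → ℂ := fun k => (Real.exp (2 * Real.pi * Real.pi * k) : ℂ) * FT η k with hg
    set D : ℝ → ℂ := fun k => FT η' k - g k with hDdef
    have hgN : ∀ N : ℕ, MemLp ((Set.Icc (-N : ℝ) N).indicator g) 2 (volume : Measure ℝ) :=
      memLp_indicator_exp (2 * Real.pi * Real.pi) (FT η)
    have hD : ∀ N : ℕ, MemLp ((Set.Icc (-N : ℝ) N).indicator D) 2 (volume : Measure ℝ) :=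
      fun N => by
        have := ((Lp.memLp (FT η')).indicator (s := Set.Icc (-N : ℝ) N) measurableSet_Icc).sub
          (hgN N)
        rw [← Set.indicator_sub'] at this
        exact this
    -- The test vector is the truncation of the defect `D` itself, so the adjoint relation says that
    -- its norm vanishes.
    have key := ae_eq_zero_of_integral_conj_mul hD fun N => by
      obtain ⟨a, b, hab, ha, hb⟩ := exists_truncated_mem_graph ((hD N).toLp _) N
      have h1 := h a b hab
      simp only at h1
      rw [← FT_inner, ← FT_inner a, L2_inner, L2_inner,
        ← integral_sub (integrable_conj_mul (Lp.memLp _) (Lp.memLp _))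
          (integrable_conj_mul (Lp.memLp _) (Lp.memLp _))] at h1
      rw [← neg_eq_zero, ← integral_neg, ← h1]
      refine integral_congr_ae ?_
      filter_upwards [ha, hb, (hD N).coeFn_toLp] with k e1 e2 e3
      rw [e1, e2]
      by_cases hk : k ∈ Set.Icc (-N : ℝ) N
      · simp only [Set.indicator_of_mem hk] at e3 ⊢
        rw [e3, hDdef]
        simp only [hg, map_mul, Complex.conj_ofReal]
        ring
      · simp [Set.indicator_of_notMem hk]
    filter_upwards [key] with k hk
    exact sub_eq_zero.1 hk
  · intro h a b hab
    rw [mem_continuationGraph_iff] at hab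
    simp only
    rw [sub_eq_zero, ← FT_inner, ← FT_inner a, L2_inner, L2_inner]
    refine integral_congr_ae ?_
    filter_upwards [h, hab] with k h1 h2
    rw [h1, h2, map_mul, Complex.conj_ofReal]
    ring

/-- The operator `V* T V`. -/
def sandwich (T : Hilb →ₗ.[ℂ] Hilb) (V : Hilb →L[ℂ] Hilb) : Hilb →ₗ.[ℂ] Hilb :=
  (ContinuousLinearMap.adjoint V).toLinearMap.compPMap (compBounded T V)

lemma mem_sandwich_graph {T : Hilb →ₗ.[ℂ] Hilb} {V : Hilb →L[ℂ] Hilb} {ξ ξ' : Hilb} :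
    (ξ, ξ') ∈ (sandwich T V).graph ↔
      ∃ b, (V ξ, b) ∈ T.graph ∧ ξ' = ContinuousLinearMap.adjoint V b := by
  constructor
  · intro h
    obtain ⟨x, hx1, hx2⟩ := LinearPMap.mem_graph_iff _ |>.1 h
    simp only at hx1 hx2
    subst hx1
    exact ⟨T ⟨V x, x.2⟩, LinearPMap.mem_graph T ⟨V x, x.2⟩, hx2.symm⟩
  · rintro ⟨b, hb, rfl⟩
    obtain ⟨x, hx1, hx2⟩ := LinearPMap.mem_graph_iff _ |>.1 hb
    simp only at hx1 hx2
    refine LinearPMap.mem_graph_iff _ |>.2 ⟨⟨ξ, ?_⟩, rfl, ?_⟩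
    · change V ξ ∈ T.domain
      rw [← hx1]; exact x.2
    · change ContinuousLinearMap.adjoint V (T ⟨V ξ, _⟩) = _
      rw [← hx2]
      congr 2
      exact Subtype.ext hx1.symm

/-- With `W = V⁻¹` every vector of `dom T` is `V (W a)`, so a pair in the adjoint graph of `V* T V`
gives a pair `(V η, W* η')` in the adjoint graph of `T`. Density holds because the domain contains
`W (dom T)`. -/
theorem sandwich_isSelfAdjoint {T : Hilb →ₗ.[ℂ] Hilb} (hT : IsSelfAdjoint T)
    {V W : Hilb →L[ℂ] Hilb} (hVW : ∀ x, V (W x) = x) (hWV : ∀ x, W (V x) = x) :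
    IsSelfAdjoint (sandwich T V) := by
  have hdense : Dense ((sandwich T V).domain : Set Hilb) := by
    have h1 : Dense (W '' (T.domain : Set Hilb)) :=
      (Function.Surjective.denseRange fun x => ⟨V x, hWV x⟩).dense_image W.continuous
        hT.dense_domain
    refine h1.mono ?_
    rintro _ ⟨x, hx, rfl⟩
    change V (W x) ∈ T.domain
    rw [hVW]; exact hx
  refine isSelfAdjoint_of_graph_adjoint hdense ?_
  have hadj : ∀ x, ContinuousLinearMap.adjoint V (ContinuousLinearMap.adjoint W x) = x := fun x => by
    refine ext_inner_right ℂ fun y => ?_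
    rw [ContinuousLinearMap.adjoint_inner_left, ContinuousLinearMap.adjoint_inner_left, hWV]
  ext ⟨η, η'⟩
  rw [Submodule.mem_adjoint_iff, mem_sandwich_graph]
  constructor
  · intro h
    refine ⟨ContinuousLinearMap.adjoint W η', ?_, (hadj η').symm⟩
    rw [← IsSelfAdjoint.graph_adjoint hT, Submodule.mem_adjoint_iff]
    intro a b hab
    have h1 := h (W a) (ContinuousLinearMap.adjoint V b)
      (mem_sandwich_graph.2 ⟨b, by rwa [hVW], rfl⟩)
    simp only at h1 ⊢
    rw [ContinuousLinearMap.adjoint_inner_left] at h1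
    rwa [ContinuousLinearMap.adjoint_inner_right]
  · rintro ⟨b', hb', rfl⟩ a b hab
    obtain ⟨b'', hb'', rfl⟩ := mem_sandwich_graph.1 hab
    rw [← IsSelfAdjoint.graph_adjoint hT, Submodule.mem_adjoint_iff] at hb'
    have := hb' _ _ hb''
    simp only at this ⊢
    rwa [ContinuousLinearMap.adjoint_inner_left, ContinuousLinearMap.adjoint_inner_right]

/-! ### Boundary limits of Poisson integrals -/

/-- Take the least such `k`. If `k > 0`, minimality gives `|t| > 2^(k-1) ε`, and the loss of one
dyadic step is the factor `4`. -/
lemma exists_dyadic {ε : ℝ} (hε : 0 < ε) (t : ℝ) :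
    ∃ k : ℕ, |t| ≤ 2 ^ k * ε ∧ ε / (t ^ 2 + ε ^ 2) ≤ 4 / (4 ^ k * ε) := by
  classical
  have hex : ∃ k : ℕ, |t| ≤ 2 ^ k * ε := by
    obtain ⟨k, hk⟩ := pow_unbounded_of_one_lt (|t| / ε) (by norm_num : (1 : ℝ) < 2)
    exact ⟨k, ((div_lt_iff₀ hε).1 hk).le⟩
  refine ⟨Nat.find hex, Nat.find_spec hex, ?_⟩
  rcases h : Nat.find hex with _ | k
  · rw [div_le_div_iff₀ (by positivity) (by positivity)]
    nlinarith [sq_nonneg t]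
  · have h1 : ¬ |t| ≤ 2 ^ k * ε := Nat.find_min hex (by omega)
    push Not at h1
    have h2 : (2 ^ k * ε) ^ 2 ≤ t ^ 2 := by
      rw [← sq_abs t]
      exact pow_le_pow_left₀ (by positivity) h1.le 2
    have h3 : ((2 : ℝ) ^ k) ^ 2 = 4 ^ k := by rw [← pow_mul, mul_comm, pow_mul]; norm_num
    rw [mul_pow, h3] at h2
    rw [div_le_div_iff₀ (by positivity) (by positivity), pow_succ]
    nlinarith [sq_nonneg ε]

lemma lintegral_poisson_le (τ : Measure ℝ) (x : ℝ) {ε : ℝ} (hε : 0 < ε) :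
    ∫⁻ s, ENNReal.ofReal (ε / ((s - x) ^ 2 + ε ^ 2)) ∂τ
      ≤ ∑' k : ℕ, ENNReal.ofReal (4 / (4 ^ k * ε)) * τ (Metric.closedBall x (2 ^ k * ε)) := by
  calc ∫⁻ s, ENNReal.ofReal (ε / ((s - x) ^ 2 + ε ^ 2)) ∂τ
      ≤ ∫⁻ s, ∑' k : ℕ, (Metric.closedBall x (2 ^ k * ε)).indicator
          (fun _ => ENNReal.ofReal (4 / (4 ^ k * ε))) s ∂τ := by
        refine lintegral_mono fun s => ?_
        obtain ⟨k, hk1, hk2⟩ := exists_dyadic hε (s - x)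
        refine le_trans ?_ (ENNReal.le_tsum k)
        rw [Set.indicator_of_mem (by simpa [Metric.mem_closedBall, Real.dist_eq] using hk1)]
        exact ENNReal.ofReal_le_ofReal hk2
    _ = _ := by
        rw [lintegral_tsum fun k =>
          (measurable_const.indicator Metric.isClosed_closedBall.measurableSet).aemeasurable]
        congr 1
        ext k
        rw [lintegral_indicator Metric.isClosed_closedBall.measurableSet, setLIntegral_const]

/-- Zero density at `x` and linear growth give `τ(B(x, r)) ≤ M r` for all `r`. The dyadic sum is
then dominated by the geometric series of `4M / 2^k`, and each of its terms tends to zero by zero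
density. -/
lemma tendsto_lintegral_poisson {τ : Measure ℝ} {x A B : ℝ}
    (hAB : ∀ r > 0, τ (Metric.closedBall x r) ≤ ENNReal.ofReal (A + B * r))
    (h0 : Tendsto (fun r => τ (Metric.closedBall x r) / ENNReal.ofReal r) (𝓝[>] 0) (𝓝 0)) :
    Tendsto (fun ε => ∫⁻ s, ENNReal.ofReal (ε / ((s - x) ^ 2 + ε ^ 2)) ∂τ) (𝓝[>] 0) (𝓝 0) := by
  set φ : ℝ → ℝ := fun r => (τ (Metric.closedBall x r)).toReal with hφ
  have hfin : ∀ r > 0, τ (Metric.closedBall x r) = ENNReal.ofReal (φ r) := fun r hr =>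
    (ENNReal.ofReal_toReal ((hAB r hr).trans_lt ENNReal.ofReal_lt_top).ne).symm
  have hφ0 : ∀ r, 0 ≤ φ r := fun r => ENNReal.toReal_nonneg
  have h1 : Tendsto (fun r => φ r / r) (𝓝[>] 0) (𝓝 0) := by
    have := (ENNReal.tendsto_toReal ENNReal.zero_ne_top).comp h0
    rw [ENNReal.toReal_zero] at this
    refine this.congr' ?_
    filter_upwards [self_mem_nhdsWithin] with r hr
    simp only [Function.comp_apply, ENNReal.toReal_div, ENNReal.toReal_ofReal (le_of_lt hr), hφ]
  obtain ⟨M, hM0, hM⟩ : ∃ M : ℝ, 0 ≤ M ∧ ∀ r > 0, φ r ≤ M * r := by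
    have h2 := h1.eventually (gt_mem_nhds one_pos)
    obtain ⟨r₀, hr₀, hr⟩ := (mem_nhdsGT_iff_exists_Ioo_subset).1 h2
    have hr₀' : 0 < r₀ := hr₀
    -- Zero density handles `r < r₀` with constant `1`; for `r ≥ r₀` the constant term satisfies
    -- `|A| ≤ (|A| / r₀) r`.
    refine ⟨1 + |A| / r₀ + |B|, by positivity, fun r hr0 => ?_⟩
    rcases lt_or_ge r r₀ with h3 | h3
    · have h4 : φ r / r < 1 := hr ⟨hr0, h3⟩
      have h5 := (div_lt_one hr0).1 h4
      have : 0 ≤ (|A| / r₀ + |B|) * r := by positivity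
      nlinarith
    · have h4 : φ r ≤ |A| + |B| * r := by
        have h5 := hAB r hr0
        refine (ENNReal.toReal_le_of_le_ofReal (by positivity)
          (h5.trans (ENNReal.ofReal_le_ofReal ?_)))
        gcongr <;> exact le_abs_self _
      have h5 : |A| ≤ |A| / r₀ * r := by
        rw [div_mul_eq_mul_div, le_div_iff₀ hr₀']
        gcongr
      nlinarith
  have hbd : ∀ (ε : ℝ), 0 < ε → ∀ k : ℕ,
      4 / (4 ^ k * ε) * φ (2 ^ k * ε) ≤ 4 * M * (1 / 2) ^ k := fun ε hε k => by
    calc 4 / (4 ^ k * ε) * φ (2 ^ k * ε) ≤ 4 / (4 ^ k * ε) * (M * (2 ^ k * ε)) := by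
          gcongr; exact hM _ (by positivity)
      _ = 4 * M * (1 / 2) ^ k := by
          have h4 : (4 : ℝ) ^ k = 2 ^ k * 2 ^ k := by rw [← mul_pow]; norm_num
          rw [h4, one_div, inv_pow]
          field_simp
  have hgeo : Summable fun k : ℕ => 4 * M * (1 / 2 : ℝ) ^ k :=
    (summable_geometric_of_lt_one (by norm_num) (by norm_num)).mul_left _
  have hsum : ∀ ε : ℝ, 0 < ε → Summable fun k : ℕ => 4 / (4 ^ k * ε) * φ (2 ^ k * ε) :=
    fun ε hε => Summable.of_nonneg_of_le (fun k => mul_nonneg (by positivity) (hφ0 _))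
      (hbd ε hε) hgeo
  have hlim : Tendsto (fun ε : ℝ => ∑' k : ℕ, 4 / (4 ^ k * ε) * φ (2 ^ k * ε)) (𝓝[>] 0)
      (𝓝 (∑' k : ℕ, (0 : ℝ))) := by
    refine tendsto_tsum_of_dominated_convergence hgeo (fun k => ?_) ?_
    · have h2 : Tendsto (fun ε : ℝ => 2 ^ k * ε) (𝓝[>] 0) (𝓝[>] 0) := by
        refine tendsto_nhdsWithin_iff.2 ⟨?_, ?_⟩
        · have : Continuous fun ε : ℝ => 2 ^ k * ε := by fun_prop
          simpa using (this.tendsto 0).mono_left nhdsWithin_le_nhds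
        · filter_upwards [self_mem_nhdsWithin] with ε hε
          have : (0 : ℝ) < ε := hε
          simp only [Set.mem_Ioi]
          positivity
      have h3 := (h1.comp h2).const_mul (4 / 2 ^ k : ℝ)
      rw [mul_zero] at h3
      refine h3.congr' ?_
      filter_upwards [self_mem_nhdsWithin] with ε hε
      have : (0 : ℝ) < ε := hε
      have h4 : (4 : ℝ) ^ k = 2 ^ k * 2 ^ k := by rw [← mul_pow]; norm_num
      simp only [Function.comp_apply, h4]
      field_simp
    · filter_upwards [self_mem_nhdsWithin] with ε hε k
      have : (0 : ℝ) < ε := hε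
      rw [Real.norm_of_nonneg (mul_nonneg (by positivity) (hφ0 _))]
      exact hbd ε hε k
  rw [tsum_zero] at hlim
  have hlim' := ENNReal.tendsto_ofReal hlim
  rw [ENNReal.ofReal_zero] at hlim'
  refine tendsto_of_tendsto_of_tendsto_of_le_of_le' tendsto_const_nhds hlim'
    (Eventually.of_forall fun _ => zero_le) ?_
  filter_upwards [self_mem_nhdsWithin] with ε hε
  have hε' : (0 : ℝ) < ε := hε
  refine (lintegral_poisson_le τ x hε').trans ?_
  rw [ENNReal.ofReal_tsum_of_nonneg (fun k => mul_nonneg (by positivity) (hφ0 _)) (hsum ε hε')]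
  refine le_of_eq (tsum_congr fun k => ?_)
  rw [hfin _ (by positivity), ← ENNReal.ofReal_mul (by positivity)]

/-- The kernel `(1 + ws) / (w - s)` on the lower half-plane. -/
def halfKernel (w : ℂ) (s : ℝ) : ℂ := (1 + w * s) / (w - s)

/-- The Poisson kernel of the lower half-plane (without the factor `1/π`). -/
def poisson (w : ℂ) (s : ℝ) : ℝ := -w.im / ((s - w.re) ^ 2 + w.im ^ 2)

lemma poisson_nonneg {w : ℂ} (hw : w.im < 0) (s : ℝ) : 0 ≤ poisson w s :=
  div_nonneg (by linarith) (by positivity)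

lemma continuous_poisson {w : ℂ} (hw : w.im < 0) : Continuous (poisson w) := by
  unfold poisson
  refine continuous_const.div (by fun_prop) fun s => ?_
  have : 0 < w.im ^ 2 := by nlinarith
  positivity

lemma sub_ofReal_ne_zero {w : ℂ} (hw : w.im < 0) (s : ℝ) : w - s ≠ 0 := fun h => by
  have := congrArg Complex.im h
  simp at this
  linarith

lemma continuous_halfKernel {w : ℂ} (hw : w.im < 0) : Continuous (halfKernel w) := by
  unfold halfKernel
  exact Continuous.div (by fun_prop) (by fun_prop) (sub_ofReal_ne_zero hw)

lemma halfKernel_im {w : ℂ} (hw : w.im < 0) (s : ℝ) :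
    (halfKernel w s).im = poisson w s * (1 + s ^ 2) := by
  have h0 : 0 < (s - w.re) ^ 2 + w.im ^ 2 := by
    have : 0 < w.im ^ 2 := by nlinarith
    positivity
  rw [halfKernel, poisson, Complex.div_im, Complex.normSq_apply]
  simp only [Complex.add_im, Complex.one_im, Complex.mul_im, Complex.ofReal_re, Complex.ofReal_im,
    Complex.sub_re, Complex.sub_im, Complex.add_re, Complex.one_re, Complex.mul_re]
  have h1 : (w.re - s) * (w.re - s) + (w.im - 0) * (w.im - 0) = (s - w.re) ^ 2 + w.im ^ 2 := by ring
  rw [h1]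
  field_simp
  ring

/-- Non-tangential approach to the boundary point `x` from the lower half-plane. -/
def NT (x : ℝ) : Filter ℂ := 𝓝 (x : ℂ) ⊓ 𝓟 {w | w.im < 0 ∧ |w.re - x| ≤ |w.im|}

instance (x : ℝ) : (NT x).IsCountablyGenerated := by unfold NT; infer_instance

lemma NT_mem (x : ℝ) : ∀ᶠ w in NT x, w.im < 0 ∧ |w.re - x| ≤ |w.im| :=
  mem_inf_of_right (mem_principal_self _)

lemma NT_le (x : ℝ) : NT x ≤ 𝓝 (x : ℂ) := inf_le_left

lemma tendsto_neg_im (x : ℝ) : Tendsto (fun w : ℂ => -w.im) (NT x) (𝓝[>] 0) := by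
  refine tendsto_nhdsWithin_iff.2 ⟨?_, ?_⟩
  · have : Continuous fun w : ℂ => -w.im := by fun_prop
    simpa using (this.tendsto (x : ℂ)).mono_left (NT_le x)
  · filter_upwards [NT_mem x] with w hw
    simpa using hw.1

/-- In the cone `|Re w - x| ≤ |Im w|` one has `(s - x)² ≤ 2 (s - Re w)² + 2 (Im w)²`. The kernel is
thus comparable to the one centred at `x`, with constant `3`. -/
lemma poisson_le {x : ℝ} {w : ℂ} (hw : w.im < 0 ∧ |w.re - x| ≤ |w.im|) (s : ℝ) :
    poisson w s ≤ 3 * (-w.im / ((s - x) ^ 2 + (-w.im) ^ 2)) := by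
  have h1 : (w.re - x) ^ 2 ≤ w.im ^ 2 := sq_le_sq.2 hw.2
  have h2 : 0 < w.im ^ 2 := by nlinarith [hw.1]
  have h4 : 0 < (s - x) ^ 2 + (-w.im) ^ 2 := by rw [neg_sq]; positivity
  rw [poisson, ← mul_div_assoc, div_le_div_iff₀ (by positivity) h4]
  have h3 : (s - x) ^ 2 + (-w.im) ^ 2 ≤ 3 * ((s - w.re) ^ 2 + w.im ^ 2) := by
    nlinarith [sq_nonneg (s - w.re - (w.re - x)), sq_nonneg (s - w.re)]
  nlinarith [hw.1]

/-- Poisson integrals vanish at points of zero density. -/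
lemma tendsto_lintegral_poisson_NT {τ : Measure ℝ} {x A B : ℝ}
    (hAB : ∀ r > 0, τ (Metric.closedBall x r) ≤ ENNReal.ofReal (A + B * r))
    (h0 : Tendsto (fun r => τ (Metric.closedBall x r) / ENNReal.ofReal r) (𝓝[>] 0) (𝓝 0)) :
    Tendsto (fun w => ∫⁻ s, ENNReal.ofReal (poisson w s) ∂τ) (NT x) (𝓝 0) := by
  have h1 := (tendsto_lintegral_poisson hAB h0).comp (tendsto_neg_im x)
  have h2 := ENNReal.Tendsto.const_mul (a := ENNReal.ofReal 3) h1 (Or.inr ENNReal.ofReal_ne_top)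
  rw [mul_zero] at h2
  refine tendsto_of_tendsto_of_tendsto_of_le_of_le' tendsto_const_nhds h2
    (Eventually.of_forall fun _ => zero_le) ?_
  filter_upwards [NT_mem x] with w hw
  simp only [Function.comp_apply]
  rw [← lintegral_const_mul' _ _ ENNReal.ofReal_ne_top]
  refine lintegral_mono fun s => ?_
  rw [← ENNReal.ofReal_mul (by norm_num)]
  exact ENNReal.ofReal_le_ofReal (poisson_le hw s)

lemma tendsto_poisson {x s : ℝ} (hs : s ≠ x) : Tendsto (fun w => poisson w s) (NT x) (𝓝 0) := by
  have h : ContinuousAt (fun w : ℂ => poisson w s) (x : ℂ) := by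
    unfold poisson
    refine ContinuousAt.div (by fun_prop) (by fun_prop) ?_
    have : (s - x) ^ 2 ≠ 0 := pow_ne_zero 2 (sub_ne_zero.2 hs)
    simpa using sub_ne_zero.2 hs
  have h1 : poisson (x : ℂ) s = 0 := by simp [poisson]
  have := h.tendsto.mono_left (NT_le x)
  rwa [h1] at this

/-- The factor `s - x` in `s² - x² = (s - x)² + 2x(s - x)` tames the kernel: `ε t²` and `2εt` are
both at most `t² + ε²` once `ε < 1`, where the first also uses `t² ≤ t² + ε²`. -/
lemma norm_poisson_mul_le {x : ℝ} {w : ℂ} (hw : w.im < 0 ∧ |w.re - x| ≤ |w.im|)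
    (hw1 : -w.im < 1) (s : ℝ) : ‖poisson w s * (s ^ 2 - x ^ 2)‖ ≤ 3 + 3 * |x| := by
  set ε := -w.im with hε
  have hε0 : 0 < ε := by linarith [hw.1]
  have h1 := poisson_le hw s
  rw [← hε] at h1
  rw [norm_mul, Real.norm_of_nonneg (poisson_nonneg hw.1 s), Real.norm_eq_abs]
  have h2 : |s ^ 2 - x ^ 2| ≤ |s - x| ^ 2 + 2 * |x| * |s - x| := by
    rw [show s ^ 2 - x ^ 2 = (s - x) ^ 2 + 2 * x * (s - x) by ring]
    refine (abs_add_le _ _).trans (le_of_eq ?_)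
    rw [abs_pow, abs_mul, abs_mul, abs_two]
  set t := |s - x| with ht
  have ht0 : 0 ≤ t := abs_nonneg _
  have h3 : (s - x) ^ 2 = t ^ 2 := (sq_abs _).symm
  rw [h3] at h1
  have h4 : 0 < t ^ 2 + ε ^ 2 := by positivity
  calc poisson w s * |s ^ 2 - x ^ 2|
      ≤ 3 * (ε / (t ^ 2 + ε ^ 2)) * (t ^ 2 + 2 * |x| * t) :=
        mul_le_mul h1 h2 (abs_nonneg _) (by positivity)
    _ = 3 * (ε * (t ^ 2 / (t ^ 2 + ε ^ 2))) + 3 * |x| * (2 * ε * t / (t ^ 2 + ε ^ 2)) := by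
        field_simp
    _ ≤ 3 * (1 * 1) + 3 * |x| * 1 := by
        have h5 : t ^ 2 / (t ^ 2 + ε ^ 2) ≤ 1 := (div_le_one h4).2 (by nlinarith)
        have h6 : 2 * ε * t / (t ^ 2 + ε ^ 2) ≤ 1 := (div_le_one h4).2 (by nlinarith [sq_nonneg (t - ε)])
        gcongr
    _ = _ := by ring

/-- Replacing the weight `1 + s²` by its value at the boundary point. -/
lemma tendsto_poisson_weight {μ : Measure ℝ} {ρ : ℝ → ℝ} (hρ : Integrable ρ μ) (x : ℝ) :
    Tendsto (fun w => ∫ s, poisson w s * (s ^ 2 - x ^ 2) * ρ s ∂μ) (NT x) (𝓝 0) := by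
  have h : Tendsto (fun w => ∫ s, poisson w s * (s ^ 2 - x ^ 2) * ρ s ∂μ) (NT x)
      (𝓝 (∫ s, (0 : ℝ) ∂μ)) := by
    refine tendsto_integral_filter_of_dominated_convergence (fun s => (3 + 3 * |x|) * ‖ρ s‖)
      ?_ ?_ (hρ.norm.const_mul _) (Eventually.of_forall fun s => ?_)
    · filter_upwards [NT_mem x] with w hw
      have := continuous_poisson hw.1
      exact (Continuous.aestronglyMeasurable (by fun_prop)).mul hρ.1
    · filter_upwards [NT_mem x, (tendsto_neg_im x).eventually
        (mem_nhdsWithin_of_mem_nhds (gt_mem_nhds one_pos))] with w hw hw1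
      refine Eventually.of_forall fun s => ?_
      rw [norm_mul]
      gcongr
      exact norm_poisson_mul_le hw hw1 s
    · by_cases hs : s = x
      · subst hs
        simp only [sub_self, mul_zero, zero_mul]
        exact tendsto_const_nhds
      · simpa using ((tendsto_poisson hs).mul_const (s ^ 2 - x ^ 2)).mul_const (ρ s)
  simpa using h

lemma poisson_le_inv {w : ℂ} (hw : w.im < 0) (s : ℝ) : poisson w s ≤ (-w.im)⁻¹ := by
  have h2 : 0 < w.im ^ 2 := by nlinarith
  rw [poisson, div_le_iff₀ (by positivity)]
  have h3 : (-w.im)⁻¹ * w.im ^ 2 = -w.im := by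
    have : w.im ≠ 0 := hw.ne
    field_simp
  have h4 : 0 ≤ (-w.im)⁻¹ * (s - w.re) ^ 2 :=
    mul_nonneg (inv_nonneg.2 (by linarith)) (by positivity)
  nlinarith

lemma integrable_poisson_mul {μ : Measure ℝ} {ρ : ℝ → ℝ} (hρ : Integrable ρ μ) {w : ℂ}
    (hw : w.im < 0) : Integrable (fun s => poisson w s * ρ s) μ :=
  hρ.bdd_mul (continuous_poisson hw).aestronglyMeasurable (c := (-w.im)⁻¹)
    (Eventually.of_forall fun s => by
      rw [Real.norm_of_nonneg (poisson_nonneg hw s)]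
      exact poisson_le_inv hw s)

lemma poisson_weight_bound {w : ℂ} (hw : w.im < 0) :
    ∃ C, ∀ s, ‖poisson w s * (1 + s ^ 2)‖ ≤ C := by
  refine ⟨(-w.im)⁻¹ * (1 + 2 * w.re ^ 2) + 2 * (-w.im), fun s => ?_⟩
  have h0 := poisson_nonneg hw s
  have h1 := poisson_le_inv hw s
  rw [Real.norm_of_nonneg (by positivity)]
  have h2 : poisson w s * (s - w.re) ^ 2 ≤ -w.im := by
    have h2 : 0 < w.im ^ 2 := by nlinarith
    rw [poisson, div_mul_eq_mul_div, div_le_iff₀ (by positivity)]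
    nlinarith [mul_pos (neg_pos.2 hw) h2]
  have h3 : 1 + s ^ 2 ≤ (1 + 2 * w.re ^ 2) + 2 * (s - w.re) ^ 2 := by
    nlinarith [sq_nonneg (s - 2 * w.re)]
  calc poisson w s * (1 + s ^ 2)
      ≤ poisson w s * ((1 + 2 * w.re ^ 2) + 2 * (s - w.re) ^ 2) := by gcongr
    _ = poisson w s * (1 + 2 * w.re ^ 2) + 2 * (poisson w s * (s - w.re) ^ 2) := by ring
    _ ≤ _ := by gcongr

lemma integrable_poisson_weight_mul {μ : Measure ℝ} {ρ : ℝ → ℝ} (hρ : Integrable ρ μ) {w : ℂ}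
    (hw : w.im < 0) : Integrable (fun s => poisson w s * (1 + s ^ 2) * ρ s) μ := by
  obtain ⟨C, hC⟩ := poisson_weight_bound hw
  have := continuous_poisson hw
  exact hρ.bdd_mul (Continuous.aestronglyMeasurable (by fun_prop)) (Eventually.of_forall hC)

/-- The limit of a Poisson integral with the weight `1 + s²`. -/
lemma tendsto_poisson_of_unweighted {μ : Measure ℝ} {ρ : ℝ → ℝ} (hρ : Integrable ρ μ) {x d : ℝ}
    (h : Tendsto (fun w => ∫ s, poisson w s * ρ s ∂μ) (NT x) (𝓝 d)) :
    Tendsto (fun w => ∫ s, poisson w s * (1 + s ^ 2) * ρ s ∂μ) (NT x) (𝓝 ((1 + x ^ 2) * d)) := by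
  have h1 := (tendsto_poisson_weight hρ x).add (h.const_mul (1 + x ^ 2))
  rw [zero_add] at h1
  refine h1.congr' ?_
  filter_upwards [NT_mem x] with w hw
  have hi := integrable_poisson_mul hρ hw.1
  have hi2 := integrable_poisson_weight_mul hρ hw.1
  have e : ∀ s, poisson w s * (s ^ 2 - x ^ 2) * ρ s
      = poisson w s * (1 + s ^ 2) * ρ s - (1 + x ^ 2) * (poisson w s * ρ s) := fun s => by ring
  simp only [e]
  rw [integral_sub hi2 (hi.const_mul _), integral_const_mul]
  ring

lemma integral_poisson {w : ℂ} (hw : w.im < 0) :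
    Integrable (poisson w) ∧ ∫ s, poisson w s = Real.pi := by
  have h0 : -w.im ≠ 0 := by linarith
  have e : poisson w = fun s => (-w.im)⁻¹ * (fun t => (1 + (t / (-w.im)) ^ 2)⁻¹) (s - w.re) := by
    ext s
    have h2 : 0 < w.im ^ 2 := by nlinarith
    have h3 : w.im ≠ 0 := hw.ne
    have h4 : (s - w.re) ^ 2 + w.im ^ 2 ≠ 0 := by positivity
    have h5 : 1 + ((s - w.re) / (-w.im)) ^ 2 = ((s - w.re) ^ 2 + w.im ^ 2) / w.im ^ 2 := by
      field_simp
      ring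
    simp only [poisson, h5]
    field_simp
  constructor
  · rw [e]
    exact ((integrable_inv_one_add_sq.comp_div h0).comp_sub_right w.re).const_mul _
  · rw [e, integral_const_mul, integral_sub_right_eq_self (fun t => (1 + (t / (-w.im)) ^ 2)⁻¹),
      Measure.integral_comp_div (fun t => (1 + t ^ 2)⁻¹), integral_univ_inv_one_add_sq,
      abs_of_pos (by linarith), smul_eq_mul, ← mul_assoc, inv_mul_cancel₀ h0, one_mul]

lemma integral_poisson_eq_toReal {τ : Measure ℝ} {w : ℂ} (hw : w.im < 0) :
    ∫ s, poisson w s ∂τ = (∫⁻ s, ENNReal.ofReal (poisson w s) ∂τ).toReal :=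
  integral_eq_lintegral_of_nonneg_ae (Eventually.of_forall (poisson_nonneg hw))
    (continuous_poisson hw).aestronglyMeasurable

/-- The Poisson integral of a singular measure vanishes almost everywhere on the boundary. -/
lemma ae_tendsto_poisson_singular {ν : Measure ℝ} [IsFiniteMeasure ν]
    (hν : ν.MutuallySingular volume) :
    ∀ᵐ x : ℝ, Tendsto (fun w => ∫ s, poisson w s * (1 + s ^ 2) ∂ν) (NT x) (𝓝 0) := by
  -- Differentiation of measures: almost everywhere the density of a singular measure with respect
  -- to Lebesgue measure is zero.
  filter_upwards [Besicovitch.ae_tendsto_rnDeriv ν volume, hν.rnDeriv_ae_eq_zero] with x hx hx0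
  rw [hx0] at hx
  have h0 : Tendsto (fun r => ν (Metric.closedBall x r) / ENNReal.ofReal r) (𝓝[>] 0) (𝓝 0) := by
    have h1 := ENNReal.Tendsto.const_mul (a := 2) hx (Or.inr (by norm_num))
    rw [Pi.zero_apply, mul_zero] at h1
    refine h1.congr' ?_
    filter_upwards [self_mem_nhdsWithin] with r hr
    have hr' : ENNReal.ofReal r ≠ 0 := by simpa using hr
    rw [Real.volume_closedBall, ENNReal.ofReal_mul (by norm_num), ← mul_div_assoc,
      ENNReal.ofReal_ofNat, ENNReal.mul_div_mul_left _ _ (by norm_num) (by norm_num)]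
  have h1 := tendsto_lintegral_poisson_NT (τ := ν) (x := x) (A := (ν Set.univ).toReal) (B := 0)
    (fun r _ => by
      rw [zero_mul, add_zero, ENNReal.ofReal_toReal (measure_ne_top _ _)]
      exact measure_mono (Set.subset_univ _)) h0
  have h2 := (ENNReal.tendsto_toReal ENNReal.zero_ne_top).comp h1
  rw [ENNReal.toReal_zero] at h2
  have h3 : Tendsto (fun w => ∫ s, poisson w s * (1 : ℝ) ∂ν) (NT x) (𝓝 0) := by
    refine h2.congr' ?_
    filter_upwards [NT_mem x] with w hw
    simp only [mul_one, Function.comp_apply, integral_poisson_eq_toReal hw.1]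
  have := tendsto_poisson_of_unweighted (integrable_const (1 : ℝ)) h3
  simpa using this

/-- The Poisson integral of an integrable density has the density as boundary value. -/
lemma ae_tendsto_poisson_density {ρ : ℝ → ℝ} (hρ : Integrable ρ) :
    ∀ᵐ x : ℝ, Tendsto (fun w => ∫ s, poisson w s * (1 + s ^ 2) * ρ s) (NT x)
      (𝓝 (Real.pi * (1 + x ^ 2) * ρ x)) := by
  filter_upwards [IsUnifLocDoublingMeasure.ae_tendsto_average_norm_sub (μ := (volume : Measure ℝ))
    hρ.locallyIntegrable 1] with x hx
  -- At a Lebesgue point `x` of `ρ`, the measure `|ρ(s) - ρ(x)| ds` has zero density at `x`, and its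
  -- Poisson integral bounds the error because the kernel has total mass `π`.
  set τ : Measure ℝ := volume.withDensity fun s => ENNReal.ofReal ‖ρ s - ρ x‖ with hτ
  have hcb : ∀ r : ℝ, IntegrableOn (fun s => ‖ρ s - ρ x‖) (Metric.closedBall x r) := fun r =>
    ((hρ.integrableOn).sub (integrableOn_const measure_closedBall_lt_top.ne)).norm
  have hτr : ∀ r : ℝ, τ (Metric.closedBall x r)
      = ENNReal.ofReal (∫ s in Metric.closedBall x r, ‖ρ s - ρ x‖) := fun r => by
    rw [hτ, withDensity_apply _ Metric.isClosed_closedBall.measurableSet,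
      ofReal_integral_eq_lintegral_ofReal (hcb r) (Eventually.of_forall fun s => norm_nonneg _)]
  have h0 : Tendsto (fun r => τ (Metric.closedBall x r) / ENNReal.ofReal r) (𝓝[>] 0) (𝓝 0) := by
    have h1 := hx (fun _ => x) id tendsto_id (by
      filter_upwards [self_mem_nhdsWithin] with r hr
      exact Metric.mem_closedBall_self (by simpa using le_of_lt hr))
    have h2 := ENNReal.tendsto_ofReal (h1.const_mul 2)
    rw [mul_zero, ENNReal.ofReal_zero] at h2
    refine h2.congr' ?_
    filter_upwards [self_mem_nhdsWithin] with r hr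
    have hr' : (0 : ℝ) < r := hr
    rw [hτr, ← ENNReal.ofReal_div_of_pos hr', setAverage_eq, measureReal_def, id,
      Real.volume_closedBall, ENNReal.toReal_ofReal (by positivity), smul_eq_mul]
    congr 1
    field_simp
  have hAB : ∀ r > 0, τ (Metric.closedBall x r)
      ≤ ENNReal.ofReal ((∫ s, ‖ρ s‖) + (2 * ‖ρ x‖) * r) := fun r hr => by
    rw [hτr]
    refine ENNReal.ofReal_le_ofReal ?_
    have hc : IntegrableOn (fun _ : ℝ => ‖ρ x‖) (Metric.closedBall x r) :=
      integrableOn_const measure_closedBall_lt_top.ne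
    calc ∫ s in Metric.closedBall x r, ‖ρ s - ρ x‖
        ≤ ∫ s in Metric.closedBall x r, (‖ρ s‖ + ‖ρ x‖) :=
          integral_mono (hcb r) (hρ.norm.integrableOn.add hc) fun s => norm_sub_le _ _
      _ = (∫ s in Metric.closedBall x r, ‖ρ s‖) + (2 * ‖ρ x‖) * r := by
          rw [integral_add hρ.norm.integrableOn hc, setIntegral_const, measureReal_def,
            Real.volume_closedBall, ENNReal.toReal_ofReal (by positivity), smul_eq_mul]
          ring
      _ ≤ _ := by
          have := setIntegral_le_integral (s := Metric.closedBall x r) hρ.norm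
            (Eventually.of_forall fun s => norm_nonneg _)
          linarith
  have h1 := (ENNReal.tendsto_toReal ENNReal.zero_ne_top).comp (tendsto_lintegral_poisson_NT hAB h0)
  rw [ENNReal.toReal_zero] at h1
  have hm : AEMeasurable (fun s => ENNReal.ofReal ‖ρ s - ρ x‖) volume :=
    ((hρ.1.aemeasurable.sub_const (ρ x)).norm).ennreal_ofReal
  have h2 : Tendsto (fun w => ∫ s, poisson w s * ρ s) (NT x) (𝓝 (Real.pi * ρ x)) := by
    rw [tendsto_iff_norm_sub_tendsto_zero]
    refine squeeze_zero' (Eventually.of_forall fun _ => norm_nonneg _) ?_ h1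
    filter_upwards [NT_mem x] with w hw
    obtain ⟨hi, hpi⟩ := integral_poisson hw.1
    have e : (∫ s, poisson w s * ρ s) - Real.pi * ρ x = ∫ s, poisson w s * (ρ s - ρ x) := by
      rw [← hpi, ← integral_mul_const, ← integral_sub (integrable_poisson_mul hρ hw.1)
        (hi.mul_const _)]
      simp only [mul_sub]
    rw [e]
    refine (norm_integral_le_integral_norm _).trans (le_of_eq ?_)
    have hm2 : AEStronglyMeasurable (fun s => ‖poisson w s * (ρ s - ρ x)‖) volume :=
      ((continuous_poisson hw.1).aestronglyMeasurable.mul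
        (hρ.1.sub aestronglyMeasurable_const)).norm
    rw [Function.comp_apply, integral_eq_lintegral_of_nonneg_ae
      (Eventually.of_forall fun s => norm_nonneg _) hm2]
    congr 1
    have hmm : Measurable fun s => ENNReal.ofReal (poisson w s) :=
      (continuous_poisson hw.1).measurable.ennreal_ofReal
    rw [hτ, lintegral_withDensity_eq_lintegral_mul₀ hm hmm.aemeasurable]
    refine lintegral_congr fun s => ?_
    rw [norm_mul, Real.norm_of_nonneg (poisson_nonneg hw.1 s), Pi.mul_apply, mul_comm,
      ENNReal.ofReal_mul (norm_nonneg _)]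
  have h3 := tendsto_poisson_of_unweighted hρ h2
  convert h3 using 2
  ring

/-! ### Vertical approach in the strip -/

lemma exp_slice (θ y : ℝ) : Complex.exp (θ + y * Complex.I)
    = Real.exp θ * (Real.cos y + Real.sin y * Complex.I) := by
  rw [Complex.exp_add, Complex.exp_mul_I, Complex.ofReal_exp, Complex.ofReal_cos, Complex.ofReal_sin]

lemma exp_slice_re (θ y : ℝ) : (Complex.exp (θ + y * Complex.I)).re = Real.exp θ * Real.cos y := by
  rw [Complex.exp_re]; simp

lemma exp_slice_im (θ y : ℝ) : (Complex.exp (θ + y * Complex.I)).im = Real.exp θ * Real.sin y := by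
  rw [Complex.exp_im]; simp

lemma exp_im_neg {ζ : ℂ} (hζ : ζ ∈ strip) : (Complex.exp ζ).im < 0 := by
  rw [Complex.exp_im]
  exact mul_neg_of_pos_of_neg (Real.exp_pos _) (Real.sin_neg_of_neg_of_neg_pi_lt hζ.2 hζ.1)

/-- This places the image of a vertical segment inside the cone of `NT`: `(1 - cos y)² ≤ 1 - cos² y`
when `cos y ≥ 0`. -/
lemma one_sub_cos_le {y : ℝ} (hy : |y| ≤ Real.pi / 2) : 1 - Real.cos y ≤ |Real.sin y| := by
  have hc : 0 ≤ Real.cos y := Real.cos_nonneg_of_mem_Icc (abs_le.1 hy)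
  have h1 := Real.cos_le_one y
  have h2 := Real.sin_sq_add_cos_sq y
  refine abs_le_of_sq_le_sq' ?_ (abs_nonneg _) |>.2
  rw [sq_abs]
  nlinarith

/-- The exponential maps a vertical line to an arc of the circle of radius `e^θ` about `0`, which
meets the real axis at a right angle, hence non-tangentially. -/
lemma tendsto_exp_upper (θ : ℝ) :
    Tendsto (fun y : ℝ => Complex.exp (θ + y * Complex.I)) (𝓝[<] 0) (NT (Real.exp θ)) := by
  have hpi := Real.pi_pos
  refine tendsto_inf.2 ⟨?_, tendsto_principal.2 ?_⟩
  · have : Continuous fun y : ℝ => Complex.exp (θ + y * Complex.I) := by fun_prop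
    simpa using (this.tendsto 0).mono_left nhdsWithin_le_nhds
  · filter_upwards [Ioo_mem_nhdsLT (show -(Real.pi / 2) < 0 by linarith)] with y hy
    have hs : Real.sin y < 0 :=
      Real.sin_neg_of_neg_of_neg_pi_lt hy.2 (by linarith [hy.1])
    refine ⟨?_, ?_⟩
    · rw [exp_slice_im]
      exact mul_neg_of_pos_of_neg (Real.exp_pos _) hs
    · rw [exp_slice_re, exp_slice_im, abs_mul, Real.abs_exp,
        show Real.exp θ * Real.cos y - Real.exp θ = -(Real.exp θ * (1 - Real.cos y)) by ring,
        abs_neg, abs_mul, Real.abs_exp, abs_of_nonneg (by linarith [Real.cos_le_one y])]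
      gcongr
      exact one_sub_cos_le (abs_le.2 ⟨by linarith [hy.1], by linarith [hy.2]⟩)

lemma tendsto_exp_lower (θ : ℝ) :
    Tendsto (fun y : ℝ => Complex.exp (θ + y * Complex.I)) (𝓝[>] (-Real.pi))
      (NT (-Real.exp θ)) := by
  have hpi := Real.pi_pos
  refine tendsto_inf.2 ⟨?_, tendsto_principal.2 ?_⟩
  · have : Continuous fun y : ℝ => Complex.exp (θ + y * Complex.I) := by fun_prop
    have h := (this.tendsto (-Real.pi)).mono_left (nhdsWithin_le_nhds (s := Set.Ioi (-Real.pi)))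
    rw [exp_slice] at h
    simpa using h
  · filter_upwards [Ioo_mem_nhdsGT (show -Real.pi < -(Real.pi / 2) by linarith)] with y hy
    have hs : Real.sin y < 0 :=
      Real.sin_neg_of_neg_of_neg_pi_lt (by linarith [hy.2]) hy.1
    have h1 := one_sub_cos_le (y := y + Real.pi) (abs_le.2 ⟨by linarith [hy.1], by linarith [hy.2]⟩)
    rw [Real.cos_add_pi, Real.sin_add_pi, abs_neg] at h1
    refine ⟨?_, ?_⟩
    · rw [exp_slice_im]
      exact mul_neg_of_pos_of_neg (Real.exp_pos _) hs
    · rw [exp_slice_re, exp_slice_im, abs_mul, Real.abs_exp,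
        show Real.exp θ * Real.cos y - -Real.exp θ = Real.exp θ * (1 - - Real.cos y) by ring,
        abs_mul, Real.abs_exp, abs_of_nonneg (by linarith [Real.neg_one_le_cos y])]
      gcongr

/-- The exceptional set is contained in the image under `log` of a null subset of the positive axis,
and differentiable maps send null sets to null sets. -/
lemma ae_exp_of_ae {p : ℝ → Prop} (h : ∀ᵐ x : ℝ, p x) : ∀ᵐ θ : ℝ, p (Real.exp θ) := by
  rw [ae_iff] at h ⊢
  set N := {x : ℝ | ¬ p x} with hN
  have h1 : {θ : ℝ | ¬ p (Real.exp θ)} ⊆ Real.log '' (N ∩ Set.Ioi 0) := fun θ hθ =>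
    ⟨Real.exp θ, ⟨hθ, Real.exp_pos _⟩, Real.log_exp θ⟩
  refine measure_mono_null h1 (addHaar_image_eq_zero_of_differentiableOn_of_addHaar_eq_zero
    (μ := volume) (fun x hx => ?_) (measure_mono_null Set.inter_subset_left h))
  exact (Real.differentiableAt_log (ne_of_gt hx.2)).differentiableWithinAt

lemma ae_neg_exp_of_ae {p : ℝ → Prop} (h : ∀ᵐ x : ℝ, p x) : ∀ᵐ θ : ℝ, p (-Real.exp θ) :=
  ae_exp_of_ae (p := fun x => p (-x))
    ((Measure.measurePreserving_neg (volume : Measure ℝ)).quasiMeasurePreserving.ae h)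

/-- The two edges of the strip cover the real line except for the point `0`. -/
lemma ae_of_ae_exp {p : ℝ → Prop} (h1 : ∀ᵐ θ : ℝ, p (Real.exp θ))
    (h2 : ∀ᵐ θ : ℝ, p (-Real.exp θ)) : ∀ᵐ x : ℝ, p x := by
  rw [ae_iff] at h1 h2 ⊢
  have h3 : {x : ℝ | ¬ p x} ⊆ Real.exp '' {θ : ℝ | ¬ p (Real.exp θ)} ∪
      ((fun θ => -Real.exp θ) '' {θ : ℝ | ¬ p (-Real.exp θ)} ∪ {0}) := fun x hx => by
    rcases lt_trichotomy x 0 with h | h | h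
    · have e : -Real.exp (Real.log (-x)) = x := by rw [Real.exp_log (neg_pos.2 h), neg_neg]
      refine Or.inr (Or.inl ⟨Real.log (-x), ?_, e⟩)
      rw [Set.mem_ofPred_eq, e]
      exact hx
    · exact Or.inr (Or.inr h)
    · refine Or.inl ⟨Real.log x, ?_, Real.exp_log h⟩
      simpa [Real.exp_log h] using hx
  refine measure_mono_null h3 (measure_union_null ?_ (measure_union_null ?_ (measure_singleton _)))
  · exact addHaar_image_eq_zero_of_differentiableOn_of_addHaar_eq_zero (μ := volume)
      (fun x _ => Real.differentiableAt_exp.differentiableWithinAt) h1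
  · exact addHaar_image_eq_zero_of_differentiableOn_of_addHaar_eq_zero (μ := volume)
      (fun x _ => Real.differentiableAt_exp.neg.differentiableWithinAt) h2

/-! ### The Herglotz representation -/

instance instMeasurableSpaceCircle : MeasurableSpace Circle := borel Circle

instance instBorelSpaceCircle : BorelSpace Circle := ⟨rfl⟩

/-- A continuous nonnegative density on the unit circle gives a finite measure. -/
lemma exists_circle_measure {g : ℂ → ℝ} (hg : ContinuousOn g (Metric.sphere 0 1))
    (hg0 : ∀ z ∈ Metric.sphere (0 : ℂ) 1, 0 ≤ g z) :
    ∃ μ : FiniteMeasure Circle, ∀ f : Circle →ᵇ ℝ, ∀ f' : ℂ → ℝ,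
      (∀ e : Circle, f e = f' e) → ∫ e, f e ∂(μ : Measure Circle)
        = Real.circleAverage (fun z => f' z * g z) 0 1 := by
  have hpi := Real.pi_pos
  have hcm : ∀ θ : ℝ, ((Circle.exp θ : Circle) : ℂ) = circleMap 0 1 θ := fun θ => by
    simp [circleMap, Circle.coe_exp]
  have hmem : ∀ θ : ℝ, circleMap 0 1 θ ∈ Metric.sphere (0 : ℂ) 1 := fun θ =>
    circleMap_mem_sphere 0 zero_le_one θ
  set d : ℝ → ℝ := fun θ => (2 * Real.pi)⁻¹ * g (circleMap 0 1 θ) with hd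
  have hdc : Continuous d := continuous_const.mul
    (hg.comp_continuous (continuous_circleMap 0 1) hmem)
  have hd0 : ∀ θ, 0 ≤ d θ := fun θ => mul_nonneg (by positivity) (hg0 _ (hmem θ))
  set τ : Measure ℝ := (volume.restrict (Set.Ioc 0 (2 * Real.pi))).withDensity
    fun θ => ENNReal.ofReal (d θ) with hτ
  have hint : Integrable d (volume.restrict (Set.Ioc 0 (2 * Real.pi))) :=
    (hdc.integrableOn_Icc (a := 0) (b := 2 * Real.pi)).mono_set Set.Ioc_subset_Icc_self
  have hfin : IsFiniteMeasure τ :=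
    isFiniteMeasure_withDensity_ofReal hint.2
  have hexp : Continuous (fun θ : ℝ => Circle.exp θ) := Circle.exp.continuous
  have hfin2 : IsFiniteMeasure (τ.map fun θ => Circle.exp θ) :=
    Measure.isFiniteMeasure_map τ _
  refine ⟨⟨τ.map fun θ => Circle.exp θ, hfin2⟩, fun f f' hf => ?_⟩
  change ∫ e, f e ∂(τ.map fun θ => Circle.exp θ) = _
  rw [integral_map hexp.aemeasurable f.continuous.aestronglyMeasurable, hτ,
    integral_withDensity_eq_integral_toReal_smul hdc.measurable.ennreal_ofReal
      (Eventually.of_forall fun _ => ENNReal.ofReal_lt_top), Real.circleAverage_def,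
    intervalIntegral.integral_of_le (by positivity), smul_eq_mul, ← integral_const_mul]
  refine integral_congr_ae (Eventually.of_forall fun θ => ?_)
  change (ENNReal.ofReal (d θ)).toReal • f (Circle.exp θ) = _
  rw [ENNReal.toReal_ofReal (hd0 θ), hf, hcm]
  simp only [smul_eq_mul, hd]
  ring

lemma circle_sub_ne_zero {z : ℂ} (hz : z ∈ Metric.ball (0 : ℂ) 1) (e : Circle) :
    (e : ℂ) - z ≠ 0 := fun h => by
  have h1 : z = e := (sub_eq_zero.1 h).symm
  rw [h1, mem_ball_zero_iff, Circle.norm_coe] at hz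
  exact lt_irrefl _ hz

lemma continuous_circleKernel {z : ℂ} (hz : z ∈ Metric.ball (0 : ℂ) 1) :
    Continuous fun e : Circle => ((e : ℂ) + z) / (e - z) :=
  Continuous.div (by fun_prop) (by fun_prop) (circle_sub_ne_zero hz)

/-- A bounded continuous real function on the circle: the real part of the Herglotz kernel. -/
def reCircleKernel {z : ℂ} (hz : z ∈ Metric.ball (0 : ℂ) 1) : Circle →ᵇ ℝ :=
  BoundedContinuousFunction.mkOfCompact
    ⟨fun e : Circle => (((e : ℂ) + z) / (e - z)).re,
      Complex.continuous_re.comp (continuous_circleKernel hz)⟩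

/-- The approximating measures of the Herglotz theorem. -/
lemma exists_measure_dilate {F : ℂ → ℂ} (hF : DifferentiableOn ℂ F (Metric.ball 0 1))
    (hre : ∀ z ∈ Metric.ball (0 : ℂ) 1, 0 ≤ (F z).re) {r : ℝ} (hr0 : 0 ≤ r) (hr1 : r < 1) :
    ∃ μ : FiniteMeasure Circle, ∀ z (hz : z ∈ Metric.ball (0 : ℂ) 1),
      ∫ e, reCircleKernel hz e ∂(μ : Measure Circle) = (F (r * z)).re := by
  have hmem : ∀ z ∈ Metric.closedBall (0 : ℂ) 1, (r : ℂ) * z ∈ Metric.ball (0 : ℂ) 1 :=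
    fun z hz => by
      rw [mem_closedBall_zero_iff] at hz
      rw [mem_ball_zero_iff, norm_mul, Complex.norm_real, Real.norm_of_nonneg hr0]
      nlinarith [norm_nonneg z]
  have hFr : DifferentiableOn ℂ (fun z => F (r * z)) (Metric.closedBall 0 1) :=
    hF.comp (by fun_prop) hmem
  have hdc : DiffContOnCl ℂ (fun z => F (r * z)) (Metric.ball 0 1) :=
    DifferentiableOn.diffContOnCl (hFr.mono Metric.closure_ball_subset_closedBall)
  have hcont : ContinuousOn (fun z => F (r * z)) (Metric.sphere (0 : ℂ) 1) :=
    hFr.continuousOn.mono Metric.sphere_subset_closedBall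
  obtain ⟨μ, hμ⟩ := exists_circle_measure (g := fun z => (F (r * z)).re)
    (Complex.continuous_re.comp_continuousOn hcont)
    fun z hz => hre _ (hmem z (Metric.sphere_subset_closedBall hz))
  refine ⟨μ, fun z hz => ?_⟩
  rw [hμ (reCircleKernel hz) (fun e => ((e + z) / (e - z)).re) fun e => rfl]
  -- The Poisson formula applies to `F(r ·)`, which is continuous up to the circle because `r < 1`.
  have h1 := hdc.circleAverage_re_herglotzRieszKernel_smul' hz
  simp only [sub_zero] at h1
  have hci : CircleIntegrable (fun e => ((e + z) / (e - z)).re • F (r * e)) 0 1 := by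
    refine ContinuousOn.circleIntegrable zero_le_one (ContinuousOn.fun_smul ?_ hcont)
    refine Complex.continuous_re.comp_continuousOn (ContinuousOn.div (by fun_prop) (by fun_prop) ?_)
    intro e he h
    rw [sub_eq_zero.1 h] at he
    rw [mem_ball_zero_iff] at hz
    rw [mem_sphere_zero_iff_norm] at he
    linarith
  have h2 := Complex.reCLM.circleAverage_comp_comm hci
  rw [h1] at h2
  simpa [Function.comp_def] using h2

/-- Open mapping theorem: `F - H` takes values on the imaginary axis, so its image cannot be open
and it is constant. -/
lemma exists_const_of_re_eq {U : Set ℂ} (hU : IsOpen U) (hUc : IsPreconnected U) {F H : ℂ → ℂ}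
    (hF : DifferentiableOn ℂ F U) (hH : DifferentiableOn ℂ H U)
    (hre : ∀ z ∈ U, (F z).re = (H z).re) : ∃ c : ℝ, ∀ z ∈ U, F z = H z + c * Complex.I := by
  rcases ((hF.sub hH).analyticOnNhd hU).is_constant_or_isOpen hUc with ⟨w, hw⟩ | hopen
  · refine ⟨w.im, fun z hz => ?_⟩
    have h1 : F z - H z = w := hw z hz
    have h2 : w.re = 0 := by rw [← h1, Complex.sub_re, hre z hz, sub_self]
    rw [← sub_eq_iff_eq_add', h1]
    apply Complex.ext <;> simp [h2]
  · rcases U.eq_empty_or_nonempty with rfl | ⟨z, hz⟩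
    · exact ⟨0, fun z hz => absurd hz (Set.notMem_empty z)⟩
    · exfalso
      have h1 := hopen U subset_rfl hU
      obtain ⟨ε, hε, hsub⟩ := Metric.isOpen_iff.1 h1 _ (Set.mem_image_of_mem (F - H) hz)
      obtain ⟨u, hu, hu2⟩ := hsub (show (F - H) z + (ε / 2 : ℝ) ∈ Metric.ball _ ε by
        rw [Metric.mem_ball, dist_eq_norm, add_sub_cancel_left, Complex.norm_real,
          Real.norm_of_nonneg (by positivity)]
        linarith)
      have h2 := congrArg Complex.re hu2
      simp [hre u hu, hre z hz] at h2
      linarith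

lemma differentiableOn_circleKernel_integral (μ : Measure Circle) [IsFiniteMeasure μ] :
    DifferentiableOn ℂ (fun z => ∫ e : Circle, ((e : ℂ) + z) / (e - z) ∂μ) (Metric.ball 0 1) := by
  refine differentiableOn_integral Metric.isOpen_ball
    (fun z hz => (continuous_circleKernel hz).aestronglyMeasurable)
    (Eventually.of_forall fun e => ?_) fun z₀ hz₀ => ?_
  · exact DifferentiableOn.div (by fun_prop) (by fun_prop) fun z hz => circle_sub_ne_zero hz e
  · rw [mem_ball_zero_iff] at hz₀
    set η := (1 - ‖z₀‖) / 2 with hη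
    have hη0 : 0 < η := by rw [hη]; linarith
    refine ⟨η, hη0, fun _ => 2 / η, integrable_const _, Eventually.of_forall fun e z hz hz1 => ?_⟩
    have h1 : ‖z‖ < ‖z₀‖ + η := by
      have h2 : ‖z - z₀‖ < η := by simpa [dist_eq_norm] using hz
      have := norm_add_le z₀ (z - z₀)
      rw [add_sub_cancel] at this
      linarith
    have h3 : ‖(e : ℂ)‖ = 1 := Circle.norm_coe e
    have h4 : η ≤ ‖(e : ℂ) - z‖ := by
      have := norm_sub_norm_le (e : ℂ) z
      rw [h3] at this
      linarith
    have h5 : ‖(e : ℂ) + z‖ ≤ 2 := by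
      have := norm_add_le (e : ℂ) z
      rw [h3] at this
      linarith [mem_ball_zero_iff.1 hz1]
    rw [norm_div]
    exact div_le_div₀ zero_le_two h5 hη0 h4

/-- The **Herglotz representation** of an analytic function with nonnegative real part on the
unit disk. -/
theorem herglotz_disk {F : ℂ → ℂ} (hF : DifferentiableOn ℂ F (Metric.ball 0 1))
    (hre : ∀ z ∈ Metric.ball (0 : ℂ) 1, 0 ≤ (F z).re) :
    ∃ (μ : Measure Circle) (_ : IsFiniteMeasure μ) (c : ℝ), ∀ z ∈ Metric.ball (0 : ℂ) 1,
      F z = (∫ e : Circle, ((e : ℂ) + z) / (e - z) ∂μ) + c * Complex.I := by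
  have hr : ∀ n : ℕ, 0 ≤ 1 - 1 / ((n : ℝ) + 1) ∧ 1 - 1 / ((n : ℝ) + 1) < 1 := fun n => by
    have h1 : (0 : ℝ) < n + 1 := by positivity
    have h2 : 1 / ((n : ℝ) + 1) ≤ 1 := (div_le_one h1).2 (by linarith [n.cast_nonneg (α := ℝ)])
    have h3 : 0 < 1 / ((n : ℝ) + 1) := by positivity
    constructor <;> linarith
  choose μ hμ using fun n => exists_measure_dilate hF hre (hr n).1 (hr n).2
  have h0 : (0 : ℂ) ∈ Metric.ball (0 : ℂ) 1 := Metric.mem_ball_self one_pos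
  -- At `z = 0` the kernel is `1`, so all approximating measures have total mass `Re F(0)`.
  have hmass : ∀ n, (μ n).mass = ⟨(F 0).re, hre 0 h0⟩ := fun n => by
    have h1 := hμ n 0 h0
    have h2 : ∀ e : Circle, reCircleKernel h0 e = 1 := fun e => by
      change (((e : ℂ) + 0) / (e - 0)).re = 1
      rw [add_zero, sub_zero, div_self (by simp), Complex.one_re]
    simp only [h2, mul_zero, integral_const, smul_eq_mul, mul_one] at h1
    exact NNReal.eq h1
  -- Weak compactness of the measures of bounded mass on the circle yields a limit along an
  -- ultrafilter, without extracting a subsequence.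
  set 𝒰 : Ultrafilter ℕ := Ultrafilter.of atTop with h𝒰
  have hle : (𝒰 : Filter ℕ) ≤ atTop := Ultrafilter.of_le _
  obtain ⟨μ₀, -, hμ₀⟩ := (isCompact_setOfPred_finiteMeasure_le_of_compactSpace Circle
    ⟨(F 0).re, hre 0 h0⟩).ultrafilter_le_nhds (𝒰.map μ) (by
      rw [le_principal_iff]
      exact Filter.Eventually.of_forall (f := (𝒰 : Filter ℕ)) fun n => (hmass n).le)
  have hlim : Tendsto μ 𝒰 (𝓝 μ₀) := hμ₀
  rw [FiniteMeasure.tendsto_iff_forall_integral_tendsto] at hlim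
  refine ⟨μ₀, inferInstance, ?_⟩
  refine exists_const_of_re_eq Metric.isOpen_ball (convex_ball _ _).isPreconnected hF
    (differentiableOn_circleKernel_integral _) fun z hz => ?_
  have h1 := hlim (reCircleKernel hz)
  simp only [hμ] at h1
  have h2 : Tendsto (fun n : ℕ => (F ((1 - 1 / ((n : ℝ) + 1) : ℝ) * z)).re) 𝒰 (𝓝 (F z).re) := by
    have h3 : Tendsto (fun n : ℕ => ((1 - 1 / ((n : ℝ) + 1) : ℝ) : ℂ) * z) atTop (𝓝 z) := by
      have h4 := (tendsto_one_div_add_atTop_nhds_zero_nat (𝕜 := ℝ)).const_sub 1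
      have h5 := ((Complex.continuous_ofReal.tendsto _).comp h4).mul_const z
      simpa using h5
    have h6 := (hF.differentiableAt (Metric.isOpen_ball.mem_nhds hz)).continuousAt.tendsto.comp
      (h3.mono_left hle)
    exact (Complex.continuous_re.tendsto _).comp h6
  rw [tendsto_nhds_unique h2 h1]
  have hi : Integrable (fun e : Circle => ((e : ℂ) + z) / (e - z)) (μ₀ : Measure Circle) :=
    (continuous_circleKernel hz).integrable_of_hasCompactSupport
      (HasCompactSupport.of_compactSpace _)
  exact (Complex.reCLM.integral_comp_comm hi)

/-! ### Herglotz on the strip -/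

lemma norm_halfKernel_le {w : ℂ} (hw : w.im < 0) (s : ℝ) :
    ‖halfKernel w s‖ ≤ ‖w‖ + (1 + ‖w‖ ^ 2) / |w.im| := by
  have h0 := sub_ofReal_ne_zero hw s
  have e : halfKernel w s = -w + (1 + w ^ 2) / (w - s) := by
    rw [halfKernel]
    field_simp
    ring
  have h1 : |w.im| ≤ ‖w - s‖ := by simpa using Complex.abs_im_le_norm (w - s)
  have h2 : ‖1 + w ^ 2‖ ≤ 1 + ‖w‖ ^ 2 := by
    have := norm_add_le 1 (w ^ 2)
    rwa [norm_one, norm_pow] at this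
  rw [e]
  refine (norm_add_le _ _).trans ?_
  rw [norm_neg, norm_div]
  have : 0 < |w.im| := abs_pos.2 hw.ne
  gcongr

lemma kernel_eq (ζ : ℂ) (s : ℝ) : kernel ζ s = halfKernel (Complex.exp ζ) s := rfl

lemma integrable_halfKernel_mul {μ : Measure ℝ} {ρ : ℝ → ℂ} (hρ : Integrable ρ μ) {w : ℂ}
    (hw : w.im < 0) : Integrable (fun s => halfKernel w s * ρ s) μ :=
  hρ.bdd_mul (continuous_halfKernel hw).aestronglyMeasurable
    (Eventually.of_forall (norm_halfKernel_le hw))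

lemma integrable_halfKernel {μ : Measure ℝ} [IsFiniteMeasure μ] {w : ℂ}
    (hw : w.im < 0) : Integrable (halfKernel w) μ := by
  simpa using integrable_halfKernel_mul (integrable_const (1 : ℂ)) hw (μ := μ)

lemma differentiableOn_integral_kernel_mul {μ : Measure ℝ} {ρ : ℝ → ℂ} (hρ : Integrable ρ μ) :
    DifferentiableOn ℂ (fun ζ => ∫ s, kernel ζ s * ρ s ∂μ) strip := by
  refine differentiableOn_integral isOpen_strip
    (fun ζ hζ => (integrable_halfKernel_mul hρ (exp_im_neg hζ)).1)
    (Eventually.of_forall fun s => ?_) fun z₀ hz₀ => ?_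
  · refine DifferentiableOn.mul_const ?_ _
    unfold kernel
    exact DifferentiableOn.div (by fun_prop) (by fun_prop)
      fun ζ hζ => sub_ofReal_ne_zero (exp_im_neg hζ) s
  · set b : ℂ → ℝ := fun ζ =>
      ‖Complex.exp ζ‖ + (1 + ‖Complex.exp ζ‖ ^ 2) / |(Complex.exp ζ).im| with hb
    have hbc : ContinuousAt b z₀ := by
      refine ContinuousAt.add (by fun_prop) (ContinuousAt.div (by fun_prop) ?_ ?_)
      · exact (Complex.continuous_im.comp Complex.continuous_exp).abs.continuousAt
      · exact (abs_pos.2 (exp_im_neg hz₀).ne).ne'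
    obtain ⟨ε, hε, hsub⟩ := Metric.eventually_nhds_iff_ball.1
      (hbc.eventually (gt_mem_nhds (lt_add_one (b z₀))))
    refine ⟨ε, hε, fun s => (b z₀ + 1) * ‖ρ s‖, hρ.norm.const_mul _,
      Eventually.of_forall fun s ζ hζ hζs => ?_⟩
    rw [norm_mul]
    exact mul_le_mul_of_nonneg_right
      ((norm_halfKernel_le (exp_im_neg hζs) s).trans (hsub ζ hζ).le) (norm_nonneg _)

lemma differentiableOn_integral_kernel (μ : Measure ℝ) [IsFiniteMeasure μ] :
    DifferentiableOn ℂ (fun ζ => ∫ s, kernel ζ s ∂μ) strip := by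
  simpa using differentiableOn_integral_kernel_mul (integrable_const (1 : ℂ)) (μ := μ)

/-- The real point that corresponds to a point of the circle. -/
def circleToReal (e : Circle) : ℝ := (Complex.I * (e + 1) / (e - 1)).re

lemma measurable_circleToReal : Measurable circleToReal := by
  have hc : Continuous fun e : Circle => (e : ℂ) := by fun_prop
  have h : Measurable fun e : Circle => (e : ℂ) := hc.measurable
  unfold circleToReal
  exact Complex.measurable_re.comp
    (((h.add_const 1).const_mul _).div (h.sub_const 1))

lemma circleToReal_eq {e : Circle} (he : e ≠ 1) :
    (circleToReal e : ℂ) = Complex.I * (e + 1) / (e - 1) := by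
  refine Complex.conj_eq_iff_re.1 ?_
  have h0 : (e : ℂ) ≠ 0 := e.coe_ne_zero
  have h1 : (e : ℂ) - 1 ≠ 0 := fun h => he (Circle.ext (by simpa using sub_eq_zero.1 h))
  have h2 : 1 - (e : ℂ) ≠ 0 := fun h => h1 (by rw [← neg_sub, h, neg_zero])
  have hc : starRingEnd ℂ (e : ℂ) = (e : ℂ)⁻¹ := by rw [← Circle.coe_inv_eq_conj, Circle.coe_inv]
  simp only [map_div₀, map_mul, map_add, map_sub, map_one, Complex.conj_I, hc]
  have h3 : (e : ℂ)⁻¹ - 1 ≠ 0 := by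
    rw [show (e : ℂ)⁻¹ - 1 = (1 - e) / e by field_simp]
    exact div_ne_zero h2 h0
  rw [div_eq_div_iff h3 h1]
  field_simp
  ring

/-- The Cayley transform carries the disk kernel to that of the lower half-plane. The excluded point
`e = 1` corresponds to `s = ∞`. -/
lemma herglotzKernel_eq {e z w : ℂ} {s : ℝ} (hw : w.im < 0) (he : e ≠ 1)
    (hs : (s : ℂ) = Complex.I * (e + 1) / (e - 1))
    (hz : z = (w + Complex.I) / (w - Complex.I)) (hez : e - z ≠ 0) :
    (e + z) / (e - z) = -Complex.I * halfKernel w s := by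
  have h1 : e - 1 ≠ 0 := sub_ne_zero.2 he
  have h2 : w - Complex.I ≠ 0 := fun h => by
    have := congrArg Complex.im h
    simp at this
    linarith
  have h3 := sub_ofReal_ne_zero hw s
  rw [halfKernel, mul_div_assoc', div_eq_div_iff hez h3, hz, hs]
  field_simp
  linear_combination (-2 * e * w * Complex.I - e ^ 2 * w * Complex.I + e ^ 2 * w ^ 2
    - w * Complex.I - w ^ 2) * Complex.I_sq

/-- The **Herglotz representation** on the strip. -/
theorem herglotz_strip {F : ℂ → ℂ} (hF : DifferentiableOn ℂ F strip)
    (hre : ∀ z ∈ strip, 0 ≤ (F z).re) :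
    ∃ (μ : Measure ℝ) (_ : IsFiniteMeasure μ) (m c : ℝ), 0 ≤ m ∧ ∀ ζ ∈ strip,
      F ζ = -Complex.I * (∫ s, kernel ζ s ∂μ) + m * (Complex.I * Complex.exp ζ)
        + c * Complex.I := by
  set p : ℂ → ℂ := fun z => Complex.I * (1 + z) / (z - 1) with hp
  have hz1 : ∀ z ∈ Metric.ball (0 : ℂ) 1, z - 1 ≠ 0 := fun z hz h => by
    rw [sub_eq_zero.1 h, mem_ball_zero_iff, norm_one] at hz
    exact lt_irrefl _ hz
  have hpim : ∀ z ∈ Metric.ball (0 : ℂ) 1, (p z).im < 0 := fun z hz => by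
    have h1 : 0 < Complex.normSq (z - 1) := Complex.normSq_pos.2 (hz1 z hz)
    have h2 : (p z).im = (Complex.normSq z - 1) / Complex.normSq (z - 1) := by
      rw [hp, Complex.div_im, ← sub_div, Complex.normSq_apply z]
      congr 1
      simp
      ring
    have h3 : Complex.normSq z < 1 := by
      rw [mem_ball_zero_iff] at hz
      rw [Complex.normSq_eq_norm_sq]
      nlinarith [norm_nonneg z]
    rw [h2]
    exact div_neg_of_neg_of_pos (by linarith) h1
  have hlog : ∀ z ∈ Metric.ball (0 : ℂ) 1, Complex.log (p z) ∈ strip := fun z hz => by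
    have := hpim z hz
    refine ⟨Complex.neg_pi_lt_log_im _, ?_⟩
    rw [Complex.log_im]
    exact Complex.arg_neg_iff.2 this
  have hpd : DifferentiableOn ℂ p (Metric.ball 0 1) :=
    DifferentiableOn.div (by fun_prop) (by fun_prop) hz1
  have hld : DifferentiableOn ℂ (fun z => Complex.log (p z)) (Metric.ball 0 1) :=
    hpd.clog fun z hz => Or.inr (hpim z hz).ne
  obtain ⟨μ, hμ, c, hc⟩ := herglotz_disk (hF.comp hld hlog) fun z hz => hre _ (hlog z hz)
  have hone : MeasurableSet ({1} : Set Circle) := measurableSet_singleton 1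
  -- The atom at `1` sits at `s = ∞` and becomes the constant `m`; the rest of the measure is
  -- transported to the line.
  refine ⟨(μ.restrict {1}ᶜ).map circleToReal, Measure.isFiniteMeasure_map _ _, μ.real {1}, c,
    measureReal_nonneg, fun ζ hζ => ?_⟩
  set w := Complex.exp ζ with hw
  have hwim : w.im < 0 := exp_im_neg hζ
  set z := (w + Complex.I) / (w - Complex.I) with hz
  have h2 : w - Complex.I ≠ 0 := fun h => by
    have := congrArg Complex.im h
    simp at this
    linarith
  have hzb : z ∈ Metric.ball (0 : ℂ) 1 := by
    rw [mem_ball_zero_iff, hz, norm_div, div_lt_one (norm_pos_iff.2 h2), ← sq_lt_sq₀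
      (norm_nonneg _) (norm_nonneg _), ← Complex.normSq_eq_norm_sq, ← Complex.normSq_eq_norm_sq,
      Complex.normSq_apply, Complex.normSq_apply]
    simp
    nlinarith
  have hzm : z - 1 = 2 * Complex.I / (w - Complex.I) := by
    rw [hz]; field_simp; ring
  have hzp : 1 + z = 2 * w / (w - Complex.I) := by
    rw [hz]; field_simp; ring
  have hpz : p z = w := by
    rw [hp]
    simp only [hzm, hzp]
    field_simp
  have hlz : Complex.log (p z) = ζ := by
    rw [hpz, hw, Complex.log_exp hζ.1 (hζ.2.le.trans Real.pi_pos.le)]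
  have h3 := hc z hzb
  simp only [Function.comp_apply, hlz] at h3
  have hi : Integrable (fun e : Circle => ((e : ℂ) + z) / (e - z)) μ :=
    (continuous_circleKernel hzb).integrable_of_hasCompactSupport
      (HasCompactSupport.of_compactSpace _)
  rw [h3, ← integral_add_compl hone hi, integral_singleton,
    integral_map measurable_circleToReal.aemeasurable
      (f := kernel ζ) (continuous_halfKernel hwim).aestronglyMeasurable, ← integral_const_mul]
  have h4 : ∫ e in ({1}ᶜ : Set Circle), ((e : ℂ) + z) / (e - z) ∂μ
      = ∫ e in ({1}ᶜ : Set Circle), -Complex.I * kernel ζ (circleToReal e) ∂μ := by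
    refine setIntegral_congr_fun hone.compl fun e he => ?_
    have he1 : e ≠ 1 := he
    exact herglotzKernel_eq hwim (fun h => he1 (Circle.ext (by simpa using h)))
      (circleToReal_eq he1) hz (circle_sub_ne_zero hzb e)
  have h5 : ((1 : Circle) + z) / ((1 : Circle) - z) = Complex.I * w := by
    have h6 : (1 : ℂ) - z = -(2 * Complex.I / (w - Complex.I)) := by rw [← hzm]; ring
    rw [Circle.coe_one, hzp, h6]
    field_simp
    simp
  rw [h4, h5, Complex.real_smul]
  ring

/-! ### Boundary values of bounded analytic functions -/

lemma integrable_poisson_weight {μ : Measure ℝ} [IsFiniteMeasure μ] {w : ℂ} (hw : w.im < 0) :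
    Integrable (fun s => poisson w s * (1 + s ^ 2)) μ := by
  simpa using integrable_poisson_weight_mul (integrable_const (1 : ℝ)) hw (μ := μ)

lemma ae_tendsto_poisson (μ : Measure ℝ) [IsFiniteMeasure μ] :
    ∀ᵐ x : ℝ, Tendsto (fun w => ∫ s, poisson w s * (1 + s ^ 2) ∂μ) (NT x)
      (𝓝 (Real.pi * (1 + x ^ 2) * (μ.rnDeriv volume x).toReal)) := by
  filter_upwards [ae_tendsto_poisson_singular (μ.mutuallySingular_singularPart volume),
    ae_tendsto_poisson_density (Measure.integrable_toReal_rnDeriv (μ := μ) (ν := volume))]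
    with x h1 h2
  have h3 := h1.add h2
  rw [zero_add] at h3
  refine h3.congr' ?_
  filter_upwards [NT_mem x] with w hw
  have h4 := integrable_poisson_weight (μ := μ) hw.1
  have e := μ.singularPart_add_rnDeriv volume
  have h5 : ∫ s, poisson w s * (1 + s ^ 2) ∂(volume.withDensity (μ.rnDeriv volume))
      = ∫ s, poisson w s * (1 + s ^ 2) * (μ.rnDeriv volume s).toReal := by
    rw [integral_withDensity_eq_integral_toReal_smul (Measure.measurable_rnDeriv _ _)
      (Measure.rnDeriv_lt_top _ _)]
    simp only [smul_eq_mul, mul_comm]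
  rw [← h5]
  conv_rhs => rw [← e]
  rw [integral_add_measure]
  · exact h4.mono_measure (Measure.singularPart_le _ _)
  · exact h4.mono_measure (Measure.withDensity_rnDeriv_le _ _)

lemma re_neg_I_mul_integral {μ : Measure ℝ} {ρ : ℝ → ℝ} (hρ : Integrable ρ μ) {w : ℂ}
    (hw : w.im < 0) : (-Complex.I * ∫ s, halfKernel w s * (ρ s : ℂ) ∂μ).re
      = ∫ s, poisson w s * (1 + s ^ 2) * ρ s ∂μ := by
  have h1 := Complex.imCLM.integral_comp_comm (integrable_halfKernel_mul hρ.ofReal hw)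
  simp only [Complex.imCLM_apply] at h1
  have h2 : (-Complex.I * ∫ s, halfKernel w s * (ρ s : ℂ) ∂μ).re
      = (∫ s, halfKernel w s * (ρ s : ℂ) ∂μ).im := by simp
  rw [h2]
  refine h1.symm.trans (integral_congr_ae (Eventually.of_forall fun s => ?_))
  simp [← halfKernel_im hw]

lemma re_neg_I_mul_integral_one {μ : Measure ℝ} [IsFiniteMeasure μ] {w : ℂ}
    (hw : w.im < 0) : (-Complex.I * ∫ s, halfKernel w s ∂μ).re
      = ∫ s, poisson w s * (1 + s ^ 2) ∂μ := by
  simpa using re_neg_I_mul_integral (integrable_const (1 : ℝ)) hw (μ := μ)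

/-- A finite measure on `ℝ` whose density gives the boundary values of the real part. -/
lemma exists_measure_re {F : ℂ → ℂ} (hF : DifferentiableOn ℂ F strip)
    (hre : ∀ z ∈ strip, 0 ≤ (F z).re) :
    ∃ (μ : Measure ℝ) (_ : IsFiniteMeasure μ) (m : ℝ), 0 ≤ m ∧ ∀ ζ ∈ strip,
      (F ζ).re = (∫ s, poisson (Complex.exp ζ) s * (1 + s ^ 2) ∂μ) - m * (Complex.exp ζ).im := by
  obtain ⟨μ, hμ, m, c, hm, h⟩ := herglotz_strip hF hre
  refine ⟨μ, hμ, m, hm, fun ζ hζ => ?_⟩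
  rw [h ζ hζ, Complex.add_re, Complex.add_re]
  simp only [kernel_eq]
  rw [re_neg_I_mul_integral_one (exp_im_neg hζ)]
  simp
  ring

lemma slice_exp_upper {p : ℝ → ℝ} {u : ℂ → ℝ}
    (h : ∀ᵐ x : ℝ, Tendsto u (NT x) (𝓝 (p x))) :
    ∀ᵐ θ : ℝ, Tendsto (fun y : ℝ => u (Complex.exp (θ + y * Complex.I))) (𝓝[<] 0)
      (𝓝 (p (Real.exp θ))) := by
  filter_upwards [ae_exp_of_ae h] with θ hθ
  exact hθ.comp (tendsto_exp_upper θ)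

lemma slice_exp_lower {p : ℝ → ℝ} {u : ℂ → ℝ}
    (h : ∀ᵐ x : ℝ, Tendsto u (NT x) (𝓝 (p x))) :
    ∀ᵐ θ : ℝ, Tendsto (fun y : ℝ => u (Complex.exp (θ + y * Complex.I))) (𝓝[>] (-Real.pi))
      (𝓝 (p (-Real.exp θ))) := by
  filter_upwards [ae_neg_exp_of_ae h] with θ hθ
  exact hθ.comp (tendsto_exp_lower θ)

/-- **Fatou's theorem** for analytic functions with nonnegative real part. -/
lemma ae_tendsto_re {F : ℂ → ℂ} (hF : DifferentiableOn ℂ F strip)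
    (hre : ∀ z ∈ strip, 0 ≤ (F z).re) :
    ∃ ρ : ℝ → ℝ≥0∞, Measurable ρ ∧ (∀ᵐ s, ρ s < ⊤) ∧
      ∫⁻ s, ρ s ≤ ENNReal.ofReal (F (-(Real.pi / 2) * Complex.I)).re ∧
      (∀ᵐ θ : ℝ, Tendsto (fun y => (slice F y θ).re) (𝓝[<] 0)
        (𝓝 (Real.pi * (1 + Real.exp θ ^ 2) * (ρ (Real.exp θ)).toReal))) ∧
      ∀ᵐ θ : ℝ, Tendsto (fun y => (slice F y θ).re) (𝓝[>] (-Real.pi))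
        (𝓝 (Real.pi * (1 + (-Real.exp θ) ^ 2) * (ρ (-Real.exp θ)).toReal)) := by
  obtain ⟨μ, hμ, m, hm, h⟩ := exists_measure_re hF hre
  have hlim : ∀ᵐ x : ℝ, Tendsto
      (fun w => (∫ s, poisson w s * (1 + s ^ 2) ∂μ) - m * w.im) (NT x)
      (𝓝 (Real.pi * (1 + x ^ 2) * (μ.rnDeriv volume x).toReal)) := by
    filter_upwards [ae_tendsto_poisson μ] with x hx
    have h1 := (Complex.continuous_im.tendsto (x : ℂ)).mono_left (NT_le x)
    simpa using hx.sub (h1.const_mul m)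
  refine ⟨μ.rnDeriv volume, Measure.measurable_rnDeriv _ _, Measure.rnDeriv_lt_top _ _, ?_, ?_, ?_⟩
  · have hp : -((Real.pi : ℂ) / 2) * Complex.I ∈ strip := by
      have := Real.pi_pos
      constructor <;> simp <;> linarith
    have he : Complex.exp (-((Real.pi : ℂ) / 2) * Complex.I) = -Complex.I := by
      rw [neg_mul, Complex.exp_neg, Complex.exp_pi_div_two_mul_I, Complex.inv_I]
    -- At the centre `e^ζ = -i` the weighted kernel is `1`, so `Re F` there is `μ(ℝ) + m`, which
    -- bounds the mass of the density.
    have h1 : ∀ s : ℝ, poisson (-Complex.I) s * (1 + s ^ 2) = 1 := fun s => by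
      have : (1 + s ^ 2) ≠ 0 := by positivity
      simp [poisson]
      rw [add_comm, inv_mul_cancel₀ this]
    rw [h _ hp, he]
    simp only [h1]
    calc ∫⁻ s, μ.rnDeriv volume s ≤ μ Set.univ := Measure.lintegral_rnDeriv_le
      _ = ENNReal.ofReal (μ.real Set.univ) := by simp
      _ ≤ _ := ENNReal.ofReal_le_ofReal (by simpa using hm)
  · filter_upwards [slice_exp_upper hlim] with θ hθ
    refine hθ.congr' ?_
    filter_upwards [upper_mem] with y hy
    exact (h _ (mem_strip_iff.2 hy)).symm
  · filter_upwards [slice_exp_lower hlim] with θ hθ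
    refine hθ.congr' ?_
    filter_upwards [lower_mem] with y hy
    exact (h _ (mem_strip_iff.2 hy)).symm

/-- Bounded analytic functions on the strip. -/
structure IsBddAnalytic (g : ℂ → ℂ) : Prop where
  analytic : DifferentiableOn ℂ g strip
  bounded : ∃ C : ℝ, ∀ z ∈ strip, ‖g z‖ ≤ C

/-- Adding a constant to `g` and to `-i g` makes the real parts nonnegative. Fatou's theorem for
these two functions gives the limits of the real and imaginary parts of `g`. -/
lemma IsBddAnalytic.re_bounds {g : ℂ → ℂ} (hg : IsBddAnalytic g) :
    ∃ C : ℝ, (∀ z ∈ strip, 0 ≤ ((C : ℂ) + g z).re) ∧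
      ∀ z ∈ strip, 0 ≤ ((C : ℂ) - Complex.I * g z).re := by
  obtain ⟨C, hC⟩ := hg.bounded
  refine ⟨C, fun z hz => ?_, fun z hz => ?_⟩
  · have h1 := Complex.abs_re_le_norm (g z)
    have := (abs_le.1 (h1.trans (hC z hz))).1
    simp
    linarith
  · have h1 := Complex.abs_im_le_norm (g z)
    have := (abs_le.1 (h1.trans (hC z hz))).1
    simp
    linarith

lemma exists_tendsto_of_re_im {l : Filter ℝ} {g : ℝ → ℂ} {C a b : ℝ}
    (h1 : Tendsto (fun y => ((C : ℂ) + g y).re) l (𝓝 a))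
    (h2 : Tendsto (fun y => ((C : ℂ) - Complex.I * g y).re) l (𝓝 b)) :
    ∃ c, Tendsto g l (𝓝 c) := by
  have h3 := (Complex.continuous_ofReal.tendsto _).comp (h1.sub_const C)
  have h4 := ((Complex.continuous_ofReal.tendsto _).comp (h2.sub_const C)).mul_const Complex.I
  refine ⟨_, (h3.add h4).congr fun y => ?_⟩
  simp [Complex.re_add_im]

theorem IsBddAnalytic.tendsto_upperValue {g : ℂ → ℂ} (hg : IsBddAnalytic g) :
    ∀ᵐ θ : ℝ, Tendsto (fun y => slice g y θ) (𝓝[<] 0) (𝓝 (upperValue g θ)) := by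
  obtain ⟨C, h1, h2⟩ := hg.re_bounds
  obtain ⟨ρ, -, -, -, h3, -⟩ := ae_tendsto_re (hg.analytic.const_add (C : ℂ)) h1
  obtain ⟨ρ', -, -, -, h4, -⟩ := ae_tendsto_re
    ((hg.analytic.const_mul Complex.I).const_sub (C : ℂ)) h2
  filter_upwards [h3, h4] with θ h3 h4
  exact tendsto_nhds_limUnder (exists_tendsto_of_re_im h3 h4)

theorem IsBddAnalytic.tendsto_lowerValue {g : ℂ → ℂ} (hg : IsBddAnalytic g) :
    ∀ᵐ θ : ℝ, Tendsto (fun y => slice g y θ) (𝓝[>] (-Real.pi)) (𝓝 (lowerValue g θ)) := by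
  obtain ⟨C, h1, h2⟩ := hg.re_bounds
  obtain ⟨ρ, -, -, -, -, h3⟩ := ae_tendsto_re (hg.analytic.const_add (C : ℂ)) h1
  obtain ⟨ρ', -, -, -, -, h4⟩ := ae_tendsto_re
    ((hg.analytic.const_mul Complex.I).const_sub (C : ℂ)) h2
  filter_upwards [h3, h4] with θ h3 h4
  exact tendsto_nhds_limUnder (exists_tendsto_of_re_im h3 h4)

lemma memLp_top_of_tendsto {l : Filter ℝ} [l.NeBot] [l.IsCountablyGenerated]
    (hl : ∀ᶠ y in l, y ∈ Set.Ioo (-Real.pi) 0) {g : ℂ → ℂ} {v : ℝ → ℂ} {C : ℝ}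
    (hg : DifferentiableOn ℂ g strip) (hC : ∀ z ∈ strip, ‖g z‖ ≤ C)
    (hv : ∀ᵐ θ : ℝ, Tendsto (fun y => slice g y θ) l (𝓝 (v θ))) :
    MemLp v ⊤ (volume : Measure ℝ) ∧ ∀ᵐ θ : ℝ, ‖v θ‖ ≤ C := by
  have hb : ∀ᵐ θ : ℝ, ‖v θ‖ ≤ C := by
    filter_upwards [hv] with θ hθ
    refine le_of_tendsto hθ.norm ?_
    filter_upwards [hl] with y hy
    exact hC _ (mem_strip_iff.2 hy)
  refine ⟨memLp_top_of_bound ?_ C hb, hb⟩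
  obtain ⟨u, hu⟩ := exists_seq_tendsto l
  obtain ⟨N, hN⟩ := eventually_atTop.1 (hu.eventually hl)
  refine aestronglyMeasurable_of_tendsto_ae atTop (f := fun n => slice g (u (n + N)))
    (fun n => (continuous_slice hg (hN _ (by omega))).aestronglyMeasurable) ?_
  filter_upwards [hv] with θ hθ
  exact hθ.comp (hu.comp (tendsto_add_atTop_nat N))

lemma IsBddAnalytic.memLp_upperValue {g : ℂ → ℂ} (hg : IsBddAnalytic g) :
    MemLp (upperValue g) ⊤ (volume : Measure ℝ) := by
  obtain ⟨C, hC⟩ := hg.bounded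
  exact (memLp_top_of_tendsto upper_mem hg.analytic hC hg.tendsto_upperValue).1

lemma IsBddAnalytic.memLp_lowerValue {g : ℂ → ℂ} (hg : IsBddAnalytic g) :
    MemLp (lowerValue g) ⊤ (volume : Measure ℝ) := by
  obtain ⟨C, hC⟩ := hg.bounded
  exact (memLp_top_of_tendsto lower_mem hg.analytic hC hg.tendsto_lowerValue).1

lemma upperValue_eq {g : ℂ → ℂ} {θ : ℝ} {c : ℂ}
    (h : Tendsto (fun y => slice g y θ) (𝓝[<] 0) (𝓝 c)) : upperValue g θ = c := h.limUnder_eq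

lemma lowerValue_eq {g : ℂ → ℂ} {θ : ℝ} {c : ℂ}
    (h : Tendsto (fun y => slice g y θ) (𝓝[>] (-Real.pi)) (𝓝 c)) : lowerValue g θ = c :=
  h.limUnder_eq

/-- The deviation of the boundary modulus from `1` is controlled by the value at the centre. -/
lemma exists_density_one_sub_norm {g : ℂ → ℂ} (hg : DifferentiableOn ℂ g strip)
    (hg1 : ∀ z ∈ strip, ‖g z‖ ≤ 1) :
    ∃ ρ : ℝ → ℝ≥0∞, Measurable ρ ∧
      ∫⁻ s, ρ s ≤ ENNReal.ofReal (1 - ‖g (-(Real.pi / 2) * Complex.I)‖) ∧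
      (∀ᵐ θ : ℝ, ENNReal.ofReal (1 - ‖upperValue g θ‖)
        ≤ ENNReal.ofReal (Real.pi * (1 + Real.exp θ ^ 2)) * ρ (Real.exp θ)) ∧
      ∀ᵐ θ : ℝ, ENNReal.ofReal (1 - ‖lowerValue g θ‖)
        ≤ ENNReal.ofReal (Real.pi * (1 + (-Real.exp θ) ^ 2)) * ρ (-Real.exp θ) := by
  have hgb : IsBddAnalytic g := ⟨hg, 1, hg1⟩
  set p : ℂ := -(Real.pi / 2) * Complex.I with hp
  -- The rotation `u` makes `u g` nonnegative at the centre. Then `Re (1 - u g)` equals `1 - |g|`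
  -- there and is at least `1 - |g|` everywhere.
  obtain ⟨u, hu, hup⟩ : ∃ u : ℂ, ‖u‖ = 1 ∧ u * g p = ‖g p‖ := by
    by_cases h0 : g p = 0
    · exact ⟨1, by simp, by simp [h0]⟩
    · have h1 : (‖g p‖ : ℂ) ≠ 0 := by simpa using h0
      refine ⟨‖g p‖ / g p, ?_, by field_simp⟩
      rw [norm_div, Complex.norm_real, norm_norm, div_self (norm_ne_zero_iff.2 h0)]
  have hre : ∀ z : ℂ, (1 - u * z).re ≥ 1 - ‖z‖ := fun z => by
    have := Complex.re_le_norm (u * z)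
    rw [norm_mul, hu, one_mul] at this
    simp only [Complex.sub_re, Complex.one_re]
    linarith
  obtain ⟨ρ, hρm, hρt, hρ, hlu, hll⟩ := ae_tendsto_re
    (F := fun z => 1 - u * g z) ((hg.const_mul u).const_sub 1)
    (fun z hz => by linarith [hre (g z), hg1 z hz])
  have key : ∀ (s : ℝ), ρ s < ⊤ → ∀ {l : Filter ℝ} [l.NeBot] {v : ℂ} {θ : ℝ},
      Tendsto (fun y => slice g y θ) l (𝓝 v) →
      Tendsto (fun y => (slice (fun z => 1 - u * g z) y θ).re) l
        (𝓝 (Real.pi * (1 + s ^ 2) * (ρ s).toReal)) →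
      ENNReal.ofReal (1 - ‖v‖) ≤ ENNReal.ofReal (Real.pi * (1 + s ^ 2)) * ρ s := by
    intro s hs l _ v θ h1 h2
    have h3 : Tendsto (fun y => (slice (fun z => 1 - u * g z) y θ).re) l
        (𝓝 (1 - u * v).re) :=
      (Complex.continuous_re.tendsto _).comp ((h1.const_mul u).const_sub 1)
    have h4 := tendsto_nhds_unique h2 h3
    rw [← ENNReal.ofReal_toReal hs.ne, ← ENNReal.ofReal_mul (by positivity), h4]
    exact ENNReal.ofReal_le_ofReal (hre v)
  refine ⟨ρ, hρm, ?_, ?_, ?_⟩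
  · refine hρ.trans (le_of_eq ?_)
    simp only [← hp, hup]
    simp
  · filter_upwards [hlu, hgb.tendsto_upperValue, ae_exp_of_ae hρt] with θ h1 h2 h3
    exact key _ h3 h2 h1
  · filter_upwards [hll, hgb.tendsto_lowerValue, ae_neg_exp_of_ae hρt] with θ h1 h2 h3
    exact key _ h3 h2 h1

/-! ### Multiplication by bounded analytic functions -/

lemma IsBddAnalytic.mul {g k : ℂ → ℂ} (hg : IsBddAnalytic g) (hk : IsBddAnalytic k) :
    IsBddAnalytic fun z => g z * k z := by
  obtain ⟨C, hC⟩ := hg.bounded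
  obtain ⟨D, hD⟩ := hk.bounded
  refine ⟨hg.analytic.mul hk.analytic, C * D, fun z hz => ?_⟩
  rw [norm_mul]
  exact mul_le_mul (hC z hz) (hD z hz) (norm_nonneg _) ((norm_nonneg _).trans (hC z hz))

lemma HasUpperL2Value.congr {G : ℂ → ℂ} {a b : ℝ → ℂ} (h : HasUpperL2Value G a)
    (hab : a =ᵐ[volume] b) : HasUpperL2Value G b := by
  unfold HasUpperL2Value at h ⊢
  simpa only [eLpNorm_congr_ae ((EventuallyEq.refl _ (slice G _)).sub hab)] using h

lemma HasLowerL2Value.congr {G : ℂ → ℂ} {a b : ℝ → ℂ} (h : HasLowerL2Value G a)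
    (hab : a =ᵐ[volume] b) : HasLowerL2Value G b := by
  unfold HasLowerL2Value at h ⊢
  simpa only [eLpNorm_congr_ae ((EventuallyEq.refl _ (slice G _)).sub hab)] using h

lemma IsBddAnalytic.mul_isHardy {r G : ℂ → ℂ} (hr : IsBddAnalytic r) (hG : IsHardy G) :
    IsHardy fun z => r z * G z := by
  obtain ⟨C, hC⟩ := hr.bounded
  obtain ⟨D, hD⟩ := hG.bounded
  refine ⟨hr.analytic.mul hG.analytic, C.toNNReal * D, fun y hy => ?_⟩
  have h1 := eLpNorm_le_nnreal_smul_eLpNorm_of_ae_le_mul (f := slice (fun z => r z * G z) y)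
    (g := slice G y) (c := C.toNNReal) (μ := volume) (Eventually.of_forall fun x => by
      rw [slice, nnnorm_mul]
      refine mul_le_mul_left ?_ _
      rw [← NNReal.coe_le_coe, coe_nnnorm]
      exact (hC _ (mem_strip_iff.2 hy)).trans (Real.le_coe_toNNReal C)) 2
  refine h1.trans ?_
  rw [ENNReal.coe_mul, ENNReal.smul_def, smul_eq_mul]
  gcongr
  exact hD y hy

/-- Split `r G - v a = r (G - a) + (r - v) a`. The first term is small since `r` is bounded, the
second by dominated convergence. -/
lemma l2Value_mul {l : Filter ℝ} [l.NeBot] [l.IsCountablyGenerated]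
    (hl : ∀ᶠ y in l, y ∈ Set.Ioo (-Real.pi) 0) {r G : ℂ → ℂ} {v a : ℝ → ℂ}
    (hr : IsBddAnalytic r) (hv : ∀ᵐ θ : ℝ, Tendsto (fun y => slice r y θ) l (𝓝 (v θ)))
    (hG : DifferentiableOn ℂ G strip) (ha : MemLp a 2 (volume : Measure ℝ))
    (h : Tendsto (fun y => eLpNorm (slice G y - a) 2 volume) l (𝓝 0)) :
    Tendsto (fun y => eLpNorm (slice (fun z => r z * G z) y - fun θ => v θ * a θ) 2 volume) l
      (𝓝 0) := by
  obtain ⟨C, hC⟩ := hr.bounded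
  obtain ⟨hvm, hvb⟩ := memLp_top_of_tendsto hl hr.analytic hC hv
  have h1 : Tendsto (fun y => eLpNorm (fun θ => (slice r y θ - v θ) * a θ) 2 volume) l (𝓝 0) := by
    refine tendsto_eLpNorm_zero (v := fun θ => (C + C) * ‖a θ‖) ?_ (ha.norm.const_mul _) ?_ ?_
    · filter_upwards [hl] with y hy
      exact ((continuous_slice hr.analytic hy).aestronglyMeasurable.sub hvm.1).mul ha.1
    · filter_upwards [hl] with y hy
      filter_upwards [hvb] with θ hθ
      rw [norm_mul]
      gcongr
      exact (norm_sub_le _ _).trans (add_le_add (hC _ (mem_strip_iff.2 hy)) hθ)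
    · filter_upwards [hv] with θ hθ
      simpa using (hθ.sub_const (v θ)).mul_const (a θ)
  have h2 : Tendsto (fun y => ENNReal.ofReal C * eLpNorm (slice G y - a) 2 volume) l (𝓝 0) := by
    simpa using ENNReal.Tendsto.const_mul h (Or.inr ENNReal.ofReal_ne_top)
  refine tendsto_of_tendsto_of_tendsto_of_le_of_le' tendsto_const_nhds
    (by simpa using h2.add h1) (Eventually.of_forall fun _ => zero_le) ?_
  filter_upwards [hl] with y hy
  have hs := (continuous_slice hr.analytic hy).aestronglyMeasurable (μ := volume)
  have hsG := (continuous_slice hG hy).aestronglyMeasurable (μ := volume)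
  have e : (slice (fun z => r z * G z) y - fun θ => v θ * a θ)
      = (fun θ => slice r y θ * (slice G y - a) θ) + fun θ => (slice r y θ - v θ) * a θ := by
    ext θ
    simp only [slice, Pi.sub_apply, Pi.add_apply]
    ring
  rw [e]
  refine (eLpNorm_add_le (hs.mul (hsG.sub ha.1)) ((hs.sub hvm.1).mul ha.1) one_le_two).trans ?_
  refine add_le_add ?_ le_rfl
  refine eLpNorm_le_mul_eLpNorm_of_ae_le_mul (Eventually.of_forall fun θ => ?_) 2
  rw [Pi.mul_apply, norm_mul]
  exact mul_le_mul_of_nonneg_right (hC _ (mem_strip_iff.2 hy)) (norm_nonneg _)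

lemma IsBddAnalytic.mul_mem_continuationGraph {r : ℂ → ℂ} (hr : IsBddAnalytic r) {a b : Hilb}
    (h : (a, b) ∈ continuationGraph) :
    (mulOp (upperValue r) a, mulOp (lowerValue r) b) ∈ continuationGraph := by
  obtain ⟨G, hG, h1, h2⟩ := h
  exact ⟨_, hr.mul_isHardy hG,
    HasUpperL2Value.congr (l2Value_mul upper_mem hr hr.tendsto_upperValue hG.analytic
      (Lp.memLp a) h1) (mulOp_apply hr.memLp_upperValue a).symm,
    HasLowerL2Value.congr (l2Value_mul lower_mem hr hr.tendsto_lowerValue hG.analytic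
      (Lp.memLp b) h2) (mulOp_apply hr.memLp_lowerValue b).symm⟩

lemma memLp_top_conj {g : ℝ → ℂ} (hg : MemLp g ⊤ (volume : Measure ℝ)) :
    MemLp (fun θ => starRingEnd ℂ (g θ)) ⊤ (volume : Measure ℝ) := hg.star

lemma adjoint_mulOp {g : ℝ → ℂ} (hg : MemLp g ⊤ (volume : Measure ℝ)) :
    ContinuousLinearMap.adjoint (mulOp g) = mulOp fun θ => starRingEnd ℂ (g θ) := by
  symm
  rw [ContinuousLinearMap.eq_adjoint_iff]
  intro x y
  rw [L2_inner, L2_inner]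
  refine integral_congr_ae ?_
  filter_upwards [mulOp_apply hg y, mulOp_apply (memLp_top_conj hg) x] with θ h1 h2
  rw [h1, h2]
  simp
  ring

lemma mulOp_mulOp {g k m : ℝ → ℂ} (hg : MemLp g ⊤ (volume : Measure ℝ))
    (hk : MemLp k ⊤ (volume : Measure ℝ)) (hm : MemLp m ⊤ (volume : Measure ℝ))
    (h : ∀ᵐ θ, g θ * k θ = m θ) (x : Hilb) : mulOp g (mulOp k x) = mulOp m x := by
  refine Lp.ext ?_
  filter_upwards [mulOp_apply hg (mulOp k x), mulOp_apply hk x, mulOp_apply hm x, h]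
    with θ h1 h2 h3 h4
  rw [h1, h2, h3, ← h4, mul_assoc]

lemma mulOp_eq_self {g : ℝ → ℂ} (h : ∀ᵐ θ, g θ = 1) (x : Hilb) : mulOp g x = x := by
  have hg : MemLp g ⊤ (volume : Measure ℝ) := by
    rw [memLp_congr_ae (show g =ᵐ[volume] fun _ => 1 from h)]
    exact memLp_top_const 1
  refine Lp.ext ?_
  filter_upwards [mulOp_apply hg x, h] with θ h1 h2
  rw [h1, h2, one_mul]

lemma memLp_top_inv {g : ℝ → ℂ} (hg : MemLp g ⊤ (volume : Measure ℝ)) {δ : ℝ} (hδ : 0 < δ)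
    (h : ∀ᵐ θ, δ ≤ ‖g θ‖) : MemLp (fun θ => (g θ)⁻¹) ⊤ (volume : Measure ℝ) := by
  refine memLp_top_of_bound hg.1.inv₀ δ⁻¹ ?_
  filter_upwards [h] with θ hθ
  rw [norm_inv]
  exact inv_anti₀ hδ hθ

/-! ### The extension determined by a bounded analytic function -/

/-- The operator `M_h* Δ^{1/2} M_h`. -/
def extension (h : ℂ → ℂ) : Hilb →ₗ.[ℂ] Hilb := sandwich DeltaHalf (mulOp (upperValue h))

lemma mem_extension_graph {h : ℂ → ℂ} (hh : IsBddAnalytic h) {ξ ξ' : Hilb} :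
    (ξ, ξ') ∈ (extension h).graph ↔
    ∃ b, (mulOp (upperValue h) ξ, b) ∈ continuationGraph ∧
      ξ' = mulOp (fun θ => starRingEnd ℂ (upperValue h θ)) b := by
  rw [extension, mem_sandwich_graph, deltaHalf_graph, adjoint_mulOp hh.memLp_upperValue]

/-- The lower boundary value needs no separate condition: `IsHardy.exists_boundary` provides it for
every Hardy function. -/
lemma mem_extension_domain {h : ℂ → ℂ} (hh : IsBddAnalytic h) {ξ : Hilb} :
    ξ ∈ (extension h).domain ↔
    ∃ G : ℂ → ℂ, IsHardy G ∧ HasUpperL2Value G (fun θ => upperValue h θ * ξ θ) := by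
  have e := mulOp_apply hh.memLp_upperValue ξ
  rw [LinearPMap.mem_domain_iff]
  constructor
  · rintro ⟨ξ', hξ⟩
    obtain ⟨b, ⟨G, hG, h1, -⟩, -⟩ := (mem_extension_graph hh).1 hξ
    exact ⟨G, hG, HasUpperL2Value.congr h1 e⟩
  · rintro ⟨G, hG, h1⟩
    obtain ⟨a, b, -, h3⟩ := hG.exists_boundary
    exact ⟨_, (mem_extension_graph hh).2 ⟨b, ⟨G, hG, HasUpperL2Value.congr h1 e.symm, h3⟩, rfl⟩⟩

/-- By the symmetry `M_h*` multiplies `b` by `h(θ - πi)`, and `h b = h² · (b / h)` there because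
`h(θ - πi)` does not vanish. -/
lemma extension_apply {h f : ℂ → ℂ} (hh : IsBddAnalytic h) {δ : ℝ} (hδ : 0 < δ)
    (hl : ∀ᵐ θ : ℝ, δ ≤ ‖lowerValue h θ‖)
    (hs : ∀ᵐ θ : ℝ, starRingEnd ℂ (upperValue h θ) = lowerValue h θ)
    (hf : ∀ᵐ θ : ℝ, lowerValue f θ = lowerValue h θ ^ 2) (ξ : (extension h).domain) :
    ∃ (G : ℂ → ℂ) (b : Hilb), IsHardy G ∧
      HasUpperL2Value G (fun θ => upperValue h θ * (ξ : Hilb) θ) ∧ HasLowerL2Value G b ∧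
      extension h ξ =ᵐ[volume] fun θ => lowerValue f θ * (b θ / lowerValue h θ) := by
  obtain ⟨b, ⟨G, hG, h1, h2⟩, h3⟩ := (mem_extension_graph hh).1 (LinearPMap.mem_graph _ ξ)
  refine ⟨G, b, hG, HasUpperL2Value.congr h1 (mulOp_apply hh.memLp_upperValue ξ), h2, ?_⟩
  rw [h3]
  filter_upwards [mulOp_apply (memLp_top_conj hh.memLp_upperValue) b, hl, hs, hf] with θ e1 e2 e3 e4
  have : lowerValue h θ ≠ 0 := norm_pos_iff.1 (hδ.trans_le e2)
  rw [e1, e3, e4]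
  field_simp

lemma extension_isSelfAdjoint {h : ℂ → ℂ} (hh : IsBddAnalytic h) {δ : ℝ} (hδ : 0 < δ)
    (hu : ∀ᵐ θ : ℝ, δ ≤ ‖upperValue h θ‖) :
    IsSelfAdjoint (extension h) := by
  have hm := hh.memLp_upperValue
  have hi := memLp_top_inv hm hδ hu
  have h0 : ∀ᵐ θ : ℝ, upperValue h θ ≠ 0 := by
    filter_upwards [hu] with θ hθ
    exact norm_pos_iff.1 (hδ.trans_le hθ)
  refine sandwich_isSelfAdjoint deltaHalf_isSelfAdjoint
    (W := mulOp fun θ => (upperValue h θ)⁻¹) (fun x => ?_) (fun x => ?_)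
  · rw [mulOp_mulOp hm hi (memLp_top_const 1) (by
      filter_upwards [h0] with θ hθ
      exact mul_inv_cancel₀ hθ)]
    exact mulOp_eq_self (Eventually.of_forall fun _ => rfl) x
  · rw [mulOp_mulOp hi hm (memLp_top_const 1) (by
      filter_upwards [h0] with θ hθ
      exact inv_mul_cancel₀ hθ)]
    exact mulOp_eq_self (Eventually.of_forall fun _ => rfl) x

/-- For `ξ` in `H²` the product `hξ` is again in `H²`, with lower value `h(θ - πi) ξ(θ - πi)`. By
the symmetry `conj h(θ) · h(θ - πi)` is the conjugate of `f(θ)`. -/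
lemma boundStateOp_le_extension {h f : ℂ → ℂ} (hh : IsBddAnalytic h)
    (hs : ∀ᵐ θ : ℝ, starRingEnd ℂ (upperValue h θ) = lowerValue h θ)
    (hf : ∀ᵐ θ : ℝ, upperValue f θ = upperValue h θ ^ 2) :
    boundStateOp f ≤ extension h := by
  have hu := hh.memLp_upperValue
  have hfu : MemLp (upperValue f) ⊤ (volume : Measure ℝ) := by
    have h1 := (hh.mul hh).memLp_upperValue
    rw [memLp_congr_ae (g := upperValue f)] at h1
    · exact h1
    · filter_upwards [hf, hh.tendsto_upperValue] with θ h2 h3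
      rw [h2, sq]
      exact upperValue_eq (h3.mul h3)
  rw [← LinearPMap.le_graph_iff]
  rintro ⟨ξ, ξ'⟩ hξ
  obtain ⟨x, hx1, hx2⟩ := (LinearPMap.mem_graph_iff _).1 hξ
  simp only at hx1 hx2
  subst hx1
  have h1 : ((x : Hilb), DeltaHalf x) ∈ continuationGraph := by
    rw [← deltaHalf_graph]
    exact LinearPMap.mem_graph DeltaHalf x
  refine (mem_extension_graph hh).2 ⟨_, hh.mul_mem_continuationGraph h1, hx2.symm.trans ?_⟩
  change mulOp (fun θ => starRingEnd ℂ (upperValue f θ)) (DeltaHalf x) = _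
  refine (mulOp_mulOp (memLp_top_conj hu) hh.memLp_lowerValue (memLp_top_conj hfu) ?_ _).symm
  filter_upwards [hs, hf] with θ h2 h3
  rw [h3, map_pow, h2, sq]

lemma upperValue_sq {h f : ℂ → ℂ} (hh : IsBddAnalytic h) (hf : ∀ z ∈ strip, f z = h z ^ 2) :
    ∀ᵐ θ : ℝ, upperValue f θ = upperValue h θ ^ 2 := by
  filter_upwards [hh.tendsto_upperValue] with θ hθ
  refine upperValue_eq ((hθ.pow 2).congr' ?_)
  filter_upwards [upper_mem] with y hy
  exact (hf _ (mem_strip_iff.2 hy)).symm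

lemma lowerValue_sq {h f : ℂ → ℂ} (hh : IsBddAnalytic h) (hf : ∀ z ∈ strip, f z = h z ^ 2) :
    ∀ᵐ θ : ℝ, lowerValue f θ = lowerValue h θ ^ 2 := by
  filter_upwards [hh.tendsto_lowerValue] with θ hθ
  refine lowerValue_eq ((hθ.pow 2).congr' ?_)
  filter_upwards [lower_mem] with y hy
  exact (hf _ (mem_strip_iff.2 hy)).symm

/-! ### Blaschke factors -/

/-- A single factor of a Blaschke product. -/
def blaschkeFactor (α ζ : ℂ) : ℂ :=
  blaschkeConst α * ((Complex.exp ζ - Complex.exp α) /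
    (Complex.exp ζ - Complex.exp (starRingEnd ℂ α)))

lemma exp_injOn_strip : Set.InjOn Complex.exp strip := fun a ha b hb h => by
  rw [← Complex.log_exp ha.1 (ha.2.le.trans Real.pi_pos.le),
    ← Complex.log_exp hb.1 (hb.2.le.trans Real.pi_pos.le), h]

lemma exp_sub_I_ne_zero {ζ : ℂ} (hζ : ζ ∈ strip) : Complex.exp ζ - Complex.I ≠ 0 := fun h => by
  have h1 := congrArg Complex.im h
  have h2 := exp_im_neg hζ
  simp only [Complex.sub_im, Complex.I_im, Complex.zero_im] at h1
  linarith

lemma exp_conj_im_pos {α : ℂ} (hα : α ∈ strip) : 0 < (Complex.exp (starRingEnd ℂ α)).im := by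
  rw [Complex.exp_conj, Complex.conj_im]
  linarith [exp_im_neg hα]

lemma sub_exp_conj_ne_zero {α w : ℂ} (hα : α ∈ strip) (hw : w.im ≤ 0) :
    w - Complex.exp (starRingEnd ℂ α) ≠ 0 := fun h => by
  have h1 := congrArg Complex.im h
  have h2 := exp_conj_im_pos hα
  simp only [Complex.sub_im, Complex.zero_im] at h1
  linarith

lemma diskPoint_sub_one {ζ : ℂ} (hζ : ζ ∈ strip) :
    diskPoint ζ - 1 = 2 * Complex.I / (Complex.exp ζ - Complex.I) := by
  have := exp_sub_I_ne_zero hζ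
  rw [diskPoint]
  field_simp
  ring

lemma diskPoint_sub_one_ne_zero {ζ : ℂ} (hζ : ζ ∈ strip) : diskPoint ζ - 1 ≠ 0 := by
  rw [diskPoint_sub_one hζ]
  exact div_ne_zero (by simp) (exp_sub_I_ne_zero hζ)

lemma exp_mul_diskPoint_sub_one {ζ : ℂ} (hζ : ζ ∈ strip) :
    Complex.exp ζ * (diskPoint ζ - 1) = Complex.I * (1 + diskPoint ζ) := by
  have h0 := exp_sub_I_ne_zero hζ
  rw [diskPoint_sub_one hζ, diskPoint]
  field_simp
  ring

lemma one_sub_normSq_diskPoint {ζ : ℂ} (hζ : ζ ∈ strip) :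
    1 - ‖diskPoint ζ‖ ^ 2
      = -4 * (Complex.exp ζ).im / ‖Complex.exp ζ - Complex.I‖ ^ 2 := by
  have h0 : ‖Complex.exp ζ - Complex.I‖ ^ 2 ≠ 0 :=
    pow_ne_zero 2 (norm_ne_zero_iff.2 (exp_sub_I_ne_zero hζ))
  rw [diskPoint, norm_div, div_pow, eq_div_iff h0, sub_mul, div_mul_cancel₀ _ h0]
  simp only [← Complex.normSq_eq_norm_sq, Complex.normSq_apply, Complex.add_re, Complex.add_im,
    Complex.sub_re, Complex.sub_im, Complex.I_re, Complex.I_im]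
  ring

lemma norm_diskPoint_lt_one {ζ : ℂ} (hζ : ζ ∈ strip) : ‖diskPoint ζ‖ < 1 := by
  have h1 := one_sub_normSq_diskPoint hζ
  have h0 : 0 < ‖Complex.exp ζ - Complex.I‖ := norm_pos_iff.2 (exp_sub_I_ne_zero hζ)
  have h2 : 0 < -4 * (Complex.exp ζ).im / ‖Complex.exp ζ - Complex.I‖ ^ 2 :=
    div_pos (by linarith [exp_im_neg hζ]) (by positivity)
  nlinarith [norm_nonneg (diskPoint ζ)]

lemma norm_blaschkeConst {α : ℂ} (hα : α ∈ strip) : ‖blaschkeConst α‖ = 1 := by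
  unfold blaschkeConst
  split_ifs with h
  · simp
  · have h1 := norm_ne_zero_iff.2 h
    have h2 := norm_ne_zero_iff.2 (diskPoint_sub_one_ne_zero hα)
    have h3 : ‖starRingEnd ℂ (diskPoint α) - 1‖ = ‖diskPoint α - 1‖ := by
      rw [← Complex.norm_conj, map_sub, map_one, Complex.conj_conj]
    rw [norm_mul, norm_neg, norm_div, norm_div, h3, Complex.norm_real, norm_norm, div_self h1,
      div_self h2, one_mul]

lemma norm_sub_exp_sq (α w : ℂ) :
    ‖w - Complex.exp (starRingEnd ℂ α)‖ ^ 2 - ‖w - Complex.exp α‖ ^ 2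
      = 4 * w.im * (Complex.exp α).im := by
  simp only [Complex.exp_conj, ← Complex.normSq_eq_norm_sq, Complex.normSq_apply, Complex.sub_re,
    Complex.sub_im, Complex.conj_re, Complex.conj_im]
  ring

/-- An exact formula for the defect: its sign gives modulus at most `1` in the strip, and its
vanishing for real `e^ζ` gives modulus `1` on the edges. -/
lemma one_sub_norm_blaschkeFactor_sq {α ζ : ℂ} (hα : α ∈ strip) (hζ : (Complex.exp ζ).im ≤ 0) :
    1 - ‖blaschkeFactor α ζ‖ ^ 2 = 4 * (Complex.exp ζ).im * (Complex.exp α).im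
      / ‖Complex.exp ζ - Complex.exp (starRingEnd ℂ α)‖ ^ 2 := by
  have h0 := pow_ne_zero 2 (norm_ne_zero_iff.2 (sub_exp_conj_ne_zero hα hζ))
  rw [blaschkeFactor, norm_mul, norm_blaschkeConst hα, one_mul, norm_div, div_pow, eq_div_iff h0,
    sub_mul, div_mul_cancel₀ _ h0, one_mul, norm_sub_exp_sq]

lemma norm_blaschkeFactor_le_one {α ζ : ℂ} (hα : α ∈ strip) (hζ : ζ ∈ strip) :
    ‖blaschkeFactor α ζ‖ ≤ 1 := by
  have h1 := one_sub_norm_blaschkeFactor_sq hα (exp_im_neg hζ).le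
  have h2 : 0 ≤ 4 * (Complex.exp ζ).im * (Complex.exp α).im
      / ‖Complex.exp ζ - Complex.exp (starRingEnd ℂ α)‖ ^ 2 :=
    div_nonneg (by nlinarith [exp_im_neg hζ, exp_im_neg hα]) (by positivity)
  nlinarith [norm_nonneg (blaschkeFactor α ζ)]

lemma norm_blaschkeFactor_eq_one {α ζ : ℂ} (hα : α ∈ strip) (hζ : (Complex.exp ζ).im = 0) :
    ‖blaschkeFactor α ζ‖ = 1 := by
  have h1 := one_sub_norm_blaschkeFactor_sq hα hζ.le
  rw [hζ, mul_zero, zero_mul, zero_div] at h1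
  exact (pow_eq_one_iff_of_nonneg (norm_nonneg _) two_ne_zero).1
    (by linarith)

/-- The modulus of a Blaschke factor at a fixed point controls the Blaschke condition. -/
lemma exists_one_sub_norm_le {ζ : ℂ} (hζ : ζ ∈ strip) :
    ∃ C : ℝ, ∀ α ∈ strip, 1 - ‖diskPoint α‖ ≤ C * (1 - ‖blaschkeFactor α ζ‖) := by
  set w := Complex.exp ζ with hw
  have hwim : w.im < 0 := exp_im_neg hζ
  -- Since `|a - i| ≥ 1`, this `M` satisfies `|w - ā| ≤ M |a - i|`, which compares the two defects.
  -- The further factor `2` comes from `1 - x² ≤ 2 (1 - x)`.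
  set M : ℝ := 1 + ‖w + Complex.I‖ with hM
  have hM1 : 0 < M := by positivity
  refine ⟨2 * M ^ 2 / (-w.im), fun α hα => ?_⟩
  set a := Complex.exp α with ha
  have haim : a.im < 0 := exp_im_neg hα
  have h1 := one_sub_norm_blaschkeFactor_sq hα (exp_im_neg hζ).le
  have h2 := one_sub_normSq_diskPoint hα
  rw [← hw, ← ha] at h1
  rw [← ha] at h2
  have h3 : 1 ≤ ‖a - Complex.I‖ := by
    have := Complex.abs_im_le_norm (a - Complex.I)
    rw [Complex.sub_im, Complex.I_im, abs_of_neg (by linarith)] at this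
    linarith
  have h4 : ‖w - Complex.exp (starRingEnd ℂ α)‖ ≤ M * ‖a - Complex.I‖ := by
    have e : w - Complex.exp (starRingEnd ℂ α)
        = (w + Complex.I) - starRingEnd ℂ (a - Complex.I) := by
      rw [Complex.exp_conj, map_sub, Complex.conj_I]; ring
    rw [e]
    refine (norm_sub_le _ _).trans ?_
    rw [Complex.norm_conj]
    nlinarith [norm_nonneg (w + Complex.I)]
  have h5 := norm_pos_iff.2 (sub_exp_conj_ne_zero hα hwim.le)
  have h6 : ‖w - Complex.exp (starRingEnd ℂ α)‖ ^ 2 ≤ M ^ 2 * ‖a - Complex.I‖ ^ 2 := by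
    rw [← mul_pow]
    exact pow_le_pow_left₀ h5.le h4 2
  have h7 : (-w.im) * (1 - ‖diskPoint α‖ ^ 2) ≤ M ^ 2 * (1 - ‖blaschkeFactor α ζ‖ ^ 2) := by
    rw [h1, h2, mul_div_assoc', mul_div_assoc', div_le_div_iff₀ (by positivity) (by positivity)]
    have h8 : 0 ≤ 4 * (w.im * a.im) := by nlinarith
    calc -w.im * (-4 * a.im) * ‖w - Complex.exp (starRingEnd ℂ α)‖ ^ 2
        = 4 * (w.im * a.im) * ‖w - Complex.exp (starRingEnd ℂ α)‖ ^ 2 := by ring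
      _ ≤ 4 * (w.im * a.im) * (M ^ 2 * ‖a - Complex.I‖ ^ 2) := by gcongr
      _ = _ := by ring
  have h8 := norm_blaschkeFactor_le_one hα hζ
  have h9 := norm_diskPoint_lt_one hα
  rw [div_mul_eq_mul_div, le_div_iff₀ (by linarith)]
  have h10 : 1 - ‖diskPoint α‖ ≤ 1 - ‖diskPoint α‖ ^ 2 := by nlinarith [norm_nonneg (diskPoint α)]
  have h11 : 1 - ‖blaschkeFactor α ζ‖ ^ 2 ≤ 2 * (1 - ‖blaschkeFactor α ζ‖) := by
    nlinarith [norm_nonneg (blaschkeFactor α ζ)]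
  calc (1 - ‖diskPoint α‖) * -w.im ≤ (1 - ‖diskPoint α‖ ^ 2) * -w.im := by gcongr; linarith
    _ ≤ M ^ 2 * (1 - ‖blaschkeFactor α ζ‖ ^ 2) := by linarith
    _ ≤ M ^ 2 * (2 * (1 - ‖blaschkeFactor α ζ‖)) := by gcongr
    _ = _ := by ring

lemma one_sub_conj_mul_ne_zero {b z : ℂ} (hb : ‖b‖ < 1) (hz : ‖z‖ < 1) :
    1 - starRingEnd ℂ b * z ≠ 0 := fun h => by
  have h1 : ‖starRingEnd ℂ b * z‖ < 1 := by
    rw [norm_mul, Complex.norm_conj]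
    nlinarith [norm_nonneg b, norm_nonneg z]
  rw [← sub_eq_zero.1 h, norm_one] at h1
  exact lt_irrefl _ h1

/-- In disk coordinates this is the Blaschke quotient `(b - z) / (1 - b̄ z)` times a unimodular
constant. Apart from `b = 0`, `blaschkeConst` turns it into the standard factor, positive at `z =
0`. -/
lemma exp_sub_div_eq {α ζ : ℂ} (hα : α ∈ strip) (hζ : ζ ∈ strip) :
    (Complex.exp ζ - Complex.exp α) / (Complex.exp ζ - Complex.exp (starRingEnd ℂ α))
      = -((diskPoint α - diskPoint ζ) * (starRingEnd ℂ (diskPoint α) - 1))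
        / ((1 - starRingEnd ℂ (diskPoint α) * diskPoint ζ) * (diskPoint α - 1)) := by
  have e1 := exp_mul_diskPoint_sub_one hα
  have e2 := exp_mul_diskPoint_sub_one hζ
  have e3 := congrArg (starRingEnd ℂ) e1
  simp only [map_mul, map_sub, map_add, map_one, Complex.conj_I, ← Complex.exp_conj] at e3
  have n1 := diskPoint_sub_one_ne_zero hα
  have n2 := diskPoint_sub_one_ne_zero hζ
  have n3 : starRingEnd ℂ (diskPoint α) - 1 ≠ 0 := fun h => n1 (by
    rw [← Complex.conj_conj (diskPoint α - 1), map_sub, map_one, h, map_zero])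
  have n4 := one_sub_conj_mul_ne_zero (norm_diskPoint_lt_one hα) (norm_diskPoint_lt_one hζ)
  have n5 := sub_exp_conj_ne_zero hα (exp_im_neg hζ).le
  set b := diskPoint α
  set b' := starRingEnd ℂ b
  set z := diskPoint ζ
  set w := Complex.exp ζ
  set a := Complex.exp α
  set a' := Complex.exp (starRingEnd ℂ α)
  have f1 : a = Complex.I * (1 + b) / (b - 1) := by rw [eq_div_iff n1, e1]
  have f2 : w = Complex.I * (1 + z) / (z - 1) := by rw [eq_div_iff n2, e2]
  have f3 : a' = -Complex.I * (1 + b') / (b' - 1) := by rw [eq_div_iff n3, e3]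
  rw [div_eq_div_iff n5 (mul_ne_zero n4 n1), f1, f2, f3]
  field_simp
  ring

/-- For `b ≠ 0` the normalized factor minus `1` contains `1 - |b|` explicitly, with cofactor at most
`2 / (1 - |z|)`. For `b = 0` the factor is `z` and the bound is trivial. The Blaschke condition thus
gives absolute convergence. -/
lemma norm_one_sub_blaschkeFactor_le {α ζ : ℂ} (hα : α ∈ strip) (hζ : ζ ∈ strip) :
    ‖blaschkeFactor α ζ - 1‖ ≤ 2 / (1 - ‖diskPoint ζ‖) * (1 - ‖diskPoint α‖) := by
  have hb := norm_diskPoint_lt_one hα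
  have hz := norm_diskPoint_lt_one hζ
  have n1 := diskPoint_sub_one_ne_zero hα
  have n4 := one_sub_conj_mul_ne_zero hb hz
  have n3 : starRingEnd ℂ (diskPoint α) - 1 ≠ 0 := fun h => n1 (by
    rw [← Complex.conj_conj (diskPoint α - 1), map_sub, map_one, h, map_zero])
  rw [blaschkeFactor, exp_sub_div_eq hα hζ, blaschkeConst]
  split_ifs with h0
  · rw [h0]
    simp only [zero_sub, map_zero, zero_mul, sub_zero, norm_zero, mul_one, one_mul]
    have e : -(-diskPoint ζ * -1) / (-1 : ℂ) - 1 = diskPoint ζ - 1 := by ring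
    rw [e]
    have h2 : ‖diskPoint ζ - 1‖ ≤ 2 := by
      refine (norm_sub_le _ _).trans ?_
      rw [norm_one]; linarith
    refine h2.trans ?_
    rw [le_div_iff₀ (by linarith)]
    nlinarith [norm_nonneg (diskPoint ζ)]
  · have hm : (‖diskPoint α‖ : ℂ) * ‖diskPoint α‖ = diskPoint α * starRingEnd ℂ (diskPoint α) := by
      rw [Complex.mul_conj, Complex.normSq_eq_norm_sq]
      push_cast
      ring
    set b := diskPoint α with hbdef
    set z := diskPoint ζ
    have e : -((‖b‖ : ℂ) / b) * ((b - 1) / (starRingEnd ℂ b - 1)) *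
        (-((b - z) * (starRingEnd ℂ b - 1)) / ((1 - starRingEnd ℂ b * z) * (b - 1))) - 1
        = -((1 - ‖b‖ : ℝ) * (b + ‖b‖ * z)) / (b * (1 - starRingEnd ℂ b * z)) := by
      push_cast
      field_simp
      linear_combination -z * hm
    rw [e, norm_div, norm_neg, norm_mul, norm_mul, Complex.norm_real,
      Real.norm_of_nonneg (by linarith)]
    have hb0 : 0 < ‖b‖ := norm_pos_iff.2 h0
    have h2 : ‖b + ‖b‖ * z‖ ≤ ‖b‖ * 2 := by
      refine (norm_add_le _ _).trans ?_
      rw [norm_mul, Complex.norm_real, norm_norm]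
      nlinarith
    have h3 : 1 - ‖z‖ ≤ ‖1 - starRingEnd ℂ b * z‖ := by
      have := norm_sub_norm_le 1 (starRingEnd ℂ b * z)
      rw [norm_one, norm_mul, Complex.norm_conj] at this
      nlinarith [norm_nonneg z]
    calc (1 - ‖b‖) * ‖b + ‖b‖ * z‖ / (‖b‖ * ‖1 - starRingEnd ℂ b * z‖)
        ≤ (1 - ‖b‖) * (‖b‖ * 2) / (‖b‖ * (1 - ‖z‖)) := by
          have : 0 < 1 - ‖z‖ := by linarith
          have : 0 ≤ 1 - ‖b‖ := by linarith
          gcongr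
      _ = _ := by
          have : 1 - ‖z‖ ≠ 0 := by linarith
          field_simp

lemma blaschkeConst_ne_zero {α : ℂ} (hα : α ∈ strip) : blaschkeConst α ≠ 0 := fun h => by
  have := norm_blaschkeConst hα
  rw [h, norm_zero] at this
  exact zero_ne_one this

lemma differentiableOn_blaschkeFactor {α : ℂ} (hα : α ∈ strip) :
    DifferentiableOn ℂ (blaschkeFactor α) strip := by
  unfold blaschkeFactor
  exact (DifferentiableOn.div (by fun_prop) (by fun_prop)
    fun ζ hζ => sub_exp_conj_ne_zero hα (exp_im_neg hζ).le).const_mul _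

lemma blaschkeFactor_eq_zero {α ζ : ℂ} (hα : α ∈ strip) (hζ : ζ ∈ strip) :
    blaschkeFactor α ζ = 0 ↔ ζ = α := by
  constructor
  · intro h
    rcases mul_eq_zero.1 h with h | h
    · exact absurd h (blaschkeConst_ne_zero hα)
    · rcases div_eq_zero_iff.1 h with h | h
      · exact exp_injOn_strip hζ hα (sub_eq_zero.1 h)
      · exact absurd h (sub_exp_conj_ne_zero hα (exp_im_neg hζ).le)
  · rintro rfl
    simp [blaschkeFactor]

lemma continuousAt_blaschkeFactor {α ζ : ℂ} (hα : α ∈ strip) (hζ : (Complex.exp ζ).im = 0) :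
    ContinuousAt (blaschkeFactor α) ζ := by
  unfold blaschkeFactor
  exact continuousAt_const.mul (ContinuousAt.div (by fun_prop) (by fun_prop)
    (sub_exp_conj_ne_zero hα hζ.le))

/-! ### Blaschke products -/

lemma tendsto_slice_of_continuousAt_upper {g : ℂ → ℂ} {θ : ℝ} (h : ContinuousAt g θ) :
    Tendsto (fun y => slice g y θ) (𝓝[<] 0) (𝓝 (g θ)) := by
  refine h.tendsto.comp ?_
  have h1 : Continuous fun y : ℝ => (θ : ℂ) + y * Complex.I := by fun_prop
  simpa using (h1.tendsto 0).mono_left nhdsWithin_le_nhds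

lemma tendsto_slice_of_continuousAt_lower {g : ℂ → ℂ} {θ : ℝ}
    (h : ContinuousAt g (θ + (-Real.pi : ℝ) * Complex.I)) :
    Tendsto (fun y => slice g y θ) (𝓝[>] (-Real.pi)) (𝓝 (g (θ + (-Real.pi : ℝ) * Complex.I))) := by
  refine h.tendsto.comp ?_
  have h1 : Continuous fun y : ℝ => (θ : ℂ) + y * Complex.I := by fun_prop
  exact (h1.tendsto (-Real.pi)).mono_left nhdsWithin_le_nhds

lemma exp_ofReal_im_zero (θ : ℝ) : (Complex.exp θ).im = 0 := by
  rw [← Complex.ofReal_exp, Complex.ofReal_im]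

lemma exp_lower_im_zero (θ : ℝ) : (Complex.exp (θ + (-Real.pi : ℝ) * Complex.I)).im = 0 := by
  rw [exp_slice_im]
  simp

section

variable {ι : Type} {α : ι → ℂ}

lemma summable_norm_blaschkeFactor_sub_one (hα : ∀ j, α j ∈ strip)
    (hs : Summable fun j => 1 - ‖diskPoint (α j)‖) {ζ : ℂ} (hζ : ζ ∈ strip) :
    Summable fun j => ‖blaschkeFactor (α j) ζ - 1‖ :=
  Summable.of_nonneg_of_le (fun _ => norm_nonneg _)
    (fun j => norm_one_sub_blaschkeFactor_le (hα j) hζ) (hs.mul_left _)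

lemma multipliable_blaschkeFactor (hα : ∀ j, α j ∈ strip)
    (hs : Summable fun j => 1 - ‖diskPoint (α j)‖) {ζ : ℂ} (hζ : ζ ∈ strip) :
    Multipliable fun j => blaschkeFactor (α j) ζ := by
  simpa using multipliable_one_add_of_summable (summable_norm_blaschkeFactor_sub_one hα hs hζ)

lemma hasProd_blaschkeProduct (hα : ∀ j, α j ∈ strip)
    (hs : Summable fun j => 1 - ‖diskPoint (α j)‖) {ζ : ℂ} (hζ : ζ ∈ strip) :
    HasProd (fun j => blaschkeFactor (α j) ζ) (blaschkeProduct α ζ) :=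
  (multipliable_blaschkeFactor hα hs hζ).hasProd

lemma continuousOn_diskPoint : ContinuousOn diskPoint strip := by
  unfold diskPoint
  exact ContinuousOn.div (by fun_prop) (by fun_prop) fun ζ hζ => exp_sub_I_ne_zero hζ

/-- On `|diskPoint ζ| < r` the terms are bounded by `2 / (1 - r)` times the Blaschke summands, so
the product converges locally uniformly. -/
lemma differentiableOn_blaschkeProduct (hα : ∀ j, α j ∈ strip)
    (hs : Summable fun j => 1 - ‖diskPoint (α j)‖) :
    DifferentiableOn ℂ (blaschkeProduct α) strip := by
  intro ζ₀ hζ₀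
  obtain ⟨r, hr1, hr2⟩ := exists_between (norm_diskPoint_lt_one hζ₀)
  set U : Set ℂ := strip ∩ {ζ | ‖diskPoint ζ‖ < r} with hU
  have hUo : IsOpen U := continuousOn_diskPoint.norm.isOpen_inter_preimage isOpen_strip isOpen_Iio
  have h1 := Summable.hasProdLocallyUniformlyOn_one_add
    (f := fun j ζ => blaschkeFactor (α j) ζ - 1) hUo (hs.mul_left (2 / (1 - r)))
    (Eventually.of_forall fun j ζ hζ => by
      refine (norm_one_sub_blaschkeFactor_le (hα j) hζ.1).trans ?_
      have h2 := hζ.2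
      rw [Set.mem_ofPred_eq] at h2
      have h3 := norm_diskPoint_lt_one (hα j)
      have : 0 < 1 - r := by linarith
      have : 0 ≤ 1 - ‖diskPoint (α j)‖ := by linarith
      gcongr)
    (fun j => ((differentiableOn_blaschkeFactor (hα j)).sub_const 1).continuousOn.mono
      Set.inter_subset_left)
  simp only [add_sub_cancel] at h1
  rw [hasProdLocallyUniformlyOn_iff_tendstoLocallyUniformlyOn] at h1
  have h2 : DifferentiableOn ℂ (fun ζ => ∏' j, blaschkeFactor (α j) ζ) U :=
    h1.differentiableOn (Eventually.of_forall fun s =>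
      DifferentiableOn.fun_finsetProd fun j _ =>
        (differentiableOn_blaschkeFactor (hα j)).mono Set.inter_subset_left) hUo
  exact ((h2 ζ₀ ⟨hζ₀, hr1⟩).differentiableAt (hUo.mem_nhds ⟨hζ₀, hr1⟩)).differentiableWithinAt

lemma norm_blaschkeProduct_le_one (hα : ∀ j, α j ∈ strip)
    (hs : Summable fun j => 1 - ‖diskPoint (α j)‖) {ζ : ℂ} (hζ : ζ ∈ strip) :
    ‖blaschkeProduct α ζ‖ ≤ 1 := by
  refine le_of_tendsto (hasProd_blaschkeProduct hα hs hζ).norm (Eventually.of_forall fun s => ?_)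
  exact Finset.prod_le_one (fun _ _ => norm_nonneg _)
    fun j _ => norm_blaschkeFactor_le_one (hα j) hζ

lemma isBddAnalytic_blaschkeProduct (hα : ∀ j, α j ∈ strip)
    (hs : Summable fun j => 1 - ‖diskPoint (α j)‖) : IsBddAnalytic (blaschkeProduct α) :=
  ⟨differentiableOn_blaschkeProduct hα hs, 1, fun _ hζ => norm_blaschkeProduct_le_one hα hs hζ⟩

lemma blaschkeProduct_eq_mul (hα : ∀ j, α j ∈ strip)
    (hs : Summable fun j => 1 - ‖diskPoint (α j)‖) (s : Finset ι) {ζ : ℂ} (hζ : ζ ∈ strip) :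
    blaschkeProduct α ζ = (∏ j ∈ s, blaschkeFactor (α j) ζ)
      * blaschkeProduct (fun j : ↥((s : Set ι)ᶜ) => α j) ζ :=
  HasProd.unique (hasProd_blaschkeProduct hα hs hζ)
    ((s.hasProd fun j => blaschkeFactor (α j) ζ).mul_compl
      (hasProd_blaschkeProduct (fun j : ↥((s : Set ι)ᶜ) => hα j) (hs.subtype _) hζ))

/-- At the centre the disk coordinate is `0`, so each factor differs from `1` by at most `2 (1 -
|β_j|)`. Tails of the product are therefore close to `1` there. -/
lemma norm_blaschkeProduct_center (hα : ∀ j, α j ∈ strip)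
    (hs : Summable fun j => 1 - ‖diskPoint (α j)‖) :
    2 - Real.exp (2 * ∑' j, (1 - ‖diskPoint (α j)‖))
      ≤ ‖blaschkeProduct α (-(Real.pi / 2) * Complex.I)‖ := by
  have hp : -((Real.pi : ℂ) / 2) * Complex.I ∈ strip := by
    have := Real.pi_pos
    constructor <;> simp <;> linarith
  have he : diskPoint (-((Real.pi : ℂ) / 2) * Complex.I) = 0 := by
    rw [diskPoint, neg_mul, Complex.exp_neg, Complex.exp_pi_div_two_mul_I, Complex.inv_I]
    simp
  have h1 : ‖blaschkeProduct α (-(Real.pi / 2) * Complex.I) - 1‖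
      ≤ Real.exp (2 * ∑' j, (1 - ‖diskPoint (α j)‖)) - 1 := by
    refine le_of_tendsto ((hasProd_blaschkeProduct hα hs hp).sub_const 1).norm
      (Eventually.of_forall fun s => ?_)
    have h2 := Finset.norm_prod_one_add_sub_one_le s
      fun j => blaschkeFactor (α j) (-(Real.pi / 2) * Complex.I) - 1
    simp only [add_sub_cancel] at h2
    refine h2.trans ?_
    gcongr
    rw [← tsum_mul_left]
    refine (Finset.sum_le_sum fun j _ => ?_).trans ((hs.mul_left 2).sum_le_tsum s fun j _ => ?_)
    · have h3 := norm_one_sub_blaschkeFactor_le (hα j) hp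
      rwa [he, norm_zero, sub_zero, div_one] at h3
    · linarith [norm_diskPoint_lt_one (hα j)]
  have h3 := norm_sub_norm_le 1 (1 - blaschkeProduct α (-(Real.pi / 2) * Complex.I))
  rw [norm_one, sub_sub_cancel, norm_sub_rev] at h3
  linarith

/-- The finitely many removed factors extend continuously to the edge and are unimodular on it, so
the boundary modulus depends only on the tail. -/
lemma norm_upperValue_prod (hα : ∀ j, α j ∈ strip)
    (hs : Summable fun j => 1 - ‖diskPoint (α j)‖) (s : Finset ι) :
    ∀ᵐ θ : ℝ, ‖upperValue (blaschkeProduct α) θ‖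
      = ‖upperValue (blaschkeProduct fun j : ↥((s : Set ι)ᶜ) => α j) θ‖ := by
  filter_upwards [(isBddAnalytic_blaschkeProduct hα hs).tendsto_upperValue,
    (isBddAnalytic_blaschkeProduct (fun j : ↥((s : Set ι)ᶜ) => hα j)
      (hs.subtype _)).tendsto_upperValue] with θ h1 h2
  have h3 : Tendsto (fun y => ∏ j ∈ s, slice (blaschkeFactor (α j)) y θ) (𝓝[<] 0)
      (𝓝 (∏ j ∈ s, blaschkeFactor (α j) θ)) := tendsto_finsetProd _ fun j _ =>
    tendsto_slice_of_continuousAt_upper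
      (continuousAt_blaschkeFactor (hα j) (exp_ofReal_im_zero θ))
  have h4 := tendsto_nhds_unique (h1.congr' (by
    filter_upwards [upper_mem] with y hy
    exact blaschkeProduct_eq_mul hα hs s (mem_strip_iff.2 hy))) (h3.mul h2)
  rw [h4, norm_mul, norm_prod, Finset.prod_eq_one fun j _ =>
    norm_blaschkeFactor_eq_one (hα j) (exp_ofReal_im_zero θ), one_mul]

lemma norm_lowerValue_prod (hα : ∀ j, α j ∈ strip)
    (hs : Summable fun j => 1 - ‖diskPoint (α j)‖) (s : Finset ι) :
    ∀ᵐ θ : ℝ, ‖lowerValue (blaschkeProduct α) θ‖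
      = ‖lowerValue (blaschkeProduct fun j : ↥((s : Set ι)ᶜ) => α j) θ‖ := by
  filter_upwards [(isBddAnalytic_blaschkeProduct hα hs).tendsto_lowerValue,
    (isBddAnalytic_blaschkeProduct (fun j : ↥((s : Set ι)ᶜ) => hα j)
      (hs.subtype _)).tendsto_lowerValue] with θ h1 h2
  have h3 : Tendsto (fun y => ∏ j ∈ s, slice (blaschkeFactor (α j)) y θ) (𝓝[>] (-Real.pi))
      (𝓝 (∏ j ∈ s, blaschkeFactor (α j) (θ + (-Real.pi : ℝ) * Complex.I))) :=
    tendsto_finsetProd _ fun j _ => tendsto_slice_of_continuousAt_lower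
      (continuousAt_blaschkeFactor (hα j) (exp_lower_im_zero θ))
  have h4 := tendsto_nhds_unique (h1.congr' (by
    filter_upwards [lower_mem] with y hy
    exact blaschkeProduct_eq_mul hα hs s (mem_strip_iff.2 hy))) (h3.mul h2)
  rw [h4, norm_mul, norm_prod, Finset.prod_eq_one fun j _ =>
    norm_blaschkeFactor_eq_one (hα j) (exp_lower_im_zero θ), one_mul]

/-- A Blaschke product has boundary values of modulus `1`. -/
theorem norm_boundary_blaschkeProduct (hα : ∀ j, α j ∈ strip)
    (hs : Summable fun j => 1 - ‖diskPoint (α j)‖) :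
    (∀ᵐ θ : ℝ, ‖upperValue (blaschkeProduct α) θ‖ = 1) ∧
      ∀ᵐ θ : ℝ, ‖lowerValue (blaschkeProduct α) θ‖ = 1 := by
  have hB := isBddAnalytic_blaschkeProduct hα hs
  have hlim := (tendsto_order.1 (tendsto_tsum_compl_atTop_zero
    fun j => 1 - ‖diskPoint (α j)‖)).2
  have hT : ∀ n : ℕ, ∃ s : Finset ι,
      ∑' j : {j // j ∉ s}, (1 - ‖diskPoint (α j)‖) < 1 / ((n : ℝ) + 1) := fun n =>
    (hlim (1 / ((n : ℝ) + 1)) (by positivity)).exists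
  choose s hs1 using hT
  choose ρ hρm hρ hρu hρl using fun n => exists_density_one_sub_norm
    (differentiableOn_blaschkeProduct (fun j : ↥((s n : Set ι)ᶜ) => hα j) (hs.subtype _))
    (fun _ hζ => norm_blaschkeProduct_le_one (fun j : ↥((s n : Set ι)ᶜ) => hα j)
      (hs.subtype _) hζ)
  have hρn : ∀ n, ∫⁻ x, ρ n x ≤ ENNReal.ofReal (Real.exp (2 * (1 / ((n : ℝ) + 1))) - 1) :=
    fun n => by
      refine (hρ n).trans (ENNReal.ofReal_le_ofReal ?_)
      have h1 := norm_blaschkeProduct_center (fun j : ↥((s n : Set ι)ᶜ) => hα j) (hs.subtype _)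
      have h2 : Real.exp (2 * ∑' j : ↥((s n : Set ι)ᶜ), (1 - ‖diskPoint (α j)‖))
          ≤ Real.exp (2 * (1 / ((n : ℝ) + 1))) := by
        gcongr
        exact (hs1 n).le
      linarith
  -- The density of each tail controls the same boundary defect. Their masses tend to zero, so the
  -- infimum vanishes almost everywhere.
  have hinf : ∫⁻ x, ⨅ n, ρ n x ≤ 0 := by
    have h1 : Tendsto (fun n : ℕ => ENNReal.ofReal (Real.exp (2 * (1 / ((n : ℝ) + 1))) - 1)) atTop
        (𝓝 0) := by
      have h2 := ((Real.continuous_exp.tendsto _).comp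
        ((tendsto_one_div_add_atTop_nhds_zero_nat (𝕜 := ℝ)).const_mul 2)).sub_const 1
      have h3 := ENNReal.tendsto_ofReal h2
      simpa using h3
    exact ge_of_tendsto h1 (Eventually.of_forall fun n =>
      (lintegral_mono fun x => iInf_le (fun n => ρ n x) n).trans (hρn n))
  have hzero : ∀ᵐ x : ℝ, ⨅ n, ρ n x = 0 :=
    (lintegral_eq_zero_iff (Measurable.iInf hρm)).1 (le_antisymm hinf zero_le)
  have key : ∀ {x : ℝ} {c : ℂ} {K : ℝ}, ⨅ n, ρ n x = 0 → ‖c‖ ≤ 1 →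
      (∀ n, ENNReal.ofReal (1 - ‖c‖) ≤ ENNReal.ofReal K * ρ n x) → ‖c‖ = 1 := by
    intro x c K h0 hc h
    have h1 : ENNReal.ofReal (1 - ‖c‖) ≤ ENNReal.ofReal K * ⨅ n, ρ n x := by
      rw [ENNReal.mul_iInf fun h => absurd h ENNReal.ofReal_ne_top]
      exact le_iInf h
    rw [h0, mul_zero, nonpos_iff_eq_zero, ENNReal.ofReal_eq_zero] at h1
    linarith
  obtain ⟨-, hbu⟩ := memLp_top_of_tendsto upper_mem hB.analytic
    (fun ζ hζ => norm_blaschkeProduct_le_one hα hs hζ) hB.tendsto_upperValue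
  obtain ⟨-, hbl⟩ := memLp_top_of_tendsto lower_mem hB.analytic
    (fun ζ hζ => norm_blaschkeProduct_le_one hα hs hζ) hB.tendsto_lowerValue
  constructor
  · filter_upwards [ae_exp_of_ae hzero, hbu, ae_all_iff.2 hρu,
      ae_all_iff.2 fun n => norm_upperValue_prod hα hs (s n)] with θ h1 h2 h3 h4
    exact key h1 h2 fun n => by rw [h4 n]; exact h3 n
  · filter_upwards [ae_neg_exp_of_ae hzero, hbl, ae_all_iff.2 hρl,
      ae_all_iff.2 fun n => norm_lowerValue_prod hα hs (s n)] with θ h1 h2 h3 h4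
    exact key h1 h2 fun n => by rw [h4 n]; exact h3 n

end

/-! ### Inner and outer functions -/

/-- The exponential of a Poisson type integral. -/
def poissonExp (ρ : ℝ → ℝ) (ζ : ℂ) : ℂ :=
  Complex.exp (-(Complex.I / Real.pi) * ∫ s, kernel ζ s * (ρ s : ℂ))

lemma outerOn_eq {S : Set ℝ} (hS : MeasurableSet S) (φ : ℝ → ℝ) (ζ : ℂ) :
    outerOn S φ ζ = poissonExp (S.indicator fun s => Real.log (φ s) / (1 + s ^ 2)) ζ := by
  rw [outerOn, poissonExp, ← integral_indicator hS]
  congr 3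
  ext s
  by_cases hs : s ∈ S <;> simp [hs]

lemma differentiableOn_poissonExp {ρ : ℝ → ℝ} (hρ : Integrable ρ) :
    DifferentiableOn ℂ (poissonExp ρ) strip :=
  ((differentiableOn_integral_kernel_mul hρ.ofReal).const_mul _).cexp

lemma poissonExp_add {ρ ρ' : ℝ → ℝ} (hρ : Integrable ρ) (hρ' : Integrable ρ') {ζ : ℂ}
    (hζ : ζ ∈ strip) : poissonExp (ρ + ρ') ζ = poissonExp ρ ζ * poissonExp ρ' ζ := by
  simp only [poissonExp, kernel_eq]
  have h := integral_add (f := fun s => halfKernel (Complex.exp ζ) s * (ρ s : ℂ))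
    (g := fun s => halfKernel (Complex.exp ζ) s * (ρ' s : ℂ))
    (integrable_halfKernel_mul hρ.ofReal (exp_im_neg hζ))
    (integrable_halfKernel_mul hρ'.ofReal (exp_im_neg hζ))
  rw [← Complex.exp_add, ← mul_add, ← h]
  congr 3
  ext s
  simp only [Pi.add_apply, Complex.ofReal_add]
  ring

lemma norm_poissonExp {ρ : ℝ → ℝ} (hρ : Integrable ρ) {ζ : ℂ} (hζ : ζ ∈ strip) :
    ‖poissonExp ρ ζ‖
      = Real.exp (Real.pi⁻¹ * ∫ s, poisson (Complex.exp ζ) s * (1 + s ^ 2) * ρ s) := by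
  rw [poissonExp, Complex.norm_exp, ← re_neg_I_mul_integral hρ (exp_im_neg hζ)]
  congr 1
  have e : -(Complex.I / Real.pi) * ∫ s, kernel ζ s * (ρ s : ℂ)
      = (Real.pi⁻¹ : ℝ) * (-Complex.I * ∫ s, halfKernel (Complex.exp ζ) s * (ρ s : ℂ)) := by
    simp only [kernel_eq]
    push_cast
    ring
  rw [e, Complex.re_ofReal_mul]

lemma norm_poissonExp_le {ρ : ℝ → ℝ} (hρ : Integrable ρ) {M : ℝ}
    (hM : ∀ᵐ s, (1 + s ^ 2) * ρ s ≤ M) {ζ : ℂ} (hζ : ζ ∈ strip) :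
    ‖poissonExp ρ ζ‖ ≤ Real.exp M := by
  rw [norm_poissonExp hρ hζ, Real.exp_le_exp]
  obtain ⟨hi, h1⟩ := integral_poisson (exp_im_neg hζ)
  have h2 : ∫ s, poisson (Complex.exp ζ) s * (1 + s ^ 2) * ρ s
      ≤ ∫ s, poisson (Complex.exp ζ) s * M := by
    refine integral_mono_ae (integrable_poisson_weight_mul hρ (exp_im_neg hζ)) (hi.mul_const M) ?_
    filter_upwards [hM] with s hs
    rw [mul_assoc]
    exact mul_le_mul_of_nonneg_left hs (poisson_nonneg (exp_im_neg hζ) s)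
  rw [integral_mul_const, h1] at h2
  rw [inv_mul_le_iff₀ Real.pi_pos]
  exact h2

lemma isBddAnalytic_poissonExp {ρ : ℝ → ℝ} (hρ : Integrable ρ) {M : ℝ}
    (hM : ∀ᵐ s, (1 + s ^ 2) * ρ s ≤ M) : IsBddAnalytic (poissonExp ρ) :=
  ⟨differentiableOn_poissonExp hρ, Real.exp M, fun _ hζ => norm_poissonExp_le hρ hM hζ⟩

lemma poissonExp_neg (ρ : ℝ → ℝ) (ζ : ℂ) : poissonExp (-ρ) ζ = (poissonExp ρ ζ)⁻¹ := by
  rw [poissonExp, poissonExp, ← Complex.exp_neg]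
  congr 1
  simp only [Pi.neg_apply, Complex.ofReal_neg, mul_neg, integral_neg]

lemma ae_tendsto_norm_poissonExp {ρ : ℝ → ℝ} (hρ : Integrable ρ) :
    ∀ᵐ x : ℝ, Tendsto
      (fun w => Real.exp (Real.pi⁻¹ * ∫ s, poisson w s * (1 + s ^ 2) * ρ s)) (NT x)
      (𝓝 (Real.exp ((1 + x ^ 2) * ρ x))) := by
  filter_upwards [ae_tendsto_poisson_density hρ] with x hx
  have h1 := (Real.continuous_exp.tendsto _).comp (hx.const_mul Real.pi⁻¹)
  rwa [mul_assoc Real.pi, inv_mul_cancel_left₀ Real.pi_ne_zero] at h1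

lemma tendsto_norm_poissonExp_upper {ρ : ℝ → ℝ} (hρ : Integrable ρ) :
    ∀ᵐ θ : ℝ, Tendsto (fun y => ‖slice (poissonExp ρ) y θ‖) (𝓝[<] 0)
      (𝓝 (Real.exp ((1 + Real.exp θ ^ 2) * ρ (Real.exp θ)))) := by
  filter_upwards [slice_exp_upper (ae_tendsto_norm_poissonExp hρ)] with θ hθ
  refine hθ.congr' ?_
  filter_upwards [upper_mem] with y hy
  exact (norm_poissonExp hρ (mem_strip_iff.2 hy)).symm

lemma tendsto_norm_poissonExp_lower {ρ : ℝ → ℝ} (hρ : Integrable ρ) :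
    ∀ᵐ θ : ℝ, Tendsto (fun y => ‖slice (poissonExp ρ) y θ‖) (𝓝[>] (-Real.pi))
      (𝓝 (Real.exp ((1 + (-Real.exp θ) ^ 2) * ρ (-Real.exp θ)))) := by
  filter_upwards [slice_exp_lower (ae_tendsto_norm_poissonExp hρ)] with θ hθ
  refine hθ.congr' ?_
  filter_upwards [lower_mem] with y hy
  exact (norm_poissonExp hρ (mem_strip_iff.2 hy)).symm

/-! ### Boundary modulus of singular inner functions -/

section

variable {ν : Measure ℝ} [IsFiniteMeasure ν] {m : ℝ}

lemma norm_singularInner {ζ : ℂ} (hζ : ζ ∈ strip) :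
    ‖singularInner ν m ζ‖ = Real.exp (m * (Complex.exp ζ).im
      - ∫ s, poisson (Complex.exp ζ) s * (1 + s ^ 2) ∂ν) := by
  rw [singularInner, Complex.norm_exp, ← re_neg_I_mul_integral_one (exp_im_neg hζ)]
  congr 1
  simp only [kernel_eq]
  simp
  ring

lemma differentiableOn_singularInner : DifferentiableOn ℂ (singularInner ν m) strip :=
  (((differentiableOn_integral_kernel ν).add (by fun_prop)).const_mul _).cexp

lemma isBddAnalytic_singularInner (hm : 0 ≤ m) : IsBddAnalytic (singularInner ν m) := by
  refine ⟨differentiableOn_singularInner, 1, fun ζ hζ => ?_⟩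
  rw [norm_singularInner hζ, Real.exp_le_one_iff]
  have h1 : 0 ≤ ∫ s, poisson (Complex.exp ζ) s * (1 + s ^ 2) ∂ν :=
    integral_nonneg fun s => mul_nonneg (poisson_nonneg (exp_im_neg hζ) s) (by positivity)
  nlinarith [exp_im_neg hζ]

lemma ae_tendsto_norm_singularInner (hν : ν.MutuallySingular volume) :
    ∀ᵐ x : ℝ, Tendsto
      (fun w : ℂ => Real.exp (m * w.im - ∫ s, poisson w s * (1 + s ^ 2) ∂ν)) (NT x) (𝓝 1) := by
  filter_upwards [ae_tendsto_poisson_singular hν] with x hx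
  have h1 := ((Complex.continuous_im.tendsto (x : ℂ)).mono_left (NT_le x)).const_mul m
  simpa [Function.comp_def] using (Real.continuous_exp.tendsto _).comp (h1.sub hx)

lemma tendsto_norm_singularInner_upper (hν : ν.MutuallySingular volume) :
    ∀ᵐ θ : ℝ, Tendsto (fun y => ‖slice (singularInner ν m) y θ‖) (𝓝[<] 0) (𝓝 1) := by
  filter_upwards [slice_exp_upper (p := fun _ => 1) (ae_tendsto_norm_singularInner (m := m) hν)]
    with θ hθ
  refine hθ.congr' ?_
  filter_upwards [upper_mem] with y hy
  exact (norm_singularInner (mem_strip_iff.2 hy)).symm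

lemma tendsto_norm_singularInner_lower (hν : ν.MutuallySingular volume) :
    ∀ᵐ θ : ℝ, Tendsto (fun y => ‖slice (singularInner ν m) y θ‖) (𝓝[>] (-Real.pi)) (𝓝 1) := by
  filter_upwards [slice_exp_lower (p := fun _ => 1) (ae_tendsto_norm_singularInner (m := m) hν)]
    with θ hθ
  refine hθ.congr' ?_
  filter_upwards [lower_mem] with y hy
  exact (norm_singularInner (mem_strip_iff.2 hy)).symm

end

/-- The symmetry of the exponential of the Poisson integral of an odd function. -/
lemma conj_poissonExp_mul {ρ : ℝ → ℝ} (hodd : ∀ᵐ s, ρ (-s) = -ρ s) (θ y : ℝ) :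
    starRingEnd ℂ (slice (poissonExp ρ) y θ) * slice (poissonExp ρ) (-Real.pi - y) θ = 1 := by
  -- Reflection of the strip in its middle line becomes `w ↦ -w̄`, which acts on the boundary
  -- parameter as `s ↦ -s`. An odd density then conjugates the integral and inverts the exponential
  -- up to conjugation.
  have hw : Complex.exp (θ + ((-Real.pi - y : ℝ) : ℂ) * Complex.I)
      = -starRingEnd ℂ (Complex.exp (θ + y * Complex.I)) := by
    apply Complex.ext
    · rw [exp_slice_re, Complex.neg_re, Complex.conj_re, exp_slice_re,
        show -Real.pi - y = -(y + Real.pi) by ring, Real.cos_neg, Real.cos_add_pi]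
      ring
    · rw [exp_slice_im, Complex.neg_im, Complex.conj_im, exp_slice_im,
        show -Real.pi - y = -(y + Real.pi) by ring, Real.sin_neg, Real.sin_add_pi]
      ring
  have hK : ∀ s : ℝ, kernel (θ + ((-Real.pi - y : ℝ) : ℂ) * Complex.I) s
      = -starRingEnd ℂ (kernel (θ + y * Complex.I) (-s)) := fun s => by
    simp only [kernel, hw, map_div₀, map_add, map_sub, map_mul, map_one, Complex.conj_ofReal]
    rw [← div_neg]
    congr 1 <;> push_cast <;> ring
  have hJ : ∫ s, kernel (θ + ((-Real.pi - y : ℝ) : ℂ) * Complex.I) s * (ρ s : ℂ)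
      = starRingEnd ℂ (∫ s, kernel (θ + y * Complex.I) s * (ρ s : ℂ)) := by
    rw [← integral_conj, ← integral_neg_eq_self]
    refine integral_congr_ae ?_
    filter_upwards [hodd] with s hs
    rw [hK, neg_neg, hs, map_mul, Complex.conj_ofReal]
    push_cast
    ring
  rw [slice, slice, poissonExp, poissonExp, hJ, ← Complex.exp_conj, ← Complex.exp_add]
  simp only [map_mul, map_neg, map_div₀, Complex.conj_I, Complex.conj_ofReal]
  rw [← Complex.exp_zero]
  congr 1
  ring

lemma tendsto_neg_pi_sub : Tendsto (fun y : ℝ => -Real.pi - y) (𝓝[<] 0) (𝓝[>] (-Real.pi)) := by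
  refine tendsto_nhdsWithin_iff.2 ⟨?_, ?_⟩
  · have h : Continuous fun y : ℝ => -Real.pi - y := by fun_prop
    simpa using (h.tendsto 0).mono_left nhdsWithin_le_nhds
  · filter_upwards [self_mem_nhdsWithin] with y hy
    rw [Set.mem_Iio] at hy
    rw [Set.mem_Ioi]
    linarith

lemma conj_upperValue_mul_lowerValue {ρ : ℝ → ℝ} (hodd : ∀ᵐ s, ρ (-s) = -ρ s)
    (hb : IsBddAnalytic (poissonExp ρ)) :
    ∀ᵐ θ : ℝ, starRingEnd ℂ (upperValue (poissonExp ρ) θ) * lowerValue (poissonExp ρ) θ = 1 := by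
  filter_upwards [hb.tendsto_upperValue, hb.tendsto_lowerValue] with θ h1 h2
  have h3 := ((Complex.continuous_conj.tendsto _).comp h1).mul (h2.comp tendsto_neg_pi_sub)
  refine tendsto_nhds_unique h3 (tendsto_const_nhds.congr fun y => ?_)
  exact (conj_poissonExp_mul hodd θ y).symm

/-! ### Comparison of extensions -/

/-- If `b` is the lower value of `hξ`, then `q(θ - πi) b` is that of `kξ = q h ξ`. Multiplying by
`conj k = conj q · conj h` cancels the two boundary values of `q`. -/
lemma extension_le {h k q : ℂ → ℂ} (hh : IsBddAnalytic h) (hq : IsBddAnalytic q)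
    (hk : IsBddAnalytic k) (he : ∀ z ∈ strip, k z = q z * h z)
    (hqq : ∀ᵐ θ : ℝ, starRingEnd ℂ (upperValue q θ) * lowerValue q θ = 1) :
    extension h ≤ extension k := by
  have hku : ∀ᵐ θ : ℝ, upperValue q θ * upperValue h θ = upperValue k θ := by
    filter_upwards [hq.tendsto_upperValue, hh.tendsto_upperValue] with θ h1 h2
    refine (upperValue_eq ((h1.mul h2).congr' ?_)).symm
    filter_upwards [upper_mem] with y hy
    exact (he _ (mem_strip_iff.2 hy)).symm
  rw [← LinearPMap.le_graph_iff]
  rintro ⟨ξ, ξ'⟩ hξ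
  obtain ⟨b, hb, rfl⟩ := (mem_extension_graph hh).1 hξ
  have h1 := hq.mul_mem_continuationGraph hb
  rw [mulOp_mulOp hq.memLp_upperValue hh.memLp_upperValue hk.memLp_upperValue hku] at h1
  refine (mem_extension_graph hk).2 ⟨_, h1, ?_⟩
  rw [mulOp_mulOp (memLp_top_conj hk.memLp_upperValue) hq.memLp_lowerValue
    (memLp_top_conj hh.memLp_upperValue)]
  filter_upwards [hku, hqq] with θ h2 h3
  rw [← h2, map_mul]
  linear_combination starRingEnd ℂ (upperValue h θ) * h3

/-- The hypotheses on `q` pass to `1/q`, so the inclusion holds in both directions. -/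
lemma extension_eq {h k q : ℂ → ℂ} (hh : IsBddAnalytic h) (hq : IsBddAnalytic q)
    (hq' : IsBddAnalytic fun z => (q z)⁻¹) (hq0 : ∀ z ∈ strip, q z ≠ 0)
    (hk : IsBddAnalytic k) (he : ∀ z ∈ strip, k z = q z * h z)
    (hqq : ∀ᵐ θ : ℝ, starRingEnd ℂ (upperValue q θ) * lowerValue q θ = 1) :
    extension h = extension k := by
  refine le_antisymm (extension_le hh hq hk he hqq) (extension_le hk hq' hh (fun z hz => ?_) ?_)
  · rw [he z hz, inv_mul_cancel_left₀ (hq0 z hz)]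
  · filter_upwards [hqq, hq.tendsto_upperValue, hq.tendsto_lowerValue] with θ h1 h2 h3
    have h4 : upperValue q θ ≠ 0 := fun h => by simp [h] at h1
    have h5 : lowerValue q θ ≠ 0 := fun h => by simp [h] at h1
    rw [upperValue_eq (g := fun z => (q z)⁻¹) (h2.inv₀ h4),
      lowerValue_eq (g := fun z => (q z)⁻¹) (h3.inv₀ h5), map_inv₀, ← mul_inv, h1, inv_one]

/-! ### The canonical extension -/

lemma IsBddAnalytic.upperValue_mul {g k : ℂ → ℂ} (hg : IsBddAnalytic g) (hk : IsBddAnalytic k) :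
    ∀ᵐ θ : ℝ, upperValue g θ * upperValue k θ = upperValue (fun z => g z * k z) θ := by
  filter_upwards [hg.tendsto_upperValue, hk.tendsto_upperValue] with θ h1 h2
  exact (upperValue_eq (g := fun z => g z * k z) (h1.mul h2)).symm

namespace BeurlingFactorization

variable {h : ℂ → ℂ} (B : BeurlingFactorization h)

/-- The density of the outer factor. -/
def density (s : ℝ) : ℝ := Real.log (B.φ s) / (1 + s ^ 2)

lemma integrable_density : Integrable B.density := B.φ_integrable

lemma one_add_sq_mul_density (s : ℝ) : (1 + s ^ 2) * B.density s = Real.log (B.φ s) := by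
  have : 1 + s ^ 2 ≠ 0 := by positivity
  rw [density]
  field_simp

lemma exp_one_add_sq_mul_density (s : ℝ) : Real.exp ((1 + s ^ 2) * B.density s) = B.φ s := by
  rw [one_add_sq_mul_density, Real.exp_log (B.φ_pos s)]

lemma outerFun_eq (ζ : ℂ) : outerFun B.φ ζ = poissonExp B.density ζ := by
  rw [outerFun, outerOn_eq MeasurableSet.univ, Set.indicator_univ]
  rfl

lemma outerMinus_eq (ζ : ℂ) : outerMinus (fun s => B.φ s ^ 2) ζ
    = poissonExp ((Set.Iio 0).indicator fun s => 2 * B.density s) ζ := by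
  rw [outerMinus, outerOn_eq measurableSet_Iio]
  congr 3
  ext s
  rw [Real.log_pow, density]
  push_cast
  ring

lemma isBddAnalytic_blaschke : IsBddAnalytic (blaschkeProduct B.α) :=
  isBddAnalytic_blaschkeProduct B.α_mem B.blaschke_condition

lemma isBddAnalytic_singular : IsBddAnalytic (singularInner B.ν B.m) :=
  haveI := B.finite_ν
  isBddAnalytic_singularInner B.m_nonneg

/-- The constant, the Blaschke product and the singular inner factor have boundary modulus `1`, so
only the outer factor contributes. This makes any given `φ` computable from `h`. -/
lemma norm_upperValue (hh : IsBddAnalytic h) :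
    ∀ᵐ θ : ℝ, ‖upperValue h θ‖ = B.φ (Real.exp θ) := by
  have := B.finite_ν
  filter_upwards [hh.tendsto_upperValue, B.isBddAnalytic_blaschke.tendsto_upperValue,
    (norm_boundary_blaschkeProduct B.α_mem B.blaschke_condition).1,
    tendsto_norm_singularInner_upper (m := B.m) B.singular_ν,
    tendsto_norm_poissonExp_upper B.integrable_density] with θ h1 h2 h3 h4 h5
  have h6 := ((h2.norm.const_mul ‖B.c‖).mul h4).mul h5
  rw [h3, B.norm_c, one_mul, one_mul, one_mul, exp_one_add_sq_mul_density] at h6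
  refine tendsto_nhds_unique h1.norm (h6.congr' ?_)
  filter_upwards [upper_mem] with y hy
  have h7 := B.factorization _ (mem_strip_iff (x := θ).2 hy)
  rw [outerFun_eq] at h7
  simp only [slice, h7, norm_mul, B.norm_c]

lemma norm_lowerValue (hh : IsBddAnalytic h) :
    ∀ᵐ θ : ℝ, ‖lowerValue h θ‖ = B.φ (-Real.exp θ) := by
  have := B.finite_ν
  filter_upwards [hh.tendsto_lowerValue, B.isBddAnalytic_blaschke.tendsto_lowerValue,
    (norm_boundary_blaschkeProduct B.α_mem B.blaschke_condition).2,
    tendsto_norm_singularInner_lower (m := B.m) B.singular_ν,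
    tendsto_norm_poissonExp_lower B.integrable_density] with θ h1 h2 h3 h4 h5
  have h6 := ((h2.norm.const_mul ‖B.c‖).mul h4).mul h5
  rw [h3, B.norm_c, one_mul, one_mul, one_mul, exp_one_add_sq_mul_density] at h6
  refine tendsto_nhds_unique h1.norm (h6.congr' ?_)
  filter_upwards [lower_mem] with y hy
  have h7 := B.factorization _ (mem_strip_iff (x := θ).2 hy)
  rw [outerFun_eq] at h7
  simp only [slice, h7, norm_mul, B.norm_c]

/-- The points `e^θ` and `-e^θ` represent `θ` and `θ - πi`, where the symmetry of `h` forces equal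
moduli. -/
lemma modulus_even (hh : IsBddAnalytic h)
    (hs : ∀ᵐ θ : ℝ, starRingEnd ℂ (upperValue h θ) = lowerValue h θ) :
    ∀ᵐ s : ℝ, B.φ (-s) = B.φ s := by
  have h1 : ∀ᵐ θ : ℝ, B.φ (-Real.exp θ) = B.φ (Real.exp θ) := by
    filter_upwards [B.norm_upperValue hh, B.norm_lowerValue hh, hs] with θ h1 h2 h3
    rw [← h1, ← h2, ← h3, Complex.norm_conj]
  refine ae_of_ae_exp h1 ?_
  filter_upwards [h1] with θ hθ
  rw [neg_neg, hθ]

/-- The two-sided bound on `φ` is what makes both `f_- / h_out` and its inverse bounded. -/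
lemma exists_log_modulus_le (hh : IsBddAnalytic h) {δ : ℝ} (hδ : 0 < δ)
    (hb : ∀ᵐ θ : ℝ, δ ≤ ‖upperValue h θ‖ ∧ δ ≤ ‖lowerValue h θ‖) :
    ∃ M, ∀ᵐ s : ℝ, |Real.log (B.φ s)| ≤ M := by
  obtain ⟨C, hC⟩ := hh.bounded
  have key : ∀ {t : ℝ}, δ ≤ t → t ≤ C → |Real.log t| ≤ max (Real.log C) (-Real.log δ) := by
    intro t h1 h2
    rw [abs_le]
    have h3 := Real.log_le_log hδ h1
    have h4 := Real.log_le_log (hδ.trans_le h1) h2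
    exact ⟨by linarith [le_max_right (Real.log C) (-Real.log δ)], h4.trans (le_max_left _ _)⟩
  refine ⟨max (Real.log C) (-Real.log δ), ae_of_ae_exp ?_ ?_⟩
  · filter_upwards [B.norm_upperValue hh, hb, (memLp_top_of_tendsto upper_mem hh.analytic hC
      hh.tendsto_upperValue).2] with θ h1 h2 h3
    rw [h1] at h2 h3
    exact key h2.1 h3
  · filter_upwards [B.norm_lowerValue hh, hb, (memLp_top_of_tendsto lower_mem hh.analytic hC
      hh.tendsto_lowerValue).2] with θ h1 h2 h3
    rw [h1] at h2 h3
    exact key h2.2 h3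

/-- The density of the quotient of `f_-` and the outer factor. -/
def oddDensity (s : ℝ) : ℝ := (if s < 0 then 1 else -1) * B.density s

lemma integrable_oddDensity : Integrable B.oddDensity := by
  refine B.integrable_density.bdd_mul (c := 1)
    (Measurable.ite measurableSet_Iio measurable_const measurable_const).aestronglyMeasurable
    (Eventually.of_forall fun s => ?_)
  split_ifs <;> simp

lemma oddDensity_neg (hh : IsBddAnalytic h)
    (hs : ∀ᵐ θ : ℝ, starRingEnd ℂ (upperValue h θ) = lowerValue h θ) :
    ∀ᵐ s : ℝ, B.oddDensity (-s) = -B.oddDensity s := by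
  have h0 : ∀ᵐ s : ℝ, s ≠ 0 := by simp [ae_iff]
  filter_upwards [B.modulus_even hh hs, h0] with s h1 h2
  have h3 : B.density (-s) = B.density s := by rw [density, density, h1, neg_sq]
  rw [oddDensity, oddDensity, h3]
  rcases lt_or_gt_of_ne h2 with h4 | h4
  · rw [if_neg (by linarith), if_pos h4]; ring
  · rw [if_pos (by linarith), if_neg (by linarith)]; ring

lemma abs_oddDensity (s : ℝ) : |(1 + s ^ 2) * B.oddDensity s| = |Real.log (B.φ s)| := by
  rw [← one_add_sq_mul_density, oddDensity, mul_left_comm, abs_mul]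
  split_ifs <;> simp

/-- Density plus odd density is twice the density on the negative axis and zero on the rest, which
is the density of `f_-`. -/
lemma outerMinus_eq_mul {ζ : ℂ} (hζ : ζ ∈ strip) : outerMinus (fun s => B.φ s ^ 2) ζ
    = poissonExp B.oddDensity ζ * outerFun B.φ ζ := by
  rw [outerMinus_eq, outerFun_eq, ← poissonExp_add B.integrable_oddDensity B.integrable_density hζ]
  congr 1
  ext s
  by_cases hs : s < 0
  · rw [Set.indicator_of_mem (Set.mem_Iio.2 hs), Pi.add_apply, oddDensity, if_pos hs]; ring
  · rw [Set.indicator_of_notMem (by simpa using hs), Pi.add_apply, oddDensity, if_neg hs]; ring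

lemma isBddAnalytic_outerMinus {M : ℝ} (hM : ∀ᵐ s : ℝ, |Real.log (B.φ s)| ≤ M) :
    IsBddAnalytic (outerMinus fun s => B.φ s ^ 2) := by
  have e : outerMinus (fun s => B.φ s ^ 2)
      = poissonExp ((Set.Iio 0).indicator fun s => 2 * B.density s) := funext B.outerMinus_eq
  rw [e]
  refine isBddAnalytic_poissonExp ((B.integrable_density.const_mul 2).indicator measurableSet_Iio)
    (M := 2 * M) ?_
  filter_upwards [hM] with s hs
  by_cases h0 : s < 0
  · rw [Set.indicator_of_mem (Set.mem_Iio.2 h0), mul_left_comm, one_add_sq_mul_density]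
    linarith [le_abs_self (Real.log (B.φ s))]
  · rw [Set.indicator_of_notMem (by simpa using h0), mul_zero]
    linarith [abs_nonneg (Real.log (B.φ s))]

/-- The canonical extension does not depend on the factorization. -/
theorem extension_eq_canonicalExtension (hh : IsBddAnalytic h)
    (hs : ∀ᵐ θ : ℝ, starRingEnd ℂ (upperValue h θ) = lowerValue h θ) {δ : ℝ} (hδ : 0 < δ)
    (hb : ∀ᵐ θ : ℝ, δ ≤ ‖upperValue h θ‖ ∧ δ ≤ ‖lowerValue h θ‖) :
    extension h = B.canonicalExtension := by
  obtain ⟨M, hM⟩ := B.exists_log_modulus_le hh hδ hb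
  have hr : IsBddAnalytic (poissonExp B.oddDensity) := by
    refine isBddAnalytic_poissonExp B.integrable_oddDensity (M := M) ?_
    filter_upwards [hM] with s h1
    rw [← abs_oddDensity] at h1
    exact (le_abs_self _).trans h1
  have hr' : IsBddAnalytic (poissonExp (-B.oddDensity)) := by
    refine isBddAnalytic_poissonExp B.integrable_oddDensity.neg (M := M) ?_
    filter_upwards [hM] with s h1
    rw [← abs_oddDensity] at h1
    rw [Pi.neg_apply, mul_neg]
    exact (neg_le_abs _).trans h1
  have hr0 : ∀ z, poissonExp B.oddDensity z ≠ 0 := fun z => Complex.exp_ne_zero _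
  have hm := B.isBddAnalytic_outerMinus hM
  have hc : B.c ≠ 0 := fun h => by have := B.norm_c; simp [h] at this
  have hconst : ∀ c : ℂ, IsBddAnalytic fun _ => c := fun c =>
    ⟨differentiableOn_const c, ‖c‖, fun _ _ => le_rfl⟩
  -- Dividing `k` by `h` cancels the Blaschke and inner factors and leaves `q = c⁻¹ f_- / h_out`.
  -- The constant is harmless because `conj (c⁻¹) · c⁻¹ = 1`.
  set q : ℂ → ℂ := fun z => B.c⁻¹ * poissonExp B.oddDensity z with hq
  set k : ℂ → ℂ := fun z => blaschkeProduct B.α z * (singularInner B.ν B.m z *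
    outerMinus (fun s => B.φ s ^ 2) z) with hkdef
  have hqb : IsBddAnalytic q := (hconst _).mul hr
  have hsm := B.isBddAnalytic_singular.mul hm
  have hk : IsBddAnalytic k := B.isBddAnalytic_blaschke.mul hsm
  have hU : B.intertwiner = mulOp (upperValue k) := by
    ext1 x
    rw [intertwiner, ContinuousLinearMap.comp_apply, ContinuousLinearMap.comp_apply,
      mulOp_mulOp B.isBddAnalytic_singular.memLp_upperValue hm.memLp_upperValue
        hsm.memLp_upperValue (B.isBddAnalytic_singular.upperValue_mul hm),
      mulOp_mulOp B.isBddAnalytic_blaschke.memLp_upperValue hsm.memLp_upperValue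
        hk.memLp_upperValue (B.isBddAnalytic_blaschke.upperValue_mul hsm)]
  have hcan : B.canonicalExtension = extension k := by
    rw [extension, ← hU]
    rfl
  rw [hcan]
  refine extension_eq hh hqb ?_ (fun z _ => mul_ne_zero (inv_ne_zero hc) (hr0 z)) hk
    (fun z hz => ?_) ?_
  · have e : (fun z => (q z)⁻¹) = fun z => B.c * poissonExp (-B.oddDensity) z := by
      ext z
      rw [hq, poissonExp_neg, mul_inv, inv_inv]
    rw [e]
    exact (hconst _).mul hr'
  · rw [hkdef, hq, B.factorization z hz]
    simp only [B.outerMinus_eq_mul hz]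
    field_simp
  · filter_upwards [conj_upperValue_mul_lowerValue (B.oddDensity_neg hh hs) hr,
      hr.tendsto_upperValue, hr.tendsto_lowerValue] with θ h1 h2 h3
    rw [upperValue_eq (g := q) (h2.const_mul B.c⁻¹), lowerValue_eq (g := q) (h3.const_mul B.c⁻¹),
      map_mul]
    have h4 : starRingEnd ℂ B.c⁻¹ * B.c⁻¹ = 1 := by
      rw [mul_comm, Complex.mul_conj, Complex.normSq_eq_norm_sq, norm_inv, B.norm_c]
      simp
    linear_combination starRingEnd ℂ B.c⁻¹ * B.c⁻¹ * h1 + h4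

end BeurlingFactorization

/-! ### Division of analytic functions -/

lemma eventually_ne_zero_of_order {B : ℂ → ℂ} {z : ℂ} (hB : AnalyticAt ℂ B z)
    (h : analyticOrderAt B z ≠ ⊤) : ∀ᶠ x in 𝓝[≠] z, B x ≠ 0 :=
  hB.eventually_eq_zero_or_eventually_ne_zero.resolve_left fun h0 =>
    h (analyticOrderAt_eq_top.2 h0)

/-- The comparison of orders gives an analytic quotient near each point. Zeros of `B` are isolated,
so the local quotients agree with one punctured limit and glue. -/
lemma exists_analytic_quotient {U : Set ℂ} (hU : IsOpen U) {h B : ℂ → ℂ}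
    (hh : DifferentiableOn ℂ h U) (hB : DifferentiableOn ℂ B U)
    (hB0 : ∀ z ∈ U, analyticOrderAt B z ≠ ⊤)
    (ho : ∀ z ∈ U, analyticOrderAt B z ≤ analyticOrderAt h z) :
    ∃ k : ℂ → ℂ, DifferentiableOn ℂ k U ∧ ∀ z ∈ U, h z = B z * k z := by
  have hBa := hB.analyticOnNhd hU
  have hha := hh.analyticOnNhd hU
  have hloc : ∀ z ∈ U, ∃ q : ℂ → ℂ, AnalyticAt ℂ q z ∧ ∀ᶠ x in 𝓝 z, h x = B x * q x := by
    intro z hz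
    obtain ⟨b, hb, hbz, hbe⟩ := (hBa z hz).analyticOrderAt_ne_top.1 (hB0 z hz)
    have h1 : (analyticOrderNatAt B z : ℕ∞) ≤ analyticOrderAt h z := by
      rw [Nat.cast_analyticOrderNatAt (hB0 z hz)]
      exact ho z hz
    obtain ⟨p, hp, hpe⟩ := (natCast_le_analyticOrderAt (hha z hz)).1 h1
    refine ⟨fun x => p x / b x, hp.div hb hbz, ?_⟩
    filter_upwards [hbe, hpe, hb.continuousAt.eventually_ne hbz] with x e1 e2 e3
    rw [e1, e2, smul_eq_mul, smul_eq_mul]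
    field_simp
  set k : ℂ → ℂ := fun z => limUnder (𝓝[≠] z) fun x => h x / B x with hk
  have hkq : ∀ z ∈ U, ∀ q : ℂ → ℂ, AnalyticAt ℂ q z → (∀ᶠ x in 𝓝 z, h x = B x * q x) →
      k z = q z := by
    intro z hz q hq hqe
    refine Tendsto.limUnder_eq ((hq.continuousAt.tendsto.mono_left nhdsWithin_le_nhds).congr' ?_)
    filter_upwards [eventually_ne_zero_of_order (hBa z hz) (hB0 z hz),
      hqe.filter_mono nhdsWithin_le_nhds] with x e1 e2
    rw [e2, mul_div_cancel_left₀ _ e1]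
  refine ⟨k, fun z hz => ?_, fun z hz => ?_⟩
  · obtain ⟨q, hq, hqe⟩ := hloc z hz
    refine (DifferentiableAt.congr_of_eventuallyEq hq.differentiableAt ?_).differentiableWithinAt
    filter_upwards [hq.eventually_analyticAt, hqe.eventually_nhds, hU.mem_nhds hz] with x e1 e2 e3
    exact hkq x e3 q e1 e2
  · obtain ⟨q, hq, hqe⟩ := hloc z hz
    rw [hkq z hz q hq hqe]
    exact hqe.self_of_nhds

/-- The bound is clear where `B ≠ 0` and extends across the isolated zeros by continuity. -/
lemma norm_quotient_le {U : Set ℂ} (hU : IsOpen U) {h B k : ℂ → ℂ} {C : ℝ}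
    (hB : DifferentiableOn ℂ B U) (hk : DifferentiableOn ℂ k U)
    (hB0 : ∀ z ∈ U, analyticOrderAt B z ≠ ⊤) (he : ∀ z ∈ U, h z = B z * k z)
    (hC : ∀ z ∈ U, ‖h z‖ ≤ C * ‖B z‖) {z : ℂ} (hz : z ∈ U) : ‖k z‖ ≤ C := by
  have h1 : Tendsto (fun x => ‖k x‖) (𝓝[≠] z) (𝓝 ‖k z‖) :=
    ((hk.differentiableAt (hU.mem_nhds hz)).continuousAt.norm.tendsto).mono_left
      nhdsWithin_le_nhds
  refine le_of_tendsto h1 ?_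
  filter_upwards [eventually_ne_zero_of_order (hB.analyticOnNhd hU z hz) (hB0 z hz),
    mem_nhdsWithin_of_mem_nhds (hU.mem_nhds hz)] with x e1 e2
  have e3 := hC x e2
  rw [he x e2, norm_mul, mul_comm] at e3
  exact le_of_mul_le_mul_right e3 (norm_pos_iff.2 e1)

/-! ### Conformal maps of the disk onto the strip -/

/-- The conformal map of the disk onto the strip that sends `0` to `log a`. -/
def stripMap (a u : ℂ) : ℂ := Complex.log ((a - starRingEnd ℂ a * u) / (1 - u))

lemma one_sub_ne_zero_of_mem_ball {u : ℂ} (hu : u ∈ Metric.ball (0 : ℂ) 1) :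
    1 - u ≠ 0 := fun h => by
  rw [← sub_eq_zero.1 h, mem_ball_zero_iff, norm_one] at hu
  exact lt_irrefl _ hu

lemma stripMap_aux_im {a u : ℂ} (ha : a.im < 0) (hu : u ∈ Metric.ball (0 : ℂ) 1) :
    ((a - starRingEnd ℂ a * u) / (1 - u)).im < 0 := by
  have h1 : 0 < Complex.normSq (1 - u) := Complex.normSq_pos.2 (one_sub_ne_zero_of_mem_ball hu)
  have h2 : ((a - starRingEnd ℂ a * u) / (1 - u)).im
      = a.im * (1 - Complex.normSq u) / Complex.normSq (1 - u) := by
    rw [Complex.div_im, ← sub_div, Complex.normSq_apply u]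
    congr 1
    simp
    ring
  have h3 : Complex.normSq u < 1 := by
    rw [mem_ball_zero_iff] at hu
    rw [Complex.normSq_eq_norm_sq]
    nlinarith [norm_nonneg u]
  rw [h2]
  exact div_neg_of_neg_of_pos (mul_neg_of_neg_of_pos ha (by linarith)) h1

lemma stripMap_mem {a u : ℂ} (ha : a.im < 0) (hu : u ∈ Metric.ball (0 : ℂ) 1) :
    stripMap a u ∈ strip :=
  ⟨Complex.neg_pi_lt_log_im _, by
    rw [stripMap, Complex.log_im]
    exact Complex.arg_neg_iff.2 (stripMap_aux_im ha hu)⟩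

lemma differentiableOn_stripMap {a : ℂ} (ha : a.im < 0) :
    DifferentiableOn ℂ (stripMap a) (Metric.ball 0 1) :=
  (DifferentiableOn.div (by fun_prop) (by fun_prop)
    fun _ hu => one_sub_ne_zero_of_mem_ball hu).clog fun _ hu => Or.inr (stripMap_aux_im ha hu).ne

lemma stripMap_zero {α : ℂ} (hα : α ∈ strip) : stripMap (Complex.exp α) 0 = α := by
  rw [stripMap, mul_zero, sub_zero, sub_zero, div_one,
    Complex.log_exp hα.1 (hα.2.le.trans Real.pi_pos.le)]

/-- The unnormalized Blaschke factor inverts `stripMap`. The Schwarz lemma of the disk therefore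
becomes a bound by a Blaschke factor. -/
lemma stripMap_apply {α ζ : ℂ} (hα : α ∈ strip) (hζ : ζ ∈ strip) :
    stripMap (Complex.exp α) ((Complex.exp ζ - Complex.exp α) /
      (Complex.exp ζ - Complex.exp (starRingEnd ℂ α))) = ζ := by
  have h1 := sub_exp_conj_ne_zero hα (exp_im_neg hζ).le
  rw [Complex.exp_conj] at h1 ⊢
  have ha := exp_im_neg hα
  set a := Complex.exp α
  set w := Complex.exp ζ with hw
  have h2 : a - starRingEnd ℂ a ≠ 0 := fun h => by
    have := congrArg Complex.im h
    simp at this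
    linarith
  have h3 : 1 - (w - a) / (w - starRingEnd ℂ a) = (a - starRingEnd ℂ a) / (w - starRingEnd ℂ a) := by
    field_simp
    ring
  have h4 : a - starRingEnd ℂ a * ((w - a) / (w - starRingEnd ℂ a))
      = w * (a - starRingEnd ℂ a) / (w - starRingEnd ℂ a) := by
    field_simp
    ring
  have h5 : w * (a - starRingEnd ℂ a) / (w - starRingEnd ℂ a)
      / ((a - starRingEnd ℂ a) / (w - starRingEnd ℂ a)) = w := by
    field_simp
  rw [stripMap, h3, h4, h5, hw, Complex.log_exp hζ.1 (hζ.2.le.trans Real.pi_pos.le)]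

lemma norm_blaschkeFactor_eq {α : ℂ} (hα : α ∈ strip) (ζ : ℂ) :
    ‖blaschkeFactor α ζ‖ = ‖(Complex.exp ζ - Complex.exp α) /
      (Complex.exp ζ - Complex.exp (starRingEnd ℂ α))‖ := by
  rw [blaschkeFactor, norm_mul, norm_blaschkeConst hα, one_mul]

lemma norm_blaschkeFactor_lt_one {α ζ : ℂ} (hα : α ∈ strip) (hζ : ζ ∈ strip) :
    ‖blaschkeFactor α ζ‖ < 1 := by
  have h1 := one_sub_norm_blaschkeFactor_sq hα (exp_im_neg hζ).le
  have h2 : 0 < 4 * (Complex.exp ζ).im * (Complex.exp α).im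
      / ‖Complex.exp ζ - Complex.exp (starRingEnd ℂ α)‖ ^ 2 :=
    div_pos (by nlinarith [exp_im_neg hζ, exp_im_neg hα])
      (pow_pos (norm_pos_iff.2 (sub_exp_conj_ne_zero hα (exp_im_neg hζ).le)) 2)
  nlinarith [norm_nonneg (blaschkeFactor α ζ)]

/-- The **Schwarz lemma** on the strip. -/
lemma norm_le_mul_norm_blaschkeFactor {g : ℂ → ℂ} {C : ℝ}
    (hg : DifferentiableOn ℂ g strip) (hC : ∀ z ∈ strip, ‖g z‖ ≤ C) {α : ℂ} (hα : α ∈ strip)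
    (h0 : g α = 0) {ζ : ℂ} (hζ : ζ ∈ strip) : ‖g ζ‖ ≤ C * ‖blaschkeFactor α ζ‖ := by
  have ha := exp_im_neg hα
  have h1 := Complex.dist_le_div_mul_dist_of_mapsTo_ball (R₂ := C)
    (hg.comp (differentiableOn_stripMap ha) fun _ hu => stripMap_mem ha hu)
    (fun u hu => by
      rw [Function.comp_apply, Function.comp_apply, stripMap_zero hα, h0, mem_closedBall_zero_iff]
      exact hC _ (stripMap_mem ha hu))
    (mem_ball_zero_iff.2 (by
      rw [← norm_blaschkeFactor_eq hα ζ]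
      exact norm_blaschkeFactor_lt_one hα hζ))
  rw [Function.comp_apply, Function.comp_apply, stripMap_zero hα, stripMap_apply hα hζ, h0,
    dist_zero_right, dist_zero_right, div_one, ← norm_blaschkeFactor_eq hα] at h1
  exact h1

lemma neg_pi_div_two_mem_strip : -((Real.pi : ℂ) / 2) * Complex.I ∈ strip := by
  have := Real.pi_pos
  constructor <;> simp <;> linarith

/-- Nonvanishing analytic functions on the strip have logarithms. -/
lemma exists_log_strip {k : ℂ → ℂ} (hk : DifferentiableOn ℂ k strip) (h0 : ∀ z ∈ strip, k z ≠ 0) :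
    ∃ L : ℂ → ℂ, DifferentiableOn ℂ L strip ∧ ∀ z ∈ strip, k z = Complex.exp (L z) := by
  set α : ℂ := -((Real.pi : ℂ) / 2) * Complex.I
  have hα : α ∈ strip := neg_pi_div_two_mem_strip
  have ha := exp_im_neg hα
  set K : ℂ → ℂ := fun u => k (stripMap (Complex.exp α) u) with hK
  have hKd : DifferentiableOn ℂ K (Metric.ball 0 1) :=
    hk.comp (differentiableOn_stripMap ha) fun _ hu => stripMap_mem ha hu
  have hK0 : ∀ u ∈ Metric.ball (0 : ℂ) 1, K u ≠ 0 := fun u hu => h0 _ (stripMap_mem ha hu)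
  -- On the disk `K' / K` has a primitive `g`, and `K exp (-g)` is constant, so `g` is a logarithm
  -- of `K` up to a constant.
  obtain ⟨g, hg⟩ := ((hKd.deriv Metric.isOpen_ball).div hKd hK0).isExactOn_ball
  have hconst : ∀ u ∈ Metric.ball (0 : ℂ) 1,
      K u * Complex.exp (-g u) = K 0 * Complex.exp (-g 0) := by
    have hd : ∀ u ∈ Metric.ball (0 : ℂ) 1,
        HasDerivAt (fun u => K u * Complex.exp (-g u)) 0 u := fun u hu => by
      have h1 := (hKd.differentiableAt (Metric.isOpen_ball.mem_nhds hu)).hasDerivAt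
      have h2 := h1.mul (hg u hu).neg.cexp
      convert! h2 using 1
      have := hK0 u hu
      simp only [Pi.div_apply]
      field_simp
      ring
    intro u hu
    exact Metric.isOpen_ball.is_const_of_deriv_eq_zero (convex_ball _ _).isPreconnected
      (fun u hu => (hd u hu).differentiableAt.differentiableWithinAt)
      (fun u hu => (hd u hu).deriv) hu (Metric.mem_ball_self one_pos)
  have hc : K 0 * Complex.exp (-g 0) ≠ 0 :=
    mul_ne_zero (hK0 0 (Metric.mem_ball_self one_pos)) (Complex.exp_ne_zero _)
  set p : ℂ → ℂ := fun ζ => (Complex.exp ζ - Complex.exp α) /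
    (Complex.exp ζ - Complex.exp (starRingEnd ℂ α)) with hp
  have hpd : DifferentiableOn ℂ p strip := DifferentiableOn.div (by fun_prop) (by fun_prop)
    fun ζ hζ => sub_exp_conj_ne_zero hα (exp_im_neg hζ).le
  have hpm : Set.MapsTo p strip (Metric.ball 0 1) := fun ζ hζ => by
    rw [mem_ball_zero_iff, hp]
    rw [← norm_blaschkeFactor_eq hα ζ]
    exact norm_blaschkeFactor_lt_one hα hζ
  have hgd : DifferentiableOn ℂ g (Metric.ball 0 1) := fun u hu =>
    (hg u hu).differentiableAt.differentiableWithinAt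
  refine ⟨fun ζ => g (p ζ) + Complex.log (K 0 * Complex.exp (-g 0)),
    (hgd.comp hpd hpm).add_const _, fun ζ hζ => ?_⟩
  rw [Complex.exp_add, Complex.exp_log hc, ← hconst _ (hpm hζ), mul_left_comm, ← Complex.exp_add,
    add_neg_cancel, Complex.exp_zero, mul_one, hK]
  simp only [hp, stripMap_apply hα hζ]

/-! ### The zeros of a bounded analytic function -/

lemma analyticAt_of_strip {g : ℂ → ℂ} (hg : DifferentiableOn ℂ g strip) {z : ℂ} (hz : z ∈ strip) :
    AnalyticAt ℂ g z := hg.analyticOnNhd isOpen_strip z hz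

lemma analyticOrderAt_blaschkeFactor_self {α : ℂ} (hα : α ∈ strip) :
    analyticOrderAt (blaschkeFactor α) α = 1 := by
  refine (analyticAt_of_strip (differentiableOn_blaschkeFactor hα)
    hα).analyticOrderAt_eq_one_of_zero_deriv_ne_zero
    ((blaschkeFactor_eq_zero hα hα).2 rfl) ?_
  have h0 := sub_exp_conj_ne_zero hα (exp_im_neg hα).le
  have h1 : HasDerivAt (blaschkeFactor α) _ α :=
    (((Complex.hasDerivAt_exp α).sub_const (Complex.exp α)).div
      ((Complex.hasDerivAt_exp α).sub_const (Complex.exp (starRingEnd ℂ α))) h0).const_mul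
      (blaschkeConst α)
  rw [h1.deriv, sub_self, zero_mul, sub_zero]
  exact mul_ne_zero (blaschkeConst_ne_zero hα)
    (div_ne_zero (mul_ne_zero (Complex.exp_ne_zero _) h0) (pow_ne_zero 2 h0))

lemma analyticOrderAt_blaschkeFactor_of_ne {α z : ℂ} (hα : α ∈ strip) (hz : z ∈ strip)
    (h : α ≠ z) : analyticOrderAt (blaschkeFactor α) z = 0 := by
  rw [(analyticAt_of_strip (differentiableOn_blaschkeFactor hα) hz).analyticOrderAt_eq_zero]
  exact fun h1 => h ((blaschkeFactor_eq_zero hα hz).1 h1).symm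

lemma differentiableOn_prod_blaschkeFactor {ι : Type} {α : ι → ℂ} (hα : ∀ j, α j ∈ strip)
    (s : Finset ι) : DifferentiableOn ℂ (fun ζ => ∏ j ∈ s, blaschkeFactor (α j) ζ) strip :=
  DifferentiableOn.fun_finsetProd fun j _ => differentiableOn_blaschkeFactor (hα j)

open Classical in
lemma analyticOrderAt_prod_blaschkeFactor {ι : Type} {α : ι → ℂ} (hα : ∀ j, α j ∈ strip)
    (s : Finset ι) {z : ℂ} (hz : z ∈ strip) :
    analyticOrderAt (fun ζ => ∏ j ∈ s, blaschkeFactor (α j) ζ) z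
      = ((s.filter fun j => α j = z).card : ℕ∞) := by
  induction s using Finset.induction_on with
  | empty => simp [analyticOrderAt_eq_zero]
  | insert j s hj ih =>
    have e : (fun ζ => ∏ i ∈ insert j s, blaschkeFactor (α i) ζ)
        = blaschkeFactor (α j) * fun ζ => ∏ i ∈ s, blaschkeFactor (α i) ζ := by
      ext ζ
      rw [Finset.prod_insert hj]
      rfl
    rw [e, analyticOrderAt_mul (analyticAt_of_strip (differentiableOn_blaschkeFactor (hα j)) hz)
      (analyticAt_of_strip (differentiableOn_prod_blaschkeFactor hα s) hz), ih,
      Finset.filter_insert]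
    split_ifs with h
    · subst h
      rw [analyticOrderAt_blaschkeFactor_self (hα j), Finset.card_insert_of_notMem (by simp [hj])]
      push_cast
      rw [add_comm]
    · rw [analyticOrderAt_blaschkeFactor_of_ne (hα j) hz h, zero_add]

/-- The zeros of `h` in the strip, repeated according to multiplicity. -/
def ZeroIndex (h : ℂ → ℂ) : Type := Σ z : {z : ℂ // z ∈ strip}, Fin (analyticOrderNatAt h z)

/-- The zero with a given index. -/
def zeroAt {h : ℂ → ℂ} (j : ZeroIndex h) : ℂ := j.1

lemma zeroAt_mem {h : ℂ → ℂ} (j : ZeroIndex h) : zeroAt j ∈ strip := j.1.2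

/-- The indices of a given point. -/
def indicesAt (h : ℂ → ℂ) {z : ℂ} (hz : z ∈ strip) : Finset (ZeroIndex h) :=
  Finset.univ.map ⟨fun k : Fin (analyticOrderNatAt h z) => ⟨⟨z, hz⟩, k⟩,
    fun _ _ hab => eq_of_heq (Sigma.mk.inj hab).2⟩

lemma mem_indicesAt {h : ℂ → ℂ} {z : ℂ} (hz : z ∈ strip) {j : ZeroIndex h} :
    j ∈ indicesAt h hz ↔ zeroAt j = z := by
  constructor
  · intro hj
    obtain ⟨k, -, rfl⟩ := Finset.mem_map.1 hj
    rfl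
  · rintro rfl
    exact Finset.mem_map.2 ⟨j.2, Finset.mem_univ _, rfl⟩

lemma card_indicesAt {h : ℂ → ℂ} {z : ℂ} (hz : z ∈ strip) :
    (indicesAt h hz).card = analyticOrderNatAt h z := by
  rw [indicesAt, Finset.card_map, Finset.card_univ, Fintype.card_fin]

section

variable {h : ℂ → ℂ} {C : ℝ}

lemma order_ne_top (hh : DifferentiableOn ℂ h strip) (hne : ∃ z ∈ strip, h z ≠ 0) {z : ℂ}
    (hz : z ∈ strip) : analyticOrderAt h z ≠ ⊤ := by
  obtain ⟨z₀, hz₀, h0⟩ := hne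
  refine (hh.analyticOnNhd isOpen_strip).analyticOrderAt_ne_top_of_isPreconnected
    convex_strip.isPreconnected hz₀ hz ?_
  rw [(analyticAt_of_strip hh hz₀).analyticOrderAt_eq_zero.2 h0]
  exact ENat.zero_ne_top

/-- Zeros are divided out one at a time. An index not yet used means the remaining factor still
vanishes at that point, and the Schwarz lemma keeps the bound `C`. -/
lemma exists_quotient_finite (hh : DifferentiableOn ℂ h strip) (hC : ∀ z ∈ strip, ‖h z‖ ≤ C)
    (hne : ∃ z ∈ strip, h z ≠ 0) (s : Finset (ZeroIndex h)) :
    ∃ g : ℂ → ℂ, DifferentiableOn ℂ g strip ∧ (∀ z ∈ strip, ‖g z‖ ≤ C) ∧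
      ∀ z ∈ strip, h z = (∏ j ∈ s, blaschkeFactor (zeroAt j) z) * g z := by
  classical
  induction s using Finset.induction_on with
  | empty => exact ⟨h, hh, hC, fun z _ => by simp⟩
  | insert j s hj ih =>
    obtain ⟨g, hg, hgC, he⟩ := ih
    set α := zeroAt j with hαdef
    have hα : α ∈ strip := zeroAt_mem j
    have hF := differentiableOn_prod_blaschkeFactor (α := zeroAt (h := h)) zeroAt_mem s
    have hord : (analyticOrderNatAt h α : ℕ∞)
        = ((s.filter fun i => zeroAt i = α).card : ℕ∞) + analyticOrderAt g α := by
      rw [Nat.cast_analyticOrderNatAt (order_ne_top hh hne hα),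
        ← analyticOrderAt_prod_blaschkeFactor zeroAt_mem s hα,
        ← analyticOrderAt_mul (analyticAt_of_strip hF hα) (analyticAt_of_strip hg hα)]
      refine analyticOrderAt_congr ?_
      filter_upwards [isOpen_strip.mem_nhds hα] with z hz
      exact he z hz
    -- There are exactly as many indices over `α` as its multiplicity, and `j` is one that `s`
    -- misses.
    have hcard : (s.filter fun i => zeroAt i = α).card < analyticOrderNatAt h α := by
      rw [← card_indicesAt hα]
      refine Finset.card_lt_card ⟨fun i hi => ?_, fun hsub => ?_⟩
      · exact (mem_indicesAt hα).2 (Finset.mem_filter.1 hi).2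
      · exact hj (Finset.mem_filter.1 (hsub ((mem_indicesAt hα).2 rfl))).1
    have hgo : analyticOrderAt g α ≠ 0 := fun h0 => by
      rw [h0, add_zero, Nat.cast_inj] at hord
      omega
    have hg0 : g α = 0 := apply_eq_zero_of_analyticOrderAt_ne_zero hgo
    have hb := differentiableOn_blaschkeFactor hα
    have hb0 : ∀ z ∈ strip, analyticOrderAt (blaschkeFactor α) z ≠ ⊤ := fun z hz => by
      by_cases h1 : α = z
      · subst h1
        rw [analyticOrderAt_blaschkeFactor_self hα]
        exact ENat.one_ne_top
      · rw [analyticOrderAt_blaschkeFactor_of_ne hα hz h1]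
        exact ENat.zero_ne_top
    obtain ⟨k, hk, hke⟩ := exists_analytic_quotient isOpen_strip hg hb hb0 fun z hz => by
      by_cases h1 : α = z
      · subst h1
        rw [analyticOrderAt_blaschkeFactor_self hα]
        exact Order.one_le_iff_ne_zero.2 hgo
      · rw [analyticOrderAt_blaschkeFactor_of_ne hα hz h1]
        exact zero_le
    refine ⟨k, hk, fun z hz => norm_quotient_le isOpen_strip hb hk hb0 hke
      (fun x hx => norm_le_mul_norm_blaschkeFactor hg hgC hα hg0 hx) hz, fun z hz => ?_⟩
    rw [Finset.prod_insert hj, he z hz, hke z hz]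
    ring

lemma norm_le_mul_norm_prod (hh : DifferentiableOn ℂ h strip) (hC : ∀ z ∈ strip, ‖h z‖ ≤ C)
    (hne : ∃ z ∈ strip, h z ≠ 0) (s : Finset (ZeroIndex h)) {z : ℂ} (hz : z ∈ strip) :
    ‖h z‖ ≤ C * ‖∏ j ∈ s, blaschkeFactor (zeroAt j) z‖ := by
  obtain ⟨g, -, hg, he⟩ := exists_quotient_finite hh hC hne s
  rw [he z hz, norm_mul, mul_comm]
  exact mul_le_mul_of_nonneg_right (hg z hz) (norm_nonneg _)

/-- The zeros of a bounded analytic function satisfy the Blaschke condition. -/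
theorem summable_blaschke (hh : DifferentiableOn ℂ h strip) (hC : ∀ z ∈ strip, ‖h z‖ ≤ C)
    (hne : ∃ z ∈ strip, h z ≠ 0) :
    Summable fun j : ZeroIndex h => 1 - ‖diskPoint (zeroAt j)‖ := by
  -- At a point where `h ≠ 0`, the bound by finite products and `1 - t ≤ -log t` bound the partial
  -- sums uniformly. The comparison constant `K` then passes from Blaschke factors to disk points.
  obtain ⟨z₀, hz₀, h0⟩ := id hne
  obtain ⟨K, hK⟩ := exists_one_sub_norm_le hz₀
  have hpos : 0 < ‖h z₀‖ := norm_pos_iff.2 h0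
  have hC0 : 0 < C := hpos.trans_le (hC z₀ hz₀)
  have h1 : Summable fun j : ZeroIndex h => 1 - ‖blaschkeFactor (zeroAt j) z₀‖ := by
    refine summable_of_sum_le (c := -Real.log (‖h z₀‖ / C))
      (fun j => by
        have := norm_blaschkeFactor_le_one (zeroAt_mem j) hz₀
        simpa using this) fun s => ?_
    have h2 := norm_le_mul_norm_prod hh hC hne s hz₀
    rw [norm_prod] at h2
    have h3 : 0 < ∏ j ∈ s, ‖blaschkeFactor (zeroAt j) z₀‖ := by
      by_contra h4
      nlinarith
    have h4 : ∀ j ∈ s, ‖blaschkeFactor (zeroAt j) z₀‖ ≠ 0 := Finset.prod_ne_zero_iff.1 h3.ne'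
    calc ∑ j ∈ s, (1 - ‖blaschkeFactor (zeroAt j) z₀‖)
        ≤ ∑ j ∈ s, -Real.log ‖blaschkeFactor (zeroAt j) z₀‖ := by
          refine Finset.sum_le_sum fun j hj => ?_
          linarith [Real.log_le_sub_one_of_pos ((norm_nonneg _).lt_of_ne' (h4 j hj))]
      _ = -Real.log (∏ j ∈ s, ‖blaschkeFactor (zeroAt j) z₀‖) := by
          rw [Finset.sum_neg_distrib, Real.log_prod h4]
      _ ≤ -Real.log (‖h z₀‖ / C) := by
          refine neg_le_neg (Real.log_le_log (by positivity) ?_)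
          rw [div_le_iff₀ hC0, mul_comm]
          exact h2
  exact Summable.of_nonneg_of_le
    (fun j => by linarith [norm_diskPoint_lt_one (zeroAt_mem j)])
    (fun j => hK _ (zeroAt_mem j)) (h1.mul_left K)

/-- Only finitely many factors vanish at `z`, as many as the multiplicity. The remaining product
converges absolutely with nonzero factors, so it does not vanish at `z`. -/
lemma analyticOrderAt_blaschkeProduct_zeros (hh : DifferentiableOn ℂ h strip)
    (hne : ∃ z ∈ strip, h z ≠ 0)
    (hs : Summable fun j : ZeroIndex h => 1 - ‖diskPoint (zeroAt j)‖) {z : ℂ} (hz : z ∈ strip) :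
    analyticOrderAt (blaschkeProduct (zeroAt (h := h))) z = analyticOrderAt h z := by
  classical
  set s := indicesAt h hz with hsdef
  let α : ↥((s : Set (ZeroIndex h))ᶜ) → ℂ := fun j => zeroAt j.1
  have hα : ∀ j, α j ∈ strip := fun j => zeroAt_mem j.1
  have hαs : Summable fun j => 1 - ‖diskPoint (α j)‖ := hs.subtype _
  set T := blaschkeProduct α with hT
  have hTd : DifferentiableOn ℂ T strip := differentiableOn_blaschkeProduct hα hαs
  have hF := differentiableOn_prod_blaschkeFactor (α := zeroAt (h := h)) zeroAt_mem s
  have hT0 : T z ≠ 0 := by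
    have h1 := tprod_one_add_ne_zero_of_summable
      (f := fun j => blaschkeFactor (α j) z - 1)
      (fun j => by
        rw [add_sub_cancel]
        intro h2
        exact j.2 ((mem_indicesAt hz).2
          ((blaschkeFactor_eq_zero (hα j) hz).1 h2).symm))
      (summable_norm_blaschkeFactor_sub_one hα hαs hz)
    simp only [add_sub_cancel] at h1
    exact h1
  have h1 : analyticOrderAt (blaschkeProduct (zeroAt (h := h))) z
      = analyticOrderAt ((fun ζ => ∏ j ∈ s, blaschkeFactor (zeroAt j) ζ) * T) z := by
    refine analyticOrderAt_congr ?_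
    filter_upwards [isOpen_strip.mem_nhds hz] with ζ hζ
    exact blaschkeProduct_eq_mul zeroAt_mem hs s hζ
  have h2 : s.filter (fun j => zeroAt j = z) = s :=
    Finset.filter_true_of_mem fun j hj => (mem_indicesAt hz).1 hj
  rw [h1, analyticOrderAt_mul (analyticAt_of_strip hF hz) (analyticAt_of_strip hTd hz),
    (analyticAt_of_strip hTd hz).analyticOrderAt_eq_zero.2 hT0, add_zero,
    analyticOrderAt_prod_blaschkeFactor zeroAt_mem s hz, h2, card_indicesAt,
    Nat.cast_analyticOrderNatAt (order_ne_top hh hne hz)]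

/-- The quotient of a bounded analytic function by the Blaschke product of its zeros. -/
theorem exists_quotient_blaschke (hh : DifferentiableOn ℂ h strip) (hC : ∀ z ∈ strip, ‖h z‖ ≤ C)
    (hne : ∃ z ∈ strip, h z ≠ 0) :
    ∃ k : ℂ → ℂ, DifferentiableOn ℂ k strip ∧ (∀ z ∈ strip, ‖k z‖ ≤ C) ∧
      (∀ z ∈ strip, k z ≠ 0) ∧
      ∀ z ∈ strip, h z = blaschkeProduct (zeroAt (h := h)) z * k z := by
  have hs := summable_blaschke hh hC hne
  have hB := differentiableOn_blaschkeProduct (α := zeroAt (h := h)) zeroAt_mem hs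
  have hord := fun z (hz : z ∈ strip) => analyticOrderAt_blaschkeProduct_zeros hh hne hs hz
  have htop := fun z (hz : z ∈ strip) => order_ne_top hh hne hz
  have hB0 : ∀ z ∈ strip, analyticOrderAt (blaschkeProduct (zeroAt (h := h))) z ≠ ⊤ :=
    fun z hz => by rw [hord z hz]; exact htop z hz
  obtain ⟨k, hk, he⟩ := exists_analytic_quotient isOpen_strip hh hB hB0
    fun z hz => (hord z hz).le
  refine ⟨k, hk, fun z hz => norm_quotient_le isOpen_strip hB hk hB0 he (fun x hx => ?_) hz,
    fun z hz => ?_, he⟩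
  -- The bound by finite products is uniform in the finite set, so it passes to the infinite
  -- product.
  · exact ge_of_tendsto ((hasProd_blaschkeProduct zeroAt_mem hs hx).norm.const_mul C)
      (Eventually.of_forall fun s => by
        have := norm_le_mul_norm_prod hh hC hne s hx
        rwa [norm_prod] at this)
  · have h1 : analyticOrderAt h z
        = analyticOrderAt (blaschkeProduct (zeroAt (h := h)) * k) z := by
      refine analyticOrderAt_congr ?_
      filter_upwards [isOpen_strip.mem_nhds hz] with ζ hζ
      exact he ζ hζ
    rw [analyticOrderAt_mul (analyticAt_of_strip hB hz) (analyticAt_of_strip hk hz), hord z hz] at h1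
    rw [← (analyticAt_of_strip hk hz).analyticOrderAt_eq_zero]
    exact (ENat.add_right_injective_of_ne_top (htop z hz)) (by simpa using h1.symm)

end

/-! ### Existence of the Beurling factorization -/

lemma integral_halfKernel_lebesgue (μ : Measure ℝ) [IsFiniteMeasure μ] {w : ℂ} (hw : w.im < 0) :
    ∫ s, halfKernel w s ∂μ = (∫ s, halfKernel w s ∂(μ.singularPart volume))
      + ∫ s, halfKernel w s * ((μ.rnDeriv volume s).toReal : ℂ) := by
  have h4 := integrable_halfKernel (μ := μ) hw
  have h5 : ∫ s, halfKernel w s ∂(volume.withDensity (μ.rnDeriv volume))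
      = ∫ s, halfKernel w s * ((μ.rnDeriv volume s).toReal : ℂ) := by
    rw [integral_withDensity_eq_integral_toReal_smul (Measure.measurable_rnDeriv _ _)
      (Measure.rnDeriv_lt_top _ _)]
    simp only [Complex.real_smul, mul_comm]
  rw [← h5]
  conv_lhs => rw [← μ.singularPart_add_rnDeriv volume]
  rw [integral_add_measure]
  · exact h4.mono_measure (Measure.singularPart_le _ _)
  · exact h4.mono_measure (Measure.withDensity_rnDeriv_le _ _)

lemma integrable_inv_one_add_sq' : Integrable fun s : ℝ => 1 / (1 + s ^ 2) := by
  simpa only [one_div] using integrable_inv_one_add_sq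

/-- This is the outer integral of a constant modulus: its real part is known from the mass of the
Poisson kernel, and the value at the centre removes the imaginary constant. -/
lemma integral_kernel_div {ζ : ℂ} (hζ : ζ ∈ strip) :
    ∫ s, kernel ζ s * ((1 / (1 + s ^ 2) : ℝ) : ℂ) = Complex.I * Real.pi := by
  have hi := integrable_inv_one_add_sq'
  obtain ⟨c, hc⟩ := exists_const_of_re_eq isOpen_strip convex_strip.isPreconnected
    ((differentiableOn_integral_kernel_mul hi.ofReal).const_mul (-Complex.I))
    (differentiableOn_const (Real.pi : ℂ)) fun z hz => by
      have h1 := re_neg_I_mul_integral hi (exp_im_neg hz)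
      refine h1.trans ?_
      rw [Complex.ofReal_re, ← (integral_poisson (exp_im_neg hz)).2]
      refine integral_congr_ae (Eventually.of_forall fun s => ?_)
      have : 1 + s ^ 2 ≠ 0 := by positivity
      simp only
      field_simp
  have hp := neg_pi_div_two_mem_strip
  have h2 : ∀ s : ℝ, kernel (-((Real.pi : ℂ) / 2) * Complex.I) s = Complex.I := fun s => by
    have he : Complex.exp (-((Real.pi : ℂ) / 2) * Complex.I) = -Complex.I := by
      rw [neg_mul, Complex.exp_neg, Complex.exp_pi_div_two_mul_I, Complex.inv_I]
    have h3 : -Complex.I - (s : ℂ) ≠ 0 := fun h => by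
      have := congrArg Complex.im h
      simp at this
    rw [kernel, he, div_eq_iff h3]
    linear_combination Complex.I_sq
  have h4 : ∫ s : ℝ, Complex.I * ((1 / (1 + s ^ 2) : ℝ) : ℂ) = Complex.I * Real.pi := by
    rw [integral_const_mul, integral_complex_ofReal]
    simp only [one_div, integral_univ_inv_one_add_sq]
  have h5 := hc _ hp
  simp only [h2] at h5
  have h6 : -Complex.I * ∫ s : ℝ, Complex.I * ((1 / (1 + s ^ 2) : ℝ) : ℂ) = Real.pi := by
    rw [h4]
    linear_combination -Real.pi * Complex.I_sq
  have h7 : (c : ℂ) * Complex.I = 0 := by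
    have := h6.symm.trans h5
    linear_combination -this
  have h8 := hc ζ hζ
  rw [h7, add_zero] at h8
  have h9 := congrArg (fun x => Complex.I * x) h8
  linear_combination h9 + (∫ s, kernel ζ s * ((1 / (1 + s ^ 2) : ℝ) : ℂ)) * Complex.I_sq

/-- Bounded analytic functions that do not vanish identically have a Beurling factorization. -/
theorem nonempty_beurlingFactorization {h : ℂ → ℂ} (hh : IsBddAnalytic h)
    (hne : ∃ z ∈ strip, h z ≠ 0) : Nonempty (BeurlingFactorization h) := by
  obtain ⟨C, hC⟩ := hh.bounded
  have hC0 : 0 < C := by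
    obtain ⟨z, hz, h0⟩ := hne
    exact (norm_pos_iff.2 h0).trans_le (hC z hz)
  obtain ⟨k, hk, hkC, hk0, he⟩ := exists_quotient_blaschke hh.analytic hC hne
  obtain ⟨L, hL, hLe⟩ := exists_log_strip hk hk0
  -- Since `|k| ≤ C` with `k = exp L`, the function `log C - L` has nonnegative real part.
  obtain ⟨μ, hμ, m, c, hm, hF⟩ := herglotz_strip (F := fun z => (Real.log C : ℂ) - L z)
    (hL.const_sub _) fun z hz => by
      have h1 := hkC z hz
      rw [hLe z hz, Complex.norm_exp, ← Real.le_log_iff_exp_le hC0] at h1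
      rw [Complex.sub_re, Complex.ofReal_re]
      linarith
  set ρ : ℝ → ℝ := fun s => (μ.rnDeriv volume s).toReal with hρdef
  have hρ : Integrable ρ := Measure.integrable_toReal_rnDeriv
  -- The outer density absorbs the constant `log C` and the absolutely continuous part of the
  -- Herglotz measure; the factor `π` matches the normalization of `outerOn`.
  set σ : ℝ → ℝ := fun s => Real.log C * (1 / (1 + s ^ 2)) - Real.pi * ρ s with hσdef
  have hσ : Integrable σ := (integrable_inv_one_add_sq'.const_mul _).sub (hρ.const_mul _)
  have hlog : ∀ s : ℝ, Real.log (Real.exp ((1 + s ^ 2) * σ s)) / (1 + s ^ 2) = σ s := fun s => by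
    have : 1 + s ^ 2 ≠ 0 := by positivity
    rw [Real.log_exp, mul_div_cancel_left₀ _ this]
  refine ⟨{
    c := Complex.exp ((-c : ℝ) * Complex.I)
    norm_c := Complex.norm_exp_ofReal_mul_I _
    ι := ZeroIndex h
    α := zeroAt
    α_mem := zeroAt_mem
    blaschke_condition := summable_blaschke hh.analytic hC hne
    ν := μ.singularPart volume
    finite_ν := inferInstance
    singular_ν := μ.mutuallySingular_singularPart volume
    m := m
    m_nonneg := hm
    φ := fun s => Real.exp ((1 + s ^ 2) * σ s)
    φ_pos := fun s => Real.exp_pos _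
    φ_integrable := by simpa only [hlog] using hσ
    factorization := fun ζ hζ => ?_ }⟩
  have hw := exp_im_neg hζ
  have h1 : ∫ s, kernel ζ s * (σ s : ℂ)
      = Real.log C * (Complex.I * Real.pi) - Real.pi * ∫ s, kernel ζ s * (ρ s : ℂ) := by
    rw [← integral_kernel_div hζ, ← integral_const_mul, ← integral_const_mul, ← integral_sub]
    · refine integral_congr_ae (Eventually.of_forall fun s => ?_)
      simp only [hσdef]
      push_cast
      ring
    · exact (integrable_halfKernel_mul integrable_inv_one_add_sq'.ofReal hw).const_mul _
    · exact (integrable_halfKernel_mul hρ.ofReal hw).const_mul _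
  have h2 : ∫ s, kernel ζ s ∂μ = (∫ s, kernel ζ s ∂(μ.singularPart volume))
      + ∫ s, kernel ζ s * (ρ s : ℂ) := integral_halfKernel_lebesgue μ hw
  have h3 := hF ζ hζ
  rw [h2] at h3
  have hpi : (Real.pi : ℂ) ≠ 0 := Complex.ofReal_ne_zero.2 Real.pi_ne_zero
  have h4 : outerFun (fun s => Real.exp ((1 + s ^ 2) * σ s)) ζ
      = Complex.exp (Real.log C + Complex.I * ∫ s, kernel ζ s * (ρ s : ℂ)) := by
    rw [outerFun, outerOn_eq MeasurableSet.univ, Set.indicator_univ]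
    simp only [hlog]
    rw [poissonExp, h1]
    congr 1
    field_simp
    linear_combination -(Real.log C : ℂ) * Complex.I_sq
  rw [he ζ hζ, hLe ζ hζ, h4, singularInner, mul_comm (Complex.exp _) (blaschkeProduct _ _),
    mul_assoc, mul_assoc, ← Complex.exp_add, ← Complex.exp_add]
  congr 2
  push_cast
  linear_combination -h3

end StripHardy

end

/-! ### The main theorem -/

open StripHardy in
theorem mainTheorem9 (h f : ℂ → ℂ)
    (h_analytic : DifferentiableOn ℂ h strip)
    (h_bounded : ∃ C : ℝ, ∀ z ∈ strip, ‖h z‖ ≤ C)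
    (h_symm : ∀ᵐ θ : ℝ, starRingEnd ℂ (upperValue h θ) = lowerValue h θ)
    (h_below : ∃ δ : ℝ, 0 < δ ∧ ∀ᵐ θ : ℝ, δ ≤ ‖upperValue h θ‖ ∧ δ ≤ ‖lowerValue h θ‖)
    (hf : ∀ z ∈ strip, f z = h z ^ 2) :
    ∃ A : Hilb →ₗ.[ℂ] Hilb,
      -- the domain consists of the `ξ` with `h ξ` in the Hardy space
      (∀ ξ : Hilb, ξ ∈ A.domain ↔
        ∃ G : ℂ → ℂ, IsHardy G ∧ HasUpperL2Value G (fun θ => upperValue h θ * ξ θ)) ∧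
      -- the action is `f(θ - πi) ξ(θ - πi)`, where `ξ(θ - πi) = (h ξ)(θ - πi) / h(θ - πi)`
      (∀ ξ : A.domain, ∃ (G : ℂ → ℂ) (b : Hilb), IsHardy G ∧
        HasUpperL2Value G (fun θ => upperValue h θ * (ξ : Hilb) θ) ∧ HasLowerL2Value G b ∧
        A ξ =ᵐ[MeasureTheory.volume] fun θ => lowerValue f θ * (b θ / lowerValue h θ)) ∧
      IsSelfAdjoint A ∧
      boundStateOp f ≤ A ∧
      Nonempty (BeurlingFactorization h) ∧
      ∀ B : BeurlingFactorization h, A = B.canonicalExtension := by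
  have hh : IsBddAnalytic h := ⟨h_analytic, h_bounded⟩
  obtain ⟨δ, hδ, hb⟩ := h_below
  have hu := hb.mono fun _ h1 => h1.1
  have hl := hb.mono fun _ h1 => h1.2
  -- If `h` vanished identically, so would its boundary value almost everywhere, against the lower
  -- bound `δ`. The factorization needs a point where `h ≠ 0`.
  have hne : ∃ z ∈ strip, h z ≠ 0 := by
    by_contra! h0
    obtain ⟨θ, h1, h2⟩ := (hu.and hh.tendsto_upperValue).exists
    have h3 : upperValue h θ = 0 := by
      refine tendsto_nhds_unique h2 (tendsto_const_nhds.congr' ?_)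
      filter_upwards [upper_mem] with y hy
      exact (h0 _ (mem_strip_iff.2 hy)).symm
    rw [h3, norm_zero] at h1
    linarith
  exact ⟨extension h, fun ξ => mem_extension_domain hh,
    extension_apply hh hδ hl h_symm (lowerValue_sq hh hf),
    extension_isSelfAdjoint hh hδ hu,
    boundStateOp_le_extension hh h_symm (upperValue_sq hh hf),
    nonempty_beurlingFactorization hh hne,
    fun B => B.extension_eq_canonicalExtension hh h_symm hδ hb⟩
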